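/- **Theorem.** Consider the following two decision problems. *MaxAvgCut.* Instance: a connected finite multigraph $G$ with edge weights $w_e\in\{-1,1\}$, and a rational number $k\ge -1$ (in particular, $k$ may be an integer). Question: is there a nontrivial partition $(A,B)$ of $V(G)$ (both parts non-empty) such that $$\Big(\sum_{e\in\delta(A)} w_e\Big)\Big/|\delta(A)|\ \ge\ k,$$ where $\delta(A)$ is the set of edges with exactly one end in $A$? *ThinTreeValid.* Instance: a connected finite simple graph $G$, a spanning tree $T$ of $G$, and a rational number $\alpha\in[0,1]$. Question: is $T$ $\alpha$-thin, that is, does $|\delta_T(A)|/|\delta_G(A)|\le\alpha$ hold for every nontrivial partition $(A,B)$ of $V(G)$? Let ThinTreeValid$^{\mathsf C}$ be the complement of ThinTreeValid (the same instances, with YES and NO interchanged). Then $\text{MaxAvgCut}\le_m^P\text{ThinTreeValid}^{\mathsf C}$: there is a function, computable by a Turing machine in time polynomial in the length of the encoded instance, that maps every instance $(G,\mathbf w,k)$ of MaxAvgCut to an instance $(G',T,\alpha)$ of ThinTreeValid such that $G$ has a nontrivial cut of average weight at least $k$ if and only if $T$ is not $\alpha$-thin in $G'$. -/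

import Mathlib

open Computability (Γ' encodeNat)

/-! ### Self-delimiting encodings over a fixed finite alphabet -/

/-- `enc` is self-delimiting: its value can be recovered from any string that starts with it. -/
def SelfDelimiting {α : Type} (enc : α → List Γ') : Prop :=
  ∀ ⦃a b : α⦄ ⦃s t : List Γ'⦄, enc a ++ s = enc b ++ t → a = b ∧ s = t

theorem SelfDelimiting.injective {α : Type} {enc : α → List Γ'} (h : SelfDelimiting enc) :
    Function.Injective enc := fun a b hab =>
  (@h a b [] [] (by rw [hab])).1

theorem selfDelimiting_map_bit_comma {l₁ l₂ : List Bool} {s t : List Γ'}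
    (h : l₁.map Γ'.bit ++ Γ'.comma :: s = l₂.map Γ'.bit ++ Γ'.comma :: t) :
    l₁ = l₂ ∧ s = t := by
  induction l₁ generalizing l₂ with
  | nil => cases l₂ <;> simp_all
  | cons a l₁ ih =>
    cases l₂ with
    | nil => simp at h
    | cons b l₂ =>
      simp only [List.map_cons, List.cons_append, List.cons.injEq, Γ'.bit.injEq] at h
      obtain ⟨h1, h2⟩ := ih h.2
      exact ⟨by rw [h.1, h1], h2⟩

/-- Unary notation, used for the names `0, …, n - 1` of the vertices of a graph. -/
def encodeUnary (i : ℕ) : List Γ' :=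
  (List.replicate i true).map Γ'.bit ++ [Γ'.comma]

/-- Binary notation, used for the rational parameters of the problems. -/
def encodeBinary (x : ℕ) : List Γ' :=
  (encodeNat x).map Γ'.bit ++ [Γ'.comma]

/-- A sign bit followed by the absolute value in binary. -/
def encodeInt (z : ℤ) : List Γ' :=
  Γ'.bit (decide (0 ≤ z)) :: encodeBinary z.natAbs

/-- A weight `1` or `-1`, as a single symbol. -/
def encodeSign (w : ℤˣ) : List Γ' :=
  [Γ'.bit (decide (w = 1))]

/-- An ordered pair, one component after the other. -/
def encodePair {α β : Type} (ea : α → List Γ') (eb : β → List Γ') (x : α × β) : List Γ' :=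
  ea x.1 ++ eb x.2

/-- A list: every item is announced by `bra`, and `ket` marks the end. -/
def encodeList {α : Type} (ea : α → List Γ') (l : List α) : List Γ' :=
  l.flatMap (fun x => Γ'.bra :: ea x) ++ [Γ'.ket]

theorem selfDelimiting_unary : SelfDelimiting encodeUnary := by
  intro a b s t h
  simp only [encodeUnary, List.append_assoc, List.singleton_append] at h
  obtain ⟨h1, h2⟩ := selfDelimiting_map_bit_comma h
  exact ⟨by simpa using congrArg List.length h1, h2⟩

theorem selfDelimiting_binary : SelfDelimiting encodeBinary := by
  intro a b s t h
  simp only [encodeBinary, List.append_assoc, List.singleton_append] at h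
  obtain ⟨h1, h2⟩ := selfDelimiting_map_bit_comma h
  exact ⟨Computability.encodingNatBool.encode_injective h1, h2⟩

theorem selfDelimiting_int : SelfDelimiting encodeInt := by
  intro a b s t h
  simp only [encodeInt, List.cons_append, List.cons.injEq, Γ'.bit.injEq, decide_eq_decide] at h
  obtain ⟨h1, h2⟩ := selfDelimiting_binary h.2
  exact ⟨by omega, h2⟩

theorem selfDelimiting_sign : SelfDelimiting encodeSign := by
  intro a b s t h
  simp only [encodeSign, List.cons_append, List.nil_append, List.cons.injEq, Γ'.bit.injEq,
    decide_eq_decide] at h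
  refine ⟨?_, h.2⟩
  rcases Int.units_eq_one_or a with rfl | rfl <;> rcases Int.units_eq_one_or b with rfl | rfl <;>
    simp_all

theorem SelfDelimiting.pair {α β : Type} {ea : α → List Γ'} {eb : β → List Γ'}
    (ha : SelfDelimiting ea) (hb : SelfDelimiting eb) : SelfDelimiting (encodePair ea eb) := by
  rintro ⟨a, b⟩ ⟨a', b'⟩ s t h
  simp only [encodePair, List.append_assoc] at h
  obtain ⟨rfl, h2⟩ := ha h
  obtain ⟨rfl, h3⟩ := hb h2
  exact ⟨rfl, h3⟩

theorem SelfDelimiting.list {α : Type} {ea : α → List Γ'} (ha : SelfDelimiting ea) :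
    SelfDelimiting (encodeList ea) := by
  intro l₁ l₂ s t h
  induction l₁ generalizing l₂ with
  | nil => cases l₂ <;> simp_all [encodeList]
  | cons a l₁ ih =>
    cases l₂ with
    | nil => simp [encodeList] at h
    | cons b l₂ =>
      simp only [encodeList, List.flatMap_cons, List.cons_append, List.append_assoc,
        List.cons.injEq, true_and] at h
      obtain ⟨rfl, h2⟩ := ha h
      obtain ⟨rfl, h3⟩ := @ih l₂ (by simpa [encodeList] using h2)
      exact ⟨rfl, h3⟩

/-! ### Decision problems and polynomial-time many-one reductions -/

/-- A decision problem: a set of instances, each written as a string over a fixed finite alphabet,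
and the set of those instances whose answer is YES. -/
structure DecisionProblem where
  /-- the instances of the problem -/
  Inst : Type
  /-- the string that represents an instance -/
  encode : Inst → List Γ'
  /-- different instances are represented by different strings -/
  encode_injective : Function.Injective encode
  /-- the instances whose answer is YES -/
  Yes : Inst → Prop

/-- The complement of a decision problem: the same instances, with YES and NO interchanged. -/
def DecisionProblem.compl (P : DecisionProblem) : DecisionProblem where
  Inst := P.Inst
  encode := P.encode
  encode_injective := P.encode_injective
  Yes x := ¬ P.Yes x

/-- Many-one (Karp) reducibility in polynomial time: a function from the instances of `P` to the
instances of `Q` that preserves the answers, and that some Turing machine computes (on the strings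
representing the instances) in a number of steps polynomial in the length of its input. -/
def DecisionProblem.KarpReducible (P Q : DecisionProblem) : Prop :=
  ∃ f : P.Inst → Q.Inst,
    Nonempty (Turing.TM2ComputableInPolyTime P.encode Q.encode f) ∧
      ∀ x : P.Inst, P.Yes x ↔ Q.Yes (f x)

/-! ### The maximum average cut problem -/

/-- An instance of the maximum average cut problem: a connected multigraph on the vertices
`0, …, n - 1`, given by the list of its edges (parallel edges and loops are allowed), each edge
with a weight `1` or `-1`, and a rational number `k = kNum / kDen ≥ -1`. -/
structure MaxAvgCutInstance where
  /-- the number of vertices -/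
  n : ℕ
  /-- the edges `(u, v, w)`: the two ends and the weight -/
  edges : List (Fin n × Fin n × ℤˣ)
  /-- the numerator of the threshold -/
  kNum : ℤ
  /-- the denominator of the threshold -/
  kDen : ℕ
  kDen_pos : 0 < kDen
  connected : (SimpleGraph.fromRel fun u v : Fin n => ∃ w, (u, v, w) ∈ edges).Connected
  neg_one_le : (-1 : ℚ) ≤ kNum / kDen

namespace MaxAvgCutInstance

/-- The threshold `k`. -/
def k (I : MaxAvgCutInstance) : ℚ := I.kNum / I.kDen

/-- `δ(A)`: the edges (counted with multiplicity) with exactly one end in `A`. -/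
def cut (I : MaxAvgCutInstance) (A : Finset (Fin I.n)) : List (Fin I.n × Fin I.n × ℤˣ) :=
  I.edges.filter fun e => decide (¬ (e.1 ∈ A ↔ e.2.1 ∈ A))

/-- The average weight of the edges in `δ(A)`. -/
def avgWeight (I : MaxAvgCutInstance) (A : Finset (Fin I.n)) : ℚ :=
  ((I.cut A).map fun e => ((e.2.2 : ℤ) : ℚ)).sum / (I.cut A).length

/-- The string that represents an instance: the number of vertices, the list of edges, and the
threshold. As the graph is connected, writing the vertices in unary changes the length only
polynomially. -/
def encode (I : MaxAvgCutInstance) : List Γ' :=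
  encodePair encodeUnary
    (encodePair
      (encodeList (encodePair encodeUnary (encodePair encodeUnary encodeSign)))
      (encodePair encodeInt encodeBinary))
    (I.n, I.edges.map (fun e => (e.1.val, e.2.1.val, e.2.2)), I.kNum, I.kDen)

theorem encode_injective : Function.Injective encode := by
  rintro ⟨n, es, a, b, _, _, _⟩ ⟨n', es', a', b', _, _, _⟩ h
  have h' := (selfDelimiting_unary.pair
    ((selfDelimiting_unary.pair (selfDelimiting_unary.pair selfDelimiting_sign)).list.pair
      (selfDelimiting_int.pair selfDelimiting_binary))).injective h
  simp only [Prod.mk.injEq] at h'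
  obtain ⟨rfl, h2, rfl, rfl⟩ := h'
  have hinj : Function.Injective
      (fun e : Fin n × Fin n × ℤˣ => (e.1.val, e.2.1.val, e.2.2)) := by
    rintro ⟨u, v, w⟩ ⟨u', v', w'⟩ h
    simpa [Fin.ext_iff] using h
  obtain rfl := hinj.list_map h2
  rfl

end MaxAvgCutInstance

/-- The maximum average cut problem: is there a nontrivial partition of the vertices into `A` and
its complement such that the edges in `δ(A)` have average weight at least `k`? -/
def MaxAvgCut : DecisionProblem where
  Inst := MaxAvgCutInstance
  encode := MaxAvgCutInstance.encode
  encode_injective := MaxAvgCutInstance.encode_injective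
  Yes I := ∃ A : Finset (Fin I.n), A.Nonempty ∧ A ≠ Finset.univ ∧ I.k ≤ I.avgWeight A

/-! ### The thin tree verification problem -/

/-- `δ_G(A)`: the edges of `G` with exactly one end in `A`. -/
def SimpleGraph.edgeCut {V : Type} (G : SimpleGraph V) (A : Finset V) : Set (Sym2 V) :=
  {e ∈ G.edgeSet | ∃ u ∈ A, ∃ v ∉ A, e = s(u, v)}

/-- A subgraph `T` of `G` is `α`-thin if it contains at most an `α` proportion of the edges of each
cut of `G`. -/
def SimpleGraph.IsThin {V : Type} [Fintype V] (G T : SimpleGraph V) (α : ℚ) : Prop :=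
  ∀ A : Finset V, A.Nonempty → A ≠ Finset.univ →
    ((T.edgeCut A).ncard : ℚ) / ((G.edgeCut A).ncard : ℚ) ≤ α

/-- The simple graph with the given list of edges. -/
def graphOfList {n : ℕ} (l : List (Fin n × Fin n)) : SimpleGraph (Fin n) :=
  SimpleGraph.fromEdgeSet {e | ∃ p ∈ l, e = s(p.1, p.2)}

/-- An instance of the thin tree verification problem: a connected simple graph on the vertices
`0, …, n - 1`, given by the list of its edges, a spanning tree of it, given by the list of its
edges, and a rational number `α = αNum / αDen` in `[0, 1]`. -/
structure ThinTreeInstance where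
  /-- the number of vertices -/
  n : ℕ
  /-- the edges of the graph -/
  edges : List (Fin n × Fin n)
  /-- the edges of the spanning tree -/
  treeEdges : List (Fin n × Fin n)
  /-- the numerator of `α` -/
  αNum : ℕ
  /-- the denominator of `α` -/
  αDen : ℕ
  αDen_pos : 0 < αDen
  /-- no edge is a loop -/
  loopless : ∀ p ∈ edges, p.1 ≠ p.2
  connected : (graphOfList edges).Connected
  tree_subset : treeEdges ⊆ edges
  tree_isTree : (graphOfList treeEdges).IsTree
  α_le_one : (αNum : ℚ) / αDen ≤ 1

namespace ThinTreeInstance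

/-- The graph `G`. -/
def graph (I : ThinTreeInstance) : SimpleGraph (Fin I.n) := graphOfList I.edges

/-- The spanning tree `T`. -/
def tree (I : ThinTreeInstance) : SimpleGraph (Fin I.n) := graphOfList I.treeEdges

/-- The bound `α`. -/
def α (I : ThinTreeInstance) : ℚ := I.αNum / I.αDen

/-- The string that represents an instance: the number of vertices, the list of the edges of the
graph, the list of the edges of the tree, and `α`. As the graph is connected, writing the vertices
in unary changes the length only polynomially. -/
def encode (I : ThinTreeInstance) : List Γ' :=
  encodePair encodeUnary
    (encodePair (encodeList (encodePair encodeUnary encodeUnary))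
      (encodePair (encodeList (encodePair encodeUnary encodeUnary))
        (encodePair encodeBinary encodeBinary)))
    (I.n, I.edges.map (fun p => (p.1.val, p.2.val)),
      I.treeEdges.map (fun p => (p.1.val, p.2.val)), I.αNum, I.αDen)

theorem encode_injective : Function.Injective encode := by
  rintro ⟨n, es, ts, a, b, _, _, _, _, _, _⟩ ⟨n', es', ts', a', b', _, _, _, _, _, _⟩ h
  have hl := (selfDelimiting_unary.pair selfDelimiting_unary).list
  have h' := (selfDelimiting_unary.pair
    (hl.pair (hl.pair (selfDelimiting_binary.pair selfDelimiting_binary)))).injective h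
  simp only [Prod.mk.injEq] at h'
  obtain ⟨rfl, h2, h3, rfl, rfl⟩ := h'
  have hinj : Function.Injective (fun p : Fin n × Fin n => (p.1.val, p.2.val)) := by
    rintro ⟨u, v⟩ ⟨u', v'⟩ h
    simpa [Fin.ext_iff] using h
  obtain rfl := hinj.list_map h2
  obtain rfl := hinj.list_map h3
  rfl

end ThinTreeInstance

/-- The thin tree verification problem: is the spanning tree `T` an `α`-thin subgraph of `G`? -/
def ThinTreeValid : DecisionProblem where
  Inst := ThinTreeInstance
  encode := ThinTreeInstance.encode
  encode_injective := ThinTreeInstance.encode_injective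
  Yes I := I.graph.IsThin I.tree I.α

/-! Let the multigraph have n vertices and m edges. Every vertex is blown up to a clique of `levels
m` = 11(m+1) vertices. Every edge becomes one edge between the cliques of its ends, put into the
tree T; a negative edge yields a second edge outside T. Edge j owns a level of the cliques (`slot`),
so parallel edges of the multigraph stay distinct in the simple graph G'. Within the cliques, T
consists of paths through the first 10(m+1)+1 levels and of edges that attach the slot vertices to
level 0. The slot vertex of `V j` already hangs on `U j`; it is attached to `V j` as well only if
edge j joins two components of the earlier edges, as in Kruskal's algorithm. Hence T is connected
and has one edge fewer than vertices (`treeList_const`, `length_treeList`).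

A cut of G' that splits no clique is a cut of the multigraph, say with c edges, q of them negative.
It has c tree edges out of c + q (`cutSize_treeList`, `cutSize_graphList`), and its average weight
is 1 - 2q/c. So the average is at least k iff c/(c+q) ≥ 2/(3-k). Non-thinness asks for a strict
inequality, so the bound is lowered a little: for k = a/b ≤ 1 it is α = 2/(3 - k + 1/(br)), where r
= 2^(m+1) ≥ c, and integrality makes both conditions equivalent (`threshold_iff`). For k > 1 the
truncation in the denominator gives α = 1, and both sides are false.

A cut that splits a clique contains so many clique edges that at most 2/5 of its edges lie in T
(`five_mul_cutSize_treeList_le`), while k ≥ -1 forces α ≥ 2/5 (`two_mul_boundDen_le`). Such cuts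
never violate thinness.

For the running time, a small structured language over stacks is compiled to Turing machines
(`Runs.simulate`). `PolyComp` expresses computability by such programs in polynomial time; it is
closed under composition, case distinction, and recursion along a string provided that all
intermediate values stay polynomially long (`PolyComp.foldr_of_mem`). Vertices are handled in unary;
only the two parts of α need binary arithmetic, done digit by digit with carries and borrows. -/

/-! ### Structured programs over stacks -/

/-- Structured programs that operate on stacks indexed by the natural numbers. -/
inductive Cmd
  | skip : Cmd
  | push (k : ℕ) (c : Γ') : Cmd
  | pop (k : ℕ) : Cmd
  | seq (p q : Cmd) : Cmd
  /-- choose a program by the top symbol of a stack -/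
  | case (k : ℕ) (p : Option Γ' → Cmd) : Cmd
  /-- while a stack is non-empty, pop its top symbol and choose a program by it -/
  | loop (k : ℕ) (p : Γ' → Cmd) : Cmd

/-- The contents of all stacks. -/
abbrev Store := ℕ → List Γ'

open Function (update)

/-- `Runs c s s' t`: started on `s`, the program `c` ends in `s'` after `t` steps. -/
inductive Runs : Cmd → Store → Store → ℕ → Prop
  | skip (s : Store) : Runs .skip s s 1
  | push (k : ℕ) (c : Γ') (s : Store) : Runs (.push k c) s (update s k (c :: s k)) 1
  | pop (k : ℕ) (s : Store) : Runs (.pop k) s (update s k (s k).tail) 1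
  | seq {p q : Cmd} {s s' s'' : Store} {t t' : ℕ} :
      Runs p s s' t → Runs q s' s'' t' → Runs (.seq p q) s s'' (t + t')
  | case {k : ℕ} {p : Option Γ' → Cmd} {s s' : Store} {t : ℕ} :
      Runs (p (s k).head?) s s' t → Runs (.case k p) s s' (1 + t)
  | loop_nil {k : ℕ} {p : Γ' → Cmd} {s : Store} : s k = [] → Runs (.loop k p) s s 1
  | loop_cons {k : ℕ} {p : Γ' → Cmd} {s s' s'' : Store} {t t' : ℕ} {c : Γ'} {l : List Γ'} :
      s k = c :: l → Runs (p c) (update s k l) s' t → Runs (.loop k p) s' s'' t' →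
      Runs (.loop k p) s s'' (1 + (t + t'))

namespace Cmd

/-- The program only uses stacks with an index less than `B`. -/
def UsesBelow (B : ℕ) : Cmd → Prop
  | skip => True
  | push k _ => k < B
  | pop k => k < B
  | seq p q => UsesBelow B p ∧ UsesBelow B q
  | case k p => k < B ∧ ∀ o, UsesBelow B (p o)
  | loop k p => k < B ∧ ∀ c, UsesBelow B (p c)

theorem UsesBelow.mono {B B' : ℕ} (h : B ≤ B') : ∀ {c : Cmd}, UsesBelow B c → UsesBelow B' c
  | skip, _ => trivial
  | push _ _, hc => lt_of_lt_of_le hc h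
  | pop _, hc => lt_of_lt_of_le hc h
  | seq _ _, hc => ⟨hc.1.mono h, hc.2.mono h⟩
  | case _ _, hc => ⟨lt_of_lt_of_le hc.1 h, fun o => (hc.2 o).mono h⟩
  | loop _ _, hc => ⟨lt_of_lt_of_le hc.1 h, fun o => (hc.2 o).mono h⟩

/-- A machine has finitely many stacks. The branches of `case` and `loop` range over a finite
alphabet, so a maximum over them exists. -/
theorem exists_usesBelow (c : Cmd) : ∃ B, UsesBelow B c := by
  induction c with
  | skip => exact ⟨0, trivial⟩
  | push k _ => exact ⟨k + 1, Nat.lt_succ_self k⟩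
  | pop k => exact ⟨k + 1, Nat.lt_succ_self k⟩
  | seq p q hp hq =>
    obtain ⟨B, hB⟩ := hp
    obtain ⟨B', hB'⟩ := hq
    exact ⟨max B B', hB.mono (le_max_left _ _), hB'.mono (le_max_right _ _)⟩
  | case k p hp | loop k p hp =>
    choose B hB using hp
    refine ⟨max (k + 1) (Finset.univ.sup B), lt_of_lt_of_le (Nat.lt_succ_self k) (le_max_left _ _),
      fun o => (hB o).mono (le_trans ?_ (le_max_right _ _))⟩
    exact Finset.le_sup (f := B) (Finset.mem_univ o)

/-! ### Compilation of programs to Turing machines -/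

/-- The control points of a program. -/
def Lab : Cmd → Type
  | skip | push _ _ | pop _ => Unit
  | seq p q => Lab p ⊕ Lab q
  | case _ p => Option (Σ o, Lab (p o))
  | loop _ p => Option (Σ c, Lab (p c))

theorem finite_lab : ∀ c : Cmd, Finite (Lab c)
  | skip | push _ _ | pop _ => inferInstanceAs (Finite Unit)
  | seq p q => by
    have := finite_lab p
    have := finite_lab q
    exact inferInstanceAs (Finite (Lab p ⊕ Lab q))
  | case _ p => by
    have := fun o => finite_lab (p o)
    exact inferInstanceAs (Finite (Option (Σ o, Lab (p o))))
  | loop _ p => by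
    have := fun o => finite_lab (p o)
    exact inferInstanceAs (Finite (Option (Σ o, Lab (p o))))

/-- The control point at which a program starts. -/
def entry : (c : Cmd) → Lab c
  | skip | push _ _ | pop _ => ()
  | seq p _ => Sum.inl (entry p)
  | case _ _ | loop _ _ => none

/-- The machine statement at a control point of a program, whose control points are embedded into
the labels of a machine by `e`, and which goes to the label `exit` at its end. -/
def stmt (B : ℕ) [NeZero B] {L : Type} : (c : Cmd) → (e : Lab c → L) → (exit : L) → Lab c →
    Turing.TM2.Stmt (fun _ : Fin B => Γ') L (Option Γ')
  | skip, _, exit, _ => .goto fun _ => exit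
  | push k c, _, exit, _ => .push (Fin.ofNat B k) (fun _ => c) (.goto fun _ => exit)
  | pop k, _, exit, _ => .pop (Fin.ofNat B k) (fun v _ => v) (.goto fun _ => exit)
  | seq p q, e, _, Sum.inl l => stmt B p (fun l => e (Sum.inl l)) (e (Sum.inr (entry q))) l
  | seq _ q, e, exit, Sum.inr l => stmt B q (fun l => e (Sum.inr l)) exit l
  | case k p, e, _, none =>
    .peek (Fin.ofNat B k) (fun _ o => o) (.goto fun o => e (some ⟨o, entry (p o)⟩))
  | case _ p, e, exit, some ⟨o, l⟩ => stmt B (p o) (fun l => e (some ⟨o, l⟩)) exit l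
  | loop k p, e, exit, none =>
    .pop (Fin.ofNat B k) (fun _ o => o) (.goto fun o => match o with
      | none => exit
      | some c => e (some ⟨c, entry (p c)⟩))
  | loop _ p, e, _, some ⟨c, l⟩ => stmt B (p c) (fun l => e (some ⟨c, l⟩)) (e none) l

end Cmd

/-- The first `B` stacks. -/
def Store.restrict (B : ℕ) (s : Store) : Fin B → List Γ' := fun i => s i

theorem Store.restrict_update {B : ℕ} [NeZero B] (s : Store) {k : ℕ} (hk : k < B) (l : List Γ') :
    Store.restrict B (update s k l) = update (Store.restrict B s) (Fin.ofNat B k) l := by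
  funext i
  simp only [Store.restrict, Function.update_apply, Fin.ext_iff, Fin.val_ofNat,
    Nat.mod_eq_of_lt hk]

theorem Store.restrict_apply {B : ℕ} [NeZero B] (s : Store) {k : ℕ} (hk : k < B) :
    Store.restrict B s (Fin.ofNat B k) = s k := by
  simp [Store.restrict, Nat.mod_eq_of_lt hk]

open Turing in
theorem iterate_step_some {B : ℕ} {L : Type} {M : L → TM2.Stmt (fun _ : Fin B => Γ') L (Option Γ')}
    {l : L} {q : TM2.Stmt (fun _ : Fin B => Γ') L (Option Γ')} (h : M l = q) (v : Option Γ')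
    (S : Fin B → List Γ') :
    (flip bind (TM2.step M))^[1] (some ⟨some l, v, S⟩) = some (TM2.stepAux q v S) := by
  subst h
  rfl

-- Each unit of cost in `Runs` is exactly one machine step, so the claim follows by induction on the
-- run. The embedding `e` and the label `exit` are arbitrary because a subprogram sits inside a
-- larger one. The final internal state is left open: it is read only right after a `peek` or `pop`
-- has overwritten it.
open Turing in
theorem Runs.simulate {B : ℕ} [NeZero B] {L : Type}
    (M : L → TM2.Stmt (fun _ : Fin B => Γ') L (Option Γ')) {c : Cmd} {s s' : Store} {t : ℕ}
    (h : Runs c s s' t) : c.UsesBelow B → ∀ (e : c.Lab → L) (exit : L),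
      (∀ l, M (e l) = c.stmt B e exit l) → ∀ v, ∃ v',
      (flip bind (TM2.step M))^[t] (some ⟨some (e c.entry), v, Store.restrict B s⟩) =
        some ⟨some exit, v', Store.restrict B s'⟩ := by
  induction h with
  | skip s =>
    intro _ e exit hM v
    exact ⟨v, (iterate_step_some (hM _) _ _).trans rfl⟩
  | push k c s =>
    intro hB e exit hM v
    refine ⟨v, (iterate_step_some (hM _) _ _).trans ?_⟩
    rw [Store.restrict_update _ hB, ← Store.restrict_apply (B := B) s hB]
    rfl
  | pop k s =>
    intro hB e exit hM v
    refine ⟨v, (iterate_step_some (hM _) _ _).trans ?_⟩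
    rw [Store.restrict_update _ hB, ← Store.restrict_apply (B := B) s hB]
    rfl
  | @seq p q s s' s'' t t' _ _ ihp ihq =>
    intro hB e exit hM v
    obtain ⟨v₁, h₁⟩ := ihp hB.1 (fun l => e (Sum.inl l)) (e (Sum.inr q.entry))
      (fun l => hM (Sum.inl l)) v
    obtain ⟨v₂, h₂⟩ := ihq hB.2 (fun l => e (Sum.inr l)) exit (fun l => hM (Sum.inr l)) v₁
    refine ⟨v₂, ?_⟩
    rw [add_comm, Function.iterate_add_apply]
    exact (congrArg _ h₁).trans h₂
  | @case k p s s' t _ ih =>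
    intro hB e exit hM v
    obtain ⟨v₁, h₁⟩ := ih (hB.2 _) (fun l => e (some ⟨_, l⟩)) exit (fun l => hM (some ⟨_, l⟩))
      (s k).head?
    refine ⟨v₁, ?_⟩
    rw [add_comm, Function.iterate_add_apply, ← h₁, iterate_step_some (hM _),
      ← Store.restrict_apply (B := B) s hB.1]
    rfl
  | @loop_nil k p s hs =>
    intro hB e exit hM v
    refine ⟨none, (iterate_step_some (hM _) _ _).trans ?_⟩
    have h₀ := Store.restrict_apply (B := B) s hB.1
    -- Popping an empty stack leaves the store as it is.
    have h₁ : update (Store.restrict B s) (Fin.ofNat B k) [] = Store.restrict B s := by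
      rw [← Store.restrict_update _ hB.1, ← hs, Function.update_eq_self]
    simp only [Cmd.entry, Cmd.stmt, TM2.stepAux, h₀, hs, List.head?_nil, List.tail_nil, h₁]
  | @loop_cons k p s s' s'' t t' c l hs _ _ ih₁ ih₂ =>
    intro hB e exit hM v
    obtain ⟨v₁, h₁⟩ := ih₁ (hB.2 _) (fun l => e (some ⟨_, l⟩)) (e none)
      (fun l => hM (some ⟨_, l⟩)) (some c)
    obtain ⟨v₂, h₂⟩ := ih₂ hB e exit hM v₁
    refine ⟨v₂, ?_⟩
    have h₀ := Store.restrict_apply (B := B) s hB.1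
    have h₃ : (flip bind (TM2.step M))^[1]
        (some ⟨some (e (Cmd.entry (.loop k p))), v, Store.restrict B s⟩) =
        some ⟨some (e (some ⟨c, (p c).entry⟩)), some c, Store.restrict B (update s k l)⟩ := by
      rw [iterate_step_some (hM _)]
      simp only [Cmd.entry, Cmd.stmt, TM2.stepAux, h₀, hs, List.head?_cons, List.tail_cons,
        Store.restrict_update _ hB.1]
    rw [show 1 + (t + t') = t' + (t + 1) by omega, Function.iterate_add_apply,
      Function.iterate_add_apply _ t 1, h₃]
    exact (congrArg _ h₁).trans h₂

/-- The machine that runs a program, with stack `0` for the input and stack `1` for the output. -/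
noncomputable def Cmd.machine (c : Cmd) (B : ℕ) (hB : 1 < B) : Turing.FinTM2 :=
  haveI : NeZero B := ⟨by omega⟩
  haveI := Cmd.finite_lab c
  letI : Fintype c.Lab := Fintype.ofFinite _
  { K := Fin B
    k₀ := ⟨0, by omega⟩
    k₁ := ⟨1, hB⟩
    Γ := fun _ => Γ'
    Λ := Option c.Lab
    main := some c.entry
    σ := Option Γ'
    initialState := none
    m := fun l => match l with
      | none => .load (fun _ => none) .halt
      | some l => c.stmt B some none l }

/-- The left side is the form in which `Turing.initList` and `Turing.haltList` describe the stacks.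
-/
theorem Store.dite_eq_restrict {B : ℕ} (k : Fin B) (l : List Γ') :
    (fun i : Fin B => @dite (List Γ') (i = k) (instDecidableEqFin B i k) (fun _ => l)
      fun _ => []) = Store.restrict B (update (fun _ => []) k l) := by
  funext i
  simp only [Store.restrict, Function.update_apply, Fin.ext_iff]
  split_ifs <;> rfl

/-- A halting configuration has the output as its only non-empty stack, so the program has to clean
up everything else. -/
theorem nonempty_computableInPolyTime {α β : Type} {ea : α → List Γ'} {eb : β → List Γ'}
    {f : α → β} (c : Cmd) (p : Polynomial ℕ)
    (h : ∀ a, ∃ t ≤ p.eval (ea a).length,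
      Runs c (update (fun _ => []) 0 (ea a)) (update (fun _ => []) 1 (eb (f a))) t) :
    Nonempty (Turing.TM2ComputableInPolyTime ea eb f) := by
  obtain ⟨B₀, hB₀⟩ := c.exists_usesBelow
  have hB : 1 < max B₀ 2 := by omega
  replace hB₀ := hB₀.mono (le_max_left B₀ 2)
  generalize max B₀ 2 = B at hB hB₀
  have : NeZero B := ⟨by omega⟩
  -- The summand 1 pays for the last step, at the label `none`, which resets the internal state and
  -- halts.
  refine ⟨⟨⟨c.machine B hB, Equiv.refl _, Equiv.refl _⟩, p + 1, fun a => ?_⟩⟩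
  choose t ht hr using h
  refine ⟨⟨t a + 1, ?_⟩, ?_⟩
  · obtain ⟨v, hv⟩ := (hr a).simulate (c.machine B hB).m hB₀ some none (fun _ => rfl) none
    rw [add_comm, Function.iterate_add_apply]
    have h₀ : Turing.initList (c.machine B hB) (List.map (Equiv.refl Γ').invFun (ea a)) =
        ⟨some (some c.entry), none, Store.restrict B (update (fun _ => []) 0 (ea a))⟩ := by
      rw [← Store.dite_eq_restrict ⟨0, by omega⟩]
      exact (congrArg (Turing.initList (c.machine B hB)) (List.map_id (ea a))).trans rfl
    have h₁ : Turing.haltList (c.machine B hB) (List.map (Equiv.refl Γ').invFun (eb (f a))) =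
        ⟨none, none, Store.restrict B (update (fun _ => []) 1 (eb (f a)))⟩ := by
      rw [← Store.dite_eq_restrict ⟨1, hB⟩]
      exact (congrArg (Turing.haltList (c.machine B hB)) (List.map_id (eb (f a)))).trans rfl
    change (flip bind _)^[1] ((flip bind _)^[t a] (some (Turing.initList (c.machine B hB)
      (List.map (Equiv.refl Γ').invFun (ea a))))) = some (Turing.haltList (c.machine B hB)
      (List.map (Equiv.refl Γ').invFun (eb (f a))))
    rw [h₀, h₁]
    exact (congrArg _ hv).trans rfl
  · simpa using ht a

/-! ### Polynomially bounded functions -/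

/-- On `D`, the function `t` is bounded by a polynomial in the size `sz`. -/
def PolyBounded {α : Type} (sz : α → ℕ) (D : Set α) (t : α → ℕ) : Prop :=
  ∃ p : Polynomial ℕ, ∀ a ∈ D, t a ≤ p.eval (sz a)

namespace PolyBounded

variable {α : Type} {sz : α → ℕ} {D : Set α} {t t' : α → ℕ}

theorem const (n : ℕ) : PolyBounded sz D fun _ => n := ⟨Polynomial.C n, by simp⟩

theorem size : PolyBounded sz D sz := ⟨Polynomial.X, by simp⟩

theorem mono (h : PolyBounded sz D t') (htt : ∀ a ∈ D, t a ≤ t' a) : PolyBounded sz D t := by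
  obtain ⟨p, hp⟩ := h
  exact ⟨p, fun a ha => (htt a ha).trans (hp a ha)⟩

theorem add (h : PolyBounded sz D t) (h' : PolyBounded sz D t') :
    PolyBounded sz D fun a => t a + t' a := by
  obtain ⟨p, hp⟩ := h
  obtain ⟨q, hq⟩ := h'
  exact ⟨p + q, fun a ha => by
    rw [Polynomial.eval_add]
    exact add_le_add (hp a ha) (hq a ha)⟩

theorem mul (h : PolyBounded sz D t) (h' : PolyBounded sz D t') :
    PolyBounded sz D fun a => t a * t' a := by
  obtain ⟨p, hp⟩ := h
  obtain ⟨q, hq⟩ := h'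
  exact ⟨p * q, fun a ha => by
    rw [Polynomial.eval_mul]
    exact Nat.mul_le_mul (hp a ha) (hq a ha)⟩

theorem subset {D' : Set α} (h : PolyBounded sz D t) (hD : D' ⊆ D) : PolyBounded sz D' t := by
  obtain ⟨p, hp⟩ := h
  exact ⟨p, fun a ha => hp a (hD ha)⟩

theorem comap {β : Type} (h : PolyBounded sz D t) (f : β → α) {D' : Set β}
    (hD : ∀ b ∈ D', f b ∈ D) : PolyBounded (fun b => sz (f b)) D' fun b => t (f b) := by
  obtain ⟨p, hp⟩ := h
  exact ⟨p, fun b hb => hp _ (hD b hb)⟩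

/-- The sum of the polynomials of the finitely many cases dominates each of them, since all values
are natural numbers. -/
theorem of_cases {ι : Type} [Fintype ι] (g : α → ι)
    (h : ∀ i, PolyBounded sz {a ∈ D | g a = i} t) : PolyBounded sz D t := by
  choose p hp using h
  refine ⟨∑ i, p i, fun a ha => (hp (g a) a ⟨ha, rfl⟩).trans ?_⟩
  rw [Polynomial.eval_finsetSum]
  exact Finset.single_le_sum (f := fun i => (p i).eval (sz a)) (fun _ _ => Nat.zero_le _)
    (Finset.mem_univ _)

end PolyBounded

/-! ### Basic programs -/

/-- Started on `s`, the program `c` ends in `s'` after at most `t` steps. -/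
def Yields (c : Cmd) (s s' : Store) (t : ℕ) : Prop := ∃ t' ≤ t, Runs c s s' t'

namespace Yields

theorem seq {p q : Cmd} {s s' s'' : Store} {t t' T : ℕ} (h : Yields p s s' t)
    (h' : Yields q s' s'' t') (hT : t + t' ≤ T) : Yields (.seq p q) s s'' T := by
  obtain ⟨u, hu, hr⟩ := h
  obtain ⟨u', hu', hr'⟩ := h'
  exact ⟨u + u', by omega, hr.seq hr'⟩

theorem push (k : ℕ) (c : Γ') {s : Store} {l : List Γ'} (h : s k = l) :
    Yields (.push k c) s (update s k (c :: l)) 1 :=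
  ⟨1, le_rfl, h ▸ .push k c s⟩

theorem of_eq {p : Cmd} {s s' s'' : Store} {t : ℕ} (h : Yields p s s' t) (hs : s' = s'') :
    Yields p s s'' t := hs ▸ h

theorem loop_cons {k : ℕ} {p : Γ' → Cmd} {s s' s'' : Store} {t t' T : ℕ} {c : Γ'} {l : List Γ'}
    (hs : s k = c :: l) (h : Yields (p c) (update s k l) s' t) (h' : Yields (.loop k p) s' s'' t')
    (hT : 1 + (t + t') ≤ T) : Yields (.loop k p) s s'' T := by
  obtain ⟨u, hu, hr⟩ := h
  obtain ⟨u', hu', hr'⟩ := h'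
  exact ⟨1 + (u + u'), by omega, hr.loop_cons hs hr'⟩

/-- Moving a stack onto another one reverses it. -/
theorem move {i j : ℕ} (hij : i ≠ j) {s : Store} {l l' : List Γ'} (hi : s i = l) (hj : s j = l') :
    Yields (.loop i fun c => .push j c) s (update (update s j (l.reverse ++ l')) i [])
      (2 * l.length + 1) := by
  induction l generalizing s l' with
  | nil =>
    refine of_eq ⟨1, by simp, .loop_nil hi⟩ ?_
    rw [List.reverse_nil, List.nil_append, ← hi, ← hj, Function.update_eq_self,
      Function.update_eq_self]
  | cons c l ih =>
    refine (loop_cons hi (push j c (l := l') ?_) (ih (l' := c :: l') ?_ ?_) ?_).of_eq ?_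
    · rw [Function.update_of_ne hij.symm, hj]
    · simp [hij]
    · simp
    · simp only [List.length_cons]
      omega
    · funext k
      rcases eq_or_ne k i with rfl | h
      · simp
      · rcases eq_or_ne k j with rfl | h' <;> simp [*]

theorem clear (i : ℕ) {s : Store} {l : List Γ'} (hi : s i = l) :
    Yields (.loop i fun _ => .skip) s (update s i []) (2 * l.length + 1) := by
  induction l generalizing s with
  | nil =>
    refine of_eq ⟨1, by simp, .loop_nil hi⟩ ?_
    simp [← hi]
  | cons c l ih =>
    refine (loop_cons hi ⟨1, le_rfl, .skip _⟩ (ih ?_) ?_).of_eq ?_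
    · simp
    · simp only [List.length_cons]
      omega
    · simp

theorem moveTwo {i j k : ℕ} (hij : i ≠ j) (hik : i ≠ k) (hjk : j ≠ k) {s : Store}
    {l l' l'' : List Γ'} (hi : s i = l) (hj : s j = l') (hk : s k = l'') :
    Yields (.loop i fun c => .seq (.push j c) (.push k c)) s
      (update (update (update s j (l.reverse ++ l')) k (l.reverse ++ l'')) i [])
      (3 * l.length + 1) := by
  induction l generalizing s l' l'' with
  | nil =>
    refine of_eq ⟨1, by simp, .loop_nil hi⟩ ?_
    rw [List.reverse_nil, List.nil_append, List.nil_append, ← hi, ← hj, ← hk,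
      Function.update_eq_self, Function.update_eq_self, Function.update_eq_self]
  | cons c l ih =>
    refine (loop_cons hi ((push j c (l := l') ?_).seq (push k c (l := l'') ?_) le_rfl)
      (ih (l' := c :: l') (l'' := c :: l'') ?_ ?_ ?_) ?_).of_eq ?_
    · rw [Function.update_of_ne hij.symm, hj]
    · rw [Function.update_of_ne hjk.symm, Function.update_of_ne hik.symm, hk]
    · simp [hij, hik]
    · simp [hjk]
    · simp
    · simp only [List.length_cons]
      omega
    · funext m
      rcases eq_or_ne m i with rfl | h
      · simp
      · rcases eq_or_ne m k with rfl | h'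
        · simp [*]
        · rcases eq_or_ne m j with rfl | h'' <;> simp [*]

/-- Moving reverses a string, so a detour through `k` restores the order on `i` and on the copy
alike. -/
theorem copy {i j k : ℕ} (hij : i ≠ j) (hik : i ≠ k) (hjk : j ≠ k) {s : Store} {l : List Γ'}
    (hi : s i = l) (hj : s j = []) (hk : s k = []) : Yields (.seq (.loop i fun c => .push k c)
      (.loop k fun c => .seq (.push i c) (.push j c))) s (update s j l) (5 * l.length + 2) := by
  refine ((move hik hi hk).seq (moveTwo (l := l.reverse) (l' := []) (l'' := []) hik.symm hjk.symm
    hij ?_ ?_ ?_) ?_).of_eq ?_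
  · simp [hik.symm]
  · simp
  · simp [hij.symm, hjk, hj]
  · simp only [List.length_reverse]
    omega
  · funext m
    rcases eq_or_ne m k with rfl | h
    · simp [hjk.symm, hk]
    · rcases eq_or_ne m j with rfl | h'
      · simp [*]
      · rcases eq_or_ne m i with rfl | h'' <;> simp [*]

/-- A stack is transferred to an empty one, with the help of a third one. -/
theorem transfer {i j k : ℕ} (hij : i ≠ j) (hik : i ≠ k) (hjk : j ≠ k) {s : Store} {l : List Γ'}
    (hi : s i = l) (hj : s j = []) (hk : s k = []) : Yields (.seq (.loop i fun c => .push k c)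
      (.loop k fun c => .push j c)) s (update (update s j l) i []) (4 * l.length + 2) := by
  refine ((move hik hi hk).seq (move (l := l.reverse) (l' := []) hjk.symm ?_ ?_) ?_).of_eq ?_
  · simp [hik.symm]
  · simp [hij.symm, hjk, hj]
  · simp only [List.length_reverse]
    omega
  · funext m
    rcases eq_or_ne m k with rfl | h
    · simp [hjk.symm, hik.symm, hk]
    · rcases eq_or_ne m j with rfl | h'
      · simp [*, hij.symm]
      · rcases eq_or_ne m i with rfl | h'' <;> simp [*]

/-- The stacks during a recursion: the symbols to come, the value, and the symbols done. -/
def recStore (s : Store) (base : ℕ) (r x suf : List Γ') : Store :=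
  update (update (update s base r) (base + 1) x) (base + 2) suf

/-- The body of a recursion whose steps are performed by the programs `p c`. -/
def recBody (base : ℕ) (p : Γ' → Cmd) (c : Γ') : Cmd :=
  .seq (p c) (.seq (.loop (base + 1) fun _ => .skip)
    (.seq (.seq (.loop (base + 3) fun c => .push (base + 4) c)
      (.loop (base + 4) fun c => .push (base + 1) c)) (.push (base + 2) c)))

/-- Recursion over the content of the stack `i`. -/
def recCmd (i base : ℕ) (p₀ : Cmd) (p : Γ' → Cmd) : Cmd :=
  .seq (.seq (.loop i fun c => .push (base + 2) c)
    (.loop (base + 2) fun c => .seq (.push i c) (.push (base + 1) c)))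
    (.seq (.loop (base + 1) fun c => .push base c) (.seq p₀ (.seq (.loop base (recBody base p))
    (.seq (.loop (base + 2) fun _ => .skip) (.seq (.loop (base + 1) fun c => .push (base + 2) c)
    (.loop (base + 2) fun c => .push base c))))))

/-- The invariant is `r.reverse ++ suf = l`: the symbols still to come lie on `base`, the one next
to the processed suffix on top. A step leaves its value on `base + 3` because it still reads the old
value; afterwards the old value is cleared (2A + 1 steps) and the new one transferred in its place
(4A + 2 steps). -/
theorem recLoop {s : Store} {base : ℕ} (hs : ∀ j ≥ base, s j = []) {p : Γ' → Cmd}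
    {f : List Γ' → List Γ'} {l : List Γ'} {q A : ℕ}
    (hp : ∀ c suf r, (c :: suf) <:+ l → Yields (p c) (recStore s base r (f suf) suf)
      (update (recStore s base r (f suf) suf) (base + 3) (f (c :: suf))) q)
    (hA : ∀ suf, suf <:+ l → (f suf).length ≤ A) (r suf : List Γ') (hr : r.reverse ++ suf = l) :
    Yields (.loop base (recBody base p)) (recStore s base r (f suf) suf)
      (recStore s base [] (f l) l) (r.length * (q + 6 * A + 6) + 1) := by
  induction r generalizing suf with
  | nil =>
    simp only [List.reverse_nil, List.nil_append] at hr
    subst hr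
    exact ⟨1, by simp, .loop_nil (by simp [recStore])⟩
  | cons c r ih =>
    have hr' : r.reverse ++ (c :: suf) = l := by simpa using hr
    have hsuf : (c :: suf) <:+ l := ⟨_, hr'⟩
    have e : update (recStore s base (c :: r) (f suf) suf) base r =
        recStore s base r (f suf) suf := by
      funext j
      rcases eq_or_ne j base with rfl | h
      · simp [recStore]
      · simp [recStore, Function.update_apply, h]
    refine Yields.loop_cons (c := c) (l := r) (s' := recStore s base r (f (c :: suf)) (c :: suf))
      (t := q + 6 * A + 5) (by simp [recStore]) ?_ (ih _ hr') ?_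
    · rw [e]
      refine ((hp c suf r hsuf).seq ((clear (base + 1) (l := f suf) ?_).seq ((transfer
        (i := base + 3) (j := base + 1) (k := base + 4) (l := f (c :: suf)) (by omega) (by omega)
        (by omega) ?_ ?_ ?_).seq (push (base + 2) c (l := suf) ?_) le_rfl) le_rfl) ?_).of_eq ?_
      · simp [recStore]
      · simp
      · simp
      · simp [recStore, hs]
      · simp [recStore]
      · have h1 := hA suf ((List.suffix_cons _ _).trans hsuf)
        have h2 := hA _ hsuf
        omega
      · funext j
        simp only [recStore, Function.update_apply]
        split_ifs <;> first | rfl | omega | (simp [*])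
    · simp only [List.length_cons, add_mul]
      omega

/-- The string is copied and then reversed onto `base`, so that its last symbol comes off first and
the values run through the suffixes from the shortest to the longest. -/
theorem recursion {s : Store} {base i : ℕ} (hs : ∀ j ≥ base, s j = []) (hi : i < base)
    {p₀ : Cmd} {p : Γ' → Cmd} {f : List Γ' → List Γ'} {l : List Γ'} {q₀ q A : ℕ} (hl : s i = l)
    (hp₀ : ∀ r, Yields p₀ (update s base r) (update (update s base r) (base + 1) (f [])) q₀)
    (hp : ∀ c suf r, (c :: suf) <:+ l → Yields (p c) (recStore s base r (f suf) suf)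
      (update (recStore s base r (f suf) suf) (base + 3) (f (c :: suf))) q)
    (hA : ∀ suf, suf <:+ l → (f suf).length ≤ A) :
    Yields (recCmd i base p₀ p) s (update s base (f l))
      (q₀ + l.length * (q + 6 * A + 6) + 9 * l.length + 4 * A + 7) := by
  have e₁ : update (update (update s (base + 1) l) base (l.reverse ++ [])) (base + 1) [] =
      update s base l.reverse := by
    funext j
    simp only [Function.update_apply, List.append_nil]
    split_ifs with h1 h2
    · omega
    · simp [h1, hs]
    · rfl
    · rfl
  have e₂ : update (update s base l.reverse) (base + 1) (f []) =
      recStore s base l.reverse (f []) [] := by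
    funext j
    simp only [recStore, Function.update_apply]
    split_ifs <;> first | rfl | omega | simp [*]
  refine (Yields.seq (copy (j := base + 1) (k := base + 2) (by omega) (by omega) (by omega) hl
    (hs _ (by omega)) (hs _ (by omega))) (Yields.seq ((move (l := l) (l' := []) (by omega)
    (by simp) (by simp [hs])).of_eq e₁) (((hp₀ _).of_eq e₂).seq ((recLoop hs hp hA l.reverse []
    (by simp)).seq ((clear (base + 2) (l := l) ?_).seq (transfer (i := base + 1) (j := base)
      (k := base + 2) (l := f l) (by omega) (by omega) (by omega) ?_ ?_ ?_) le_rfl) le_rfl) le_rfl)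
      le_rfl) ?_).of_eq ?_
  · simp [recStore]
  · simp [recStore]
  · simp [recStore]
  · simp
  · have h := hA l (List.suffix_refl l)
    simp only [List.length_reverse]
    omega
  · funext j
    simp only [recStore, Function.update_apply]
    split_ifs <;> first | rfl | omega | simp [*]

end Yields

/-! ### Relative computability in polynomial time -/

/-- For every `a ∈ D`, the string `x a` can be computed in a time that is polynomial in `sz a` from
the strings `y a` for `y ∈ Δ`, on a machine that depends neither on `a` nor on the stacks that
hold these strings. -/
def PolyComp {α : Type} (sz : α → ℕ) (D : Set α) (Δ : Set (α → List Γ')) (x : α → List Γ') :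
    Prop :=
  (∀ y ∈ Δ, PolyBounded sz D fun a => (y a).length) →
    (PolyBounded sz D fun a => (x a).length) ∧
    ∀ (pos : (α → List Γ') → ℕ) (base : ℕ), (∀ y ∈ Δ, pos y < base) →
      ∃ (c : Cmd) (t : α → ℕ), PolyBounded sz D t ∧ ∀ a ∈ D, ∀ s : Store,
        (∀ y ∈ Δ, s (pos y) = y a) → (∀ j ≥ base, s j = []) →
        Yields c s (update s base (x a)) (t a)

namespace PolyComp

variable {α : Type} {sz : α → ℕ} {D : Set α} {Δ Δ' : Set (α → List Γ')} {x y : α → List Γ'}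

theorem congr (h : PolyComp sz D Δ x) (hxy : ∀ a ∈ D, y a = x a) : PolyComp sz D Δ y := by
  intro hΔ
  obtain ⟨hb, hc⟩ := h hΔ
  refine ⟨hb.mono fun a ha => by rw [hxy a ha], fun pos base hpos => ?_⟩
  obtain ⟨c, t, ht, hr⟩ := hc pos base hpos
  exact ⟨c, t, ht, fun a ha s h₁ h₂ => by
    rw [hxy a ha]
    exact hr a ha s h₁ h₂⟩

theorem weaken (h : PolyComp sz D Δ x) (hΔ : Δ ⊆ Δ') : PolyComp sz D Δ' x := by
  intro hb
  obtain ⟨h₁, h₂⟩ := h fun y hy => hb y (hΔ hy)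
  refine ⟨h₁, fun pos base hpos => ?_⟩
  obtain ⟨c, t, ht, hr⟩ := h₂ pos base fun y hy => hpos y (hΔ hy)
  exact ⟨c, t, ht, fun a ha s h₁ h₂ => hr a ha s (fun y hy => h₁ y (hΔ hy)) h₂⟩

theorem of_mem (hx : x ∈ Δ) : PolyComp sz D Δ x := by
  intro hb
  refine ⟨hb x hx, fun pos base hpos => ?_⟩
  have := hpos x hx
  exact ⟨_, _, ((PolyBounded.const 5).mul (hb x hx)).add (.const 2), fun a _ s h₁ h₂ =>
    Yields.copy (i := pos x) (j := base) (k := base + 1) (by omega) (by omega) (by omega)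
      (h₁ x hx) (h₂ _ le_rfl) (h₂ _ (by omega))⟩

theorem nil : PolyComp sz D Δ fun _ => [] := by
  intro _
  refine ⟨.const 0, fun pos base _ => ⟨.skip, _, .const 1, fun a _ s _ h₂ => ?_⟩⟩
  refine ⟨1, le_rfl, ?_⟩
  rw [← h₂ base le_rfl, Function.update_eq_self]
  exact .skip s

theorem cons (c : Γ') (h : PolyComp sz D Δ x) : PolyComp sz D Δ fun a => c :: x a := by
  intro hΔ
  obtain ⟨hb, hc⟩ := h hΔ
  refine ⟨(hb.add (.const 1)).mono fun a _ => by simp, fun pos base hpos => ?_⟩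
  obtain ⟨p, t, ht, hr⟩ := hc pos base hpos
  refine ⟨_, _, ht.add (.const 1), fun a ha s h₁ h₂ =>
    ((hr a ha s h₁ h₂).seq (.push base c (Function.update_self _ _ _)) le_rfl).of_eq ?_⟩
  simp

theorem tail (h : PolyComp sz D Δ x) : PolyComp sz D Δ fun a => (x a).tail := by
  intro hΔ
  obtain ⟨hb, hc⟩ := h hΔ
  refine ⟨hb.mono fun a _ => by simp, fun pos base hpos => ?_⟩
  obtain ⟨p, t, ht, hr⟩ := hc pos base hpos
  refine ⟨_, _, ht.add (.const 1), fun a ha s h₁ h₂ =>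
    ((hr a ha s h₁ h₂).seq ⟨1, le_rfl, .pop base _⟩ le_rfl).of_eq ?_⟩
  simp

/-- A computable string may be used as an auxiliary one. -/
theorem cut (hx : PolyComp sz D Δ x) (hy : PolyComp sz D (insert x Δ) y) : PolyComp sz D Δ y := by
  classical
  by_cases hxΔ : x ∈ Δ
  · rwa [Set.insert_eq_of_mem hxΔ] at hy
  intro hΔ
  obtain ⟨hxb, hxc⟩ := hx hΔ
  obtain ⟨hyb, hyc⟩ := hy (by
    rintro z (rfl | hz)
    exacts [hxb, hΔ z hz])
  refine ⟨hyb, fun pos base hpos => ?_⟩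
  obtain ⟨p, t, ht, hr⟩ := hxc pos base hpos
  obtain ⟨p', t', ht', hr'⟩ := hyc (update pos x base) (base + 1) (by
    rintro z (rfl | hz)
    · simp
    · rw [Function.update_of_ne (by rintro rfl; exact hxΔ hz)]
      exact (hpos z hz).trans (Nat.lt_succ_self _))
  refine ⟨.seq p (.seq p' (.seq (.loop base fun _ => .skip)
      (.seq (.loop (base + 1) fun c => .push (base + 2) c)
        (.loop (base + 2) fun c => .push base c)))), _,
    ht.add (ht'.add ((((PolyBounded.const 2).mul hxb).add (.const 1)).add
      (((PolyBounded.const 4).mul hyb).add (.const 2)))), fun a ha s h₁ h₂ => ?_⟩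
  refine (Yields.seq (hr a ha s h₁ h₂) (Yields.seq (hr' a ha _ ?_ ?_)
    (Yields.seq (Yields.clear base (l := x a) ?_) (Yields.transfer (l := y a) (by omega) (by omega)
      (by omega) ?_ ?_ ?_) le_rfl) le_rfl) le_rfl).of_eq ?_
  · rintro z (rfl | hz)
    · simp
    · rw [Function.update_of_ne (f := pos) (by rintro rfl; exact hxΔ hz),
        Function.update_of_ne (hpos z hz).ne, h₁ z hz]
  · intro j hj
    rw [Function.update_of_ne (by omega), h₂ j (by omega)]
  · simp
  · simp
  · simp
  · simp [h₂]
  · funext j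
    simp only [Function.update_apply]
    split_ifs <;> first | rfl | omega | simp [*]

/-- Each branch need only work for those inputs that reach it. As there are finitely many symbols,
the bounds of the branches combine to one. -/
theorem case_head_of_mem (hx : x ∈ Δ)
    (h : ∀ o, PolyComp sz {a ∈ D | (x a).head? = o} Δ y) : PolyComp sz D Δ y := by
  intro hΔ
  have hsub : ∀ o, {a ∈ D | (x a).head? = o} ⊆ D := fun o a ha => ha.1
  choose hb hc using fun o => h o fun y hy => (hΔ y hy).subset (hsub o)
  refine ⟨.of_cases _ hb, fun pos base hpos => ?_⟩
  choose p t ht hr using fun o => hc o pos base hpos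
  refine ⟨.case (pos x) p, fun a => 1 + t (x a).head? a, .add (.const 1) (.of_cases
    (fun a => (x a).head?) fun o => (ht o).mono ?_), fun a ha s h₁ h₂ => ?_⟩
  · rintro a ⟨_, rfl⟩
    exact le_rfl
  · obtain ⟨u, hu, hru⟩ := hr (x a).head? a ⟨ha, rfl⟩ s h₁ h₂
    refine ⟨1 + u, Nat.add_le_add_left hu 1, .case ?_⟩
    rwa [h₁ x hx]

theorem case_head (hx : PolyComp sz D Δ x)
    (h : ∀ o, PolyComp sz {a ∈ D | (x a).head? = o} (insert x Δ) y) : PolyComp sz D Δ y :=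
  hx.cut (case_head_of_mem (Set.mem_insert _ _) h)

/-- Recursion over the suffixes of a string. -/
theorem foldr_of_mem {l : α → List Γ'} (hl : l ∈ Δ) (acc : α → List Γ' → List Γ')
    (hacc : PolyBounded (fun p : α × List Γ' => sz p.1) {p | p.1 ∈ D ∧ p.2 <:+ l p.1}
      fun p => (acc p.1 p.2).length)
    (h₀ : PolyComp sz D Δ fun a => acc a [])
    (hstep : ∀ c, PolyComp (fun p : α × List Γ' => sz p.1) {p | p.1 ∈ D ∧ (c :: p.2) <:+ l p.1}
      (insert (fun p => acc p.1 p.2) (insert (fun p => p.2) ((fun y p => y p.1) '' Δ)))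
      fun p => acc p.1 (c :: p.2)) :
    PolyComp sz D Δ fun a => acc a (l a) := by
  classical
  intro hΔ
  have hlb := hΔ l hl
  obtain ⟨-, hc₀⟩ := h₀ hΔ
  have hsub : ∀ c, {p : α × List Γ' | p.1 ∈ D ∧ (c :: p.2) <:+ l p.1} ⊆
      {p | p.1 ∈ D ∧ p.2 <:+ l p.1} := fun c p hp => ⟨hp.1, (List.suffix_cons _ _).trans hp.2⟩
  have hstep' := fun c => (hstep c (by
    rintro z (rfl | rfl | ⟨y, hy, rfl⟩)
    · exact hacc.subset (hsub c)
    · exact (hlb.comap Prod.fst (fun p hp => hp.1)).mono fun p hp =>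
        ((List.suffix_cons _ _).trans hp.2).length_le
    · exact (hΔ y hy).comap Prod.fst (fun p hp => hp.1))).2
  refine ⟨?_, fun pos base hpos => ?_⟩
  · obtain ⟨q, hq⟩ := hacc
    exact ⟨q, fun a ha => hq (a, l a) ⟨ha, List.suffix_refl _⟩⟩
  obtain ⟨p₀, t₀, ht₀, hr₀⟩ := hc₀ pos (base + 1) fun y hy => (hpos y hy).trans (Nat.lt_succ_self _)
  have hlt := hpos l hl
  -- The strings available to a step are functions of the pair (input, suffix): the value and the
  -- suffix lie on the stacks of the recursion, the others stay where they were. If a function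
  -- arises in several ways, any of its places holds the right string. The default 0 is never used.
  let pos' : (α × List Γ' → List Γ') → ℕ := fun z =>
    if z = (fun p => acc p.1 p.2) then base + 1 else if z = (fun p => p.2) then base + 2 else
    if h : ∃ y ∈ Δ, z = fun p => y p.1 then pos h.choose else 0
  have hpos' : ∀ (a : α) (suf : List Γ') (s : Store), (∀ y ∈ Δ, s (pos y) = y a) →
      s (base + 1) = acc a suf → s (base + 2) = suf →
      ∀ z ∈ insert (fun p : α × List Γ' => acc p.1 p.2)
        (insert (fun p => p.2) ((fun y p => y p.1) '' Δ)),
      s (pos' z) = z (a, suf) := by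
    intro a suf s hs h1 h2 z hz
    simp only [pos']
    split_ifs with c1 c2 c3
    · simp [c1, h1]
    · simp [c2, h2]
    · rw [hs _ c3.choose_spec.1]
      conv_rhs => rw [c3.choose_spec.2]
    · rcases hz with hz | hz | ⟨y, hy, rfl⟩
      exacts [absurd hz c1, absurd hz c2, absurd ⟨y, hy, rfl⟩ c3]
  have hposlt : ∀ z ∈ insert (fun p : α × List Γ' => acc p.1 p.2)
      (insert (fun p => p.2) ((fun y p => y p.1) '' Δ)), pos' z < base + 3 := by
    intro z hz
    simp only [pos']
    split_ifs with c1 c2 c3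
    · omega
    · omega
    · exact (hpos _ c3.choose_spec.1).trans (by omega)
    · omega
  choose p t ht hr using fun c => hstep' c pos' (base + 3) hposlt
  choose q hq using ht
  obtain ⟨b, hb⟩ := hacc
  -- The sum over all symbols bounds the time of a step independently of the symbol read.
  have hQ : PolyBounded sz D fun a => ∑ c, (q c).eval (sz a) :=
    ⟨∑ c, q c, fun a _ => by rw [Polynomial.eval_finsetSum]⟩
  have hA : PolyBounded sz D fun a => b.eval (sz a) := ⟨b, fun a _ => le_rfl⟩
  refine ⟨Yields.recCmd (pos l) base p₀ p, _, (((ht₀.add (hlb.mul ((hQ.add ((PolyBounded.const 6).mul hA)).add (.const 6)))).add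
    ((PolyBounded.const 9).mul hlb)).add ((PolyBounded.const 4).mul hA)).add (.const 7),
    fun a ha s h₁ h₂ => ?_⟩
  refine Yields.recursion h₂ hlt (p₀ := p₀) (p := p) (f := acc a) (h₁ l hl) (fun r => ?_)
    (fun c suf r hsuf => ?_) fun suf hsuf => hb (a, suf) ⟨ha, hsuf⟩
  · exact hr₀ a ha _ (fun y hy => by
      rw [Function.update_of_ne (hpos y hy).ne, h₁ y hy]) fun j hj => by
      rw [Function.update_of_ne (by omega), h₂ j (by omega)]
  · obtain ⟨u, hu, hru⟩ := hr c (a, suf) ⟨ha, hsuf⟩ (Yields.recStore s base r (acc a suf) suf)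
      (hpos' a suf _ (fun y hy => by
        have := hpos y hy
        rw [Yields.recStore, Function.update_of_ne (by omega), Function.update_of_ne (by omega),
          Function.update_of_ne (by omega), h₁ y hy])
        (by simp [Yields.recStore]) (by simp [Yields.recStore])) (fun j hj => by
        rw [Yields.recStore, Function.update_of_ne (by omega), Function.update_of_ne (by omega),
          Function.update_of_ne (by omega), h₂ j (by omega)])
    exact ⟨u, hu.trans ((hq c (a, suf) ⟨ha, hsuf⟩).trans (Finset.single_le_sum
      (f := fun c => (q c).eval (sz a)) (fun _ _ => Nat.zero_le _) (Finset.mem_univ c))), hru⟩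

theorem foldr {l : α → List Γ'} (hl : PolyComp sz D Δ l) (acc : α → List Γ' → List Γ')
    (hacc : PolyBounded (fun p : α × List Γ' => sz p.1) {p | p.1 ∈ D ∧ p.2 <:+ l p.1}
      fun p => (acc p.1 p.2).length)
    (h₀ : PolyComp sz D Δ fun a => acc a [])
    (hstep : ∀ c, PolyComp (fun p : α × List Γ' => sz p.1) {p | p.1 ∈ D ∧ (c :: p.2) <:+ l p.1}
      (insert (fun p => acc p.1 p.2) (insert (fun p => p.2) ((fun y p => y p.1) '' Δ)))
      fun p => acc p.1 (c :: p.2)) :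
    PolyComp sz D Δ fun a => acc a (l a) :=
  hl.cut <| foldr_of_mem (Set.mem_insert _ _) acc hacc (h₀.weaken (Set.subset_insert _ _))
    fun c => (hstep c).weaken <| Set.insert_subset_insert <| Set.insert_subset_insert <|
      Set.image_mono (Set.subset_insert _ _)

end PolyComp

namespace PolyComp

variable {α : Type} {sz : α → ℕ} {D : Set α} {Δ Δ' : Set (α → List Γ')} {x y z : α → List Γ'}

/-! ### Computing with strings -/

/-- With the input on stack 0 and `base = 1`, the result appears on the output stack; it remains to
clear the input. -/
theorem nonempty_computableInPolyTime {β : Type} {ea : α → List Γ'} {eb : β → List Γ'} {f : α → β}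
    (h : PolyComp (fun a => (ea a).length) Set.univ {ea} fun a => eb (f a)) :
    Nonempty (Turing.TM2ComputableInPolyTime ea eb f) := by
  obtain ⟨-, h⟩ := h (by
    rintro y rfl
    exact .size)
  obtain ⟨c, t, ⟨p, hp⟩, hr⟩ := h (fun _ => 0) 1 fun _ _ => Nat.one_pos
  refine _root_.nonempty_computableInPolyTime (.seq c (.loop 0 fun _ => .skip))
    (p + (2 * Polynomial.X + 1)) fun a => ?_
  refine ((hr a trivial (update (fun _ => []) 0 (ea a)) ?_ ?_).seq (Yields.clear 0 (l := ea a) ?_)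
    (T := (p + (2 * Polynomial.X + 1)).eval (ea a).length) ?_).of_eq ?_
  · rintro y rfl
    simp
  · intro j hj
    rw [Function.update_of_ne (by omega)]
  · simp
  · have := hp a trivial
    simp only [Polynomial.eval_add, Polynomial.eval_mul, Polynomial.eval_ofNat,
      Polynomial.eval_X, Polynomial.eval_one] at this ⊢
    omega
  · funext j
    simp only [Function.update_apply]
    split_ifs <;> first | rfl | omega

/-- The length bounds on `Δ` are a premise inside `PolyComp`; this makes them available while a
program is being built. -/
theorem of_bounded
    (h : (∀ y ∈ Δ, PolyBounded sz D fun a => (y a).length) → PolyComp sz D Δ x) :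
    PolyComp sz D Δ x :=
  fun hΔ => h hΔ hΔ

theorem bounded (h : PolyComp sz D Δ x) (hΔ : ∀ y ∈ Δ, PolyBounded sz D fun a => (y a).length) :
    PolyBounded sz D fun a => (x a).length :=
  (h hΔ).1

/-- Two computable strings may be used as auxiliary ones. -/
theorem cut₂ (hx : PolyComp sz D Δ x) (hy : PolyComp sz D Δ y)
    (h : PolyComp sz D (insert y (insert x Δ)) z) : PolyComp sz D Δ z :=
  hx.cut ((hy.weaken (Set.subset_insert _ _)).cut h)

/-- The body of a loop works on pairs of an input and a loop variable; a program for the input alone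
serves there unchanged. -/
theorem comap {β : Type} (f : β → α) {D' : Set β} (hD : ∀ b ∈ D', f b ∈ D)
    (hΔ : ∀ y ∈ Δ, PolyBounded sz D fun a => (y a).length) (h : PolyComp sz D Δ x) :
    PolyComp (fun b => sz (f b)) D' ((fun y b => y (f b)) '' Δ) fun b => x (f b) := by
  intro _
  obtain ⟨hb, hc⟩ := h hΔ
  refine ⟨hb.comap f hD, fun pos base hpos => ?_⟩
  obtain ⟨c, t, ht, hr⟩ := hc (fun y => pos fun b => y (f b)) base
    fun y hy => hpos _ ⟨y, hy, rfl⟩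
  exact ⟨c, fun b => t (f b), ht.comap f hD, fun b hb' s h₁ h₂ =>
    hr (f b) (hD b hb') s (fun y hy => h₁ _ ⟨y, hy, rfl⟩) h₂⟩

/-- The string `y` is the start of a recursion along `x` that puts back one symbol of `x` at a time.
-/
theorem append (hx : PolyComp sz D Δ x) (hy : PolyComp sz D Δ y) :
    PolyComp sz D Δ fun a => x a ++ y a := by
  refine cut₂ hx hy (of_bounded fun hΔ => ?_)
  refine foldr_of_mem (l := x) (by simp) (fun a suf => suf ++ y a) ?_ (of_mem (by simp))
    fun c => cons c (of_mem (by simp))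
  refine (((hΔ x (by simp)).comap Prod.fst ?_).add ((hΔ y (by simp)).comap Prod.fst ?_)).mono ?_
  · exact fun p hp => hp.1
  · exact fun p hp => hp.1
  · intro p hp
    have := hp.2.length_le
    simp only [List.length_append]
    omega

theorem const (l : List Γ') : PolyComp sz D Δ fun _ => l := by
  induction l with
  | nil => exact nil
  | cons c l ih => exact ih.cons c

/-- Recursion over the suffixes of a string, with values that are not longer than the suffixes. -/
theorem foldr_of_length_le (hx : PolyComp sz D Δ x) (acc : List Γ' → List Γ')
    (hacc : ∀ l, (acc l).length ≤ l.length)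
    (hstep : ∀ c, PolyComp (fun p : α × List Γ' => sz p.1) {p | p.1 ∈ D ∧ (c :: p.2) <:+ x p.1}
      {fun p => acc p.2, fun p => p.2} fun p => acc (c :: p.2)) :
    PolyComp sz D Δ fun a => acc (x a) := by
  refine hx.cut (of_bounded fun hΔ => ?_)
  refine foldr_of_mem (l := x) (by simp) (fun _ => acc) ?_ ?_ fun c => (hstep c).weaken ?_
  · exact ((hΔ x (by simp)).comap Prod.fst (fun p hp => hp.1)).mono fun p hp =>
      (hacc _).trans hp.2.length_le
  · exact const _
  · rintro _ (rfl | rfl) <;> simp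

theorem takeWhile (p : Γ' → Bool) (hx : PolyComp sz D Δ x) :
    PolyComp sz D Δ fun a => (x a).takeWhile p := by
  refine hx.foldr_of_length_le (fun l => l.takeWhile p)
    (fun l => (List.takeWhile_prefix p).length_le) fun c => ?_
  cases h : p c
  · exact nil.congr fun a _ => by simp [h]
  · exact (cons c (of_mem (x := fun q : α × List Γ' => q.2.takeWhile p) (by simp))).congr
      fun a _ => by simp [h]

theorem dropWhile (p : Γ' → Bool) (hx : PolyComp sz D Δ x) :
    PolyComp sz D Δ fun a => (x a).dropWhile p := by
  refine hx.foldr_of_length_le (fun l => l.dropWhile p)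
    (fun l => (List.dropWhile_suffix p).length_le) fun c => ?_
  cases h : p c
  · exact (cons c (of_mem (x := fun q : α × List Γ' => q.2) (by simp))).congr
      fun a _ => by simp [h]
  · exact (of_mem (x := fun q : α × List Γ' => q.2.dropWhile p) (by simp)).congr
      fun a _ => by simp [h]

/-- Both alternatives are computed beforehand, so that only a copy remains to be chosen. The test is
emptiness of `x`, visible from its top symbol. -/
theorem cond {P : α → Prop} [DecidablePred P] (hx : PolyComp sz D Δ x)
    (hP : ∀ a ∈ D, x a = [] ↔ P a) (hy : PolyComp sz D Δ y) (hz : PolyComp sz D Δ z) :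
    PolyComp sz D Δ fun a => if P a then y a else z a := by
  refine cut₂ hy hz (case_head (hx.weaken ?_) fun o => ?_)
  · exact (Set.subset_insert _ _).trans (Set.subset_insert _ _)
  · cases o with
    | none =>
      refine (of_mem (x := y) (by simp)).congr fun a ha => if_pos ((hP a ha.1).1 ?_)
      simpa using ha.2
    | some c =>
      refine (of_mem (x := z) (by simp)).congr fun a ha => if_neg fun h => ?_
      have := ha.2
      simp [(hP a ha.1).2 h] at this

/-- Case distinction by whether the first symbol of a string is `c`. -/
theorem cond_head {P : α → Prop} [DecidablePred P] (c : Γ') (hx : PolyComp sz D Δ x)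
    (hP : ∀ a ∈ D, (x a).head? = some c ↔ P a) (hy : PolyComp sz D Δ y) (hz : PolyComp sz D Δ z) :
    PolyComp sz D Δ fun a => if P a then y a else z a := by
  refine cut₂ hy hz (case_head (hx.weaken ?_) fun o => ?_)
  · exact (Set.subset_insert _ _).trans (Set.subset_insert _ _)
  · by_cases ho : o = some c
    · exact (of_mem (x := y) (by simp)).congr fun a ha =>
        if_pos ((hP a ha.1).1 (ha.2.trans ho))
    · exact (of_mem (x := z) (by simp)).congr fun a ha =>
        if_neg fun h => ho (ha.2.symm.trans ((hP a ha.1).2 h))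

end PolyComp

/-! ### Computing with numbers in unary notation -/

/-- A number in unary notation. -/
def ones (k : ℕ) : List Γ' := List.replicate k (Γ'.bit true)

@[simp] theorem length_ones (k : ℕ) : (ones k).length = k := List.length_replicate

@[simp] theorem ones_eq_nil {k : ℕ} : ones k = [] ↔ k = 0 := by simp [ones]

@[simp] theorem ones_zero : ones 0 = [] := rfl

theorem ones_add (k l : ℕ) : ones (k + l) = ones k ++ ones l := List.replicate_add ..

namespace PolyComp

variable {α : Type} {sz : α → ℕ} {D : Set α} {Δ Δ' : Set (α → List Γ')} {x y z : α → List Γ'}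
  {f g : α → ℕ}

/-- A unary counter is a string whose suffixes are the smaller counters, so recursion along it is a
counted loop. The bound `hacc` prevents the values from growing exponentially. -/
theorem iterate (hf : PolyComp sz D Δ fun a => ones (f a)) (acc : α → ℕ → List Γ')
    (hacc : PolyBounded (fun p : α × ℕ => sz p.1) {p | p.1 ∈ D ∧ p.2 ≤ f p.1}
      fun p => (acc p.1 p.2).length)
    (h₀ : PolyComp sz D Δ fun a => acc a 0)
    (hstep : PolyComp (fun p : α × ℕ => sz p.1) {p | p.1 ∈ D ∧ p.2 < f p.1}
      (insert (fun p => acc p.1 p.2) (insert (fun p => ones p.2) ((fun y p => y p.1) '' Δ)))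
      fun p => acc p.1 (p.2 + 1)) :
    PolyComp sz D Δ fun a => acc a (f a) := by
  refine of_bounded fun hΔ => ?_
  have hfb := hf.bounded hΔ
  refine (hf.foldr (fun a l => acc a l.length) ?_ h₀ fun c => ?_).congr fun a _ => by simp
  · exact (hacc.comap (fun p : α × List Γ' => (p.1, p.2.length)) fun p hp =>
      ⟨hp.1, by simpa using hp.2.length_le⟩)
  · have hD : ∀ p ∈ {p : α × List Γ' | p.1 ∈ D ∧ (c :: p.2) <:+ ones (f p.1)},
        (p.1, p.2.length) ∈ {p : α × ℕ | p.1 ∈ D ∧ p.2 < f p.1} :=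
      fun p hp => ⟨hp.1, by simpa using hp.2.length_le⟩
    refine cut (x := fun p : α × List Γ' => ones p.2.length)
      ((of_mem (x := fun p => p.2) (by simp)).congr fun p hp => ?_)
      ((comap (fun p : α × List Γ' => (p.1, p.2.length)) hD ?_ hstep).weaken ?_)
    -- The suffix that remains is itself a unary number and thus determined by its length.
    · obtain ⟨k, hk⟩ : ∃ k, p.2 = ones k := by
        have h := (List.suffix_cons _ _).trans hp.2
        exact ⟨_, (List.suffix_replicate_iff.1 h).2⟩
      rw [hk, length_ones]
    · rintro z (rfl | rfl | ⟨y, hy, rfl⟩)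
      · exact hacc.subset fun p hp => ⟨hp.1, hp.2.le⟩
      · refine (hfb.comap Prod.fst fun p hp => hp.1).mono fun p hp => ?_
        simpa using hp.2.le
      · exact (hΔ y hy).comap Prod.fst fun p hp => hp.1
    · rintro _ ⟨z, rfl | rfl | ⟨y, hy, rfl⟩, rfl⟩
      · exact Or.inr (Or.inl rfl)
      · exact Or.inl rfl
      · exact Or.inr (Or.inr (Or.inr ⟨y, hy, rfl⟩))

/-- One polynomial bounds all items, so the accumulated string has at most `f` times that length. -/
theorem flatMap_range (hf : PolyComp sz D Δ fun a => ones (f a)) {body : α → ℕ → List Γ'}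
    (hbody : PolyComp (fun p : α × ℕ => sz p.1) {p | p.1 ∈ D ∧ p.2 < f p.1}
      (insert (fun p => ones p.2) ((fun y p => y p.1) '' Δ)) fun p => body p.1 p.2) :
    PolyComp sz D Δ fun a => (List.range (f a)).flatMap (body a) := by
  refine of_bounded fun hΔ => ?_
  have hfb := hf.bounded hΔ
  obtain ⟨q, hq⟩ := hbody.bounded (by
    rintro z (rfl | ⟨y, hy, rfl⟩)
    · refine (hfb.comap Prod.fst fun p hp => hp.1).mono fun p hp => ?_
      simpa using hp.2.le
    · exact (hΔ y hy).comap Prod.fst fun p hp => hp.1)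
  refine hf.iterate (fun a i => (List.range i).flatMap (body a)) ?_ nil ?_
  · refine ((hfb.comap Prod.fst fun p hp => hp.1).mul
      (t' := fun p => q.eval (sz p.1)) ⟨q, fun p _ => le_rfl⟩).mono ?_
    rintro ⟨a, i⟩ ⟨ha, hi⟩
    simp only [List.length_flatMap, length_ones]
    refine (List.sum_le_card_nsmul _ (q.eval (sz a)) ?_).trans ?_
    · simp only [List.mem_map, List.mem_range]
      rintro _ ⟨j, hj, rfl⟩
      exact hq (a, j) ⟨ha, lt_of_lt_of_le hj hi⟩
    · simp only [List.length_map, List.length_range, smul_eq_mul]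
      exact Nat.mul_le_mul_right _ hi
  · refine ((of_mem (x := fun p : α × ℕ => (List.range p.2).flatMap (body p.1)) (by simp)).append
      (hbody.weaken (Set.subset_insert _ _))).congr fun p _ => ?_
    simp [List.range_succ]

theorem add (hf : PolyComp sz D Δ fun a => ones (f a)) (hg : PolyComp sz D Δ fun a => ones (g a)) :
    PolyComp sz D Δ fun a => ones (f a + g a) :=
  (hf.append hg).congr fun _ _ => ones_add _ _

theorem number (k : ℕ) : PolyComp sz D Δ fun _ => ones k := const _

theorem succ (hf : PolyComp sz D Δ fun a => ones (f a)) :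
    PolyComp sz D Δ fun a => ones (f a + 1) :=
  hf.cons _

theorem mul (hf : PolyComp sz D Δ fun a => ones (f a)) (hg : PolyComp sz D Δ fun a => ones (g a)) :
    PolyComp sz D Δ fun a => ones (f a * g a) := by
  refine hg.cut (((hf.weaken (Set.subset_insert _ _)).flatMap_range (body := fun a _ => ones (g a))
    (of_mem (Or.inr ⟨_, Set.mem_insert _ _, rfl⟩))).congr fun a _ => ?_)
  induction f a with
  | zero => simp
  | succ k ih => simp [List.range_succ, add_mul, ones_add, ih]

theorem drop (hx : PolyComp sz D Δ x) (hf : PolyComp sz D Δ fun a => ones (f a)) :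
    PolyComp sz D Δ fun a => (x a).drop (f a) := by
  refine of_bounded fun hΔ => ?_
  refine hf.iterate (fun a i => (x a).drop i) ?_ hx ?_
  · refine ((hx.bounded hΔ).comap Prod.fst fun p hp => hp.1).mono fun p _ => ?_
    simp
  · refine (of_mem (x := fun p : α × ℕ => (x p.1).drop p.2) (by simp)).tail.congr fun p _ => ?_
    simp

theorem sub (hf : PolyComp sz D Δ fun a => ones (f a)) (hg : PolyComp sz D Δ fun a => ones (g a)) :
    PolyComp sz D Δ fun a => ones (f a - g a) :=
  (hf.drop hg).congr fun a _ => by simp [ones]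

/-- Two natural numbers agree iff both truncated differences vanish. -/
theorem ite_eq (hf : PolyComp sz D Δ fun a => ones (f a))
    (hg : PolyComp sz D Δ fun a => ones (g a)) (hx : PolyComp sz D Δ x) (hy : PolyComp sz D Δ y) :
    PolyComp sz D Δ fun a => if f a = g a then x a else y a :=
  ((hf.sub hg).add (hg.sub hf)).cond (fun a _ => by rw [ones_eq_nil]; omega) hx hy

theorem length (hx : PolyComp sz D Δ x) : PolyComp sz D Δ fun a => ones (x a).length := by
  refine hx.foldr_of_length_le (fun l => ones l.length) (fun l => by simp) fun c => ?_
  exact succ (of_mem (by simp))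

theorem count (c : Γ') (hx : PolyComp sz D Δ x) :
    PolyComp sz D Δ fun a => ones ((x a).count c) := by
  refine hx.foldr_of_length_le (fun l => ones (l.count c)) (fun l => ?_) fun d => ?_
  · simpa using List.count_le_length
  · have h : PolyComp (fun p : α × List Γ' => sz p.1) {p | p.1 ∈ D ∧ (d :: p.2) <:+ x p.1}
        {fun p => ones (p.2.count c), fun p => p.2} (fun p => ones (p.2.count c)) :=
      of_mem (by simp)
    by_cases hd : d = c
    · exact h.succ.congr fun p _ => by simp [hd]
    · exact h.congr fun p _ => by simp [hd]

theorem mod_two (hf : PolyComp sz D Δ fun a => ones (f a)) :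
    PolyComp sz D Δ fun a => ones (f a % 2) := by
  refine (hf.foldr_of_length_le (fun l => ones (l.length % 2)) (fun l => ?_) fun c => ?_).congr
    fun a _ => by simp
  · simpa using Nat.mod_le _ _
  · refine (cond (P := fun p : α × List Γ' => p.2.length % 2 = 0)
      (of_mem (x := fun p : α × List Γ' => ones (p.2.length % 2)) (by simp)) (by simp) (number 1)
      (number 0)).congr fun p _ => ?_
    simp only [List.length_cons]
    split_ifs <;> congr 1 <;> omega

/-- Recursion by (l + 1) / 2 = l / 2 + l % 2. -/
theorem div_two (hf : PolyComp sz D Δ fun a => ones (f a)) :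
    PolyComp sz D Δ fun a => ones (f a / 2) := by
  refine (hf.foldr_of_length_le (fun l => ones (l.length / 2)) (fun l => ?_) fun c => ?_).congr
    fun a _ => by simp
  · simpa using Nat.div_le_self _ _
  · have h : PolyComp (fun p : α × List Γ' => sz p.1) {p | p.1 ∈ D ∧ (c :: p.2) <:+ ones (f p.1)}
        {fun p => ones (p.2.length / 2), fun p => p.2} (fun p => ones p.2.length) :=
      length (of_mem (by simp))
    refine ((of_mem (x := fun p : α × List Γ' => ones (p.2.length / 2)) (by simp)).add
      h.mod_two).congr fun p _ => ?_
    simp only [List.length_cons]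
    congr 1
    omega

end PolyComp

/-! ### Computing with numbers in binary notation -/

/-- A number in binary notation, with the least significant digit first. -/
def binary (k : ℕ) : List Γ' := (encodeNat k).map Γ'.bit

@[simp] theorem binary_zero : binary 0 = [] := rfl

theorem binary_double {k : ℕ} (hk : k ≠ 0) : binary (2 * k) = Γ'.bit false :: binary k := by
  have h : ((2 * k : ℕ) : Num) = Num.bit0 (k : Num) := by
    rw [two_mul, Nat.cast_add, Num.bit0_of_bit0]
  have h' : (k : Num) ≠ 0 := by exact_mod_cast hk
  unfold binary encodeNat
  rw [h]
  cases e : (k : Num) with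
  | zero => exact absurd e h'
  | pos p => rfl

theorem binary_double_add_one (k : ℕ) : binary (2 * k + 1) = Γ'.bit true :: binary k := by
  have h : ((2 * k + 1 : ℕ) : Num) = Num.bit1 (k : Num) := by
    rw [two_mul, Nat.cast_add, Nat.cast_add, Nat.cast_one, Num.bit1_of_bit1]
  unfold binary encodeNat
  rw [h]
  cases e : (k : Num) with
  | zero => rfl
  | pos p => rfl

theorem binary_eq_nil {k : ℕ} : binary k = [] ↔ k = 0 := by
  refine ⟨fun h => ?_, fun h => by rw [h, binary_zero]⟩
  by_contra hk
  rcases Nat.even_or_odd' k with ⟨l, rfl | rfl⟩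
  · rw [binary_double (by omega)] at h
    simp at h
  · rw [binary_double_add_one] at h
    simp at h

/-- The inner test keeps zero the empty string: the notation has no leading zeros. -/
theorem binary_double_add (k b : ℕ) (hb : b < 2) : binary (2 * k + b) =
    if b = 1 then Γ'.bit true :: binary k else
    if binary k = [] then [] else Γ'.bit false :: binary k := by
  obtain rfl | rfl : b = 0 ∨ b = 1 := by omega
  · rw [if_neg zero_ne_one, add_zero]
    split_ifs with hk
    · rw [binary_eq_nil.1 hk, mul_zero, binary_zero]
    · exact binary_double fun h => hk (binary_eq_nil.2 h)
  · rw [if_pos rfl, binary_double_add_one]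

theorem tail_binary (k : ℕ) : (binary k).tail = binary (k / 2) := by
  rcases Nat.even_or_odd' k with ⟨l, rfl | rfl⟩
  · rcases eq_or_ne l 0 with rfl | hl
    · rfl
    · rw [binary_double hl, Nat.mul_div_cancel_left _ two_pos, List.tail_cons]
  · rw [binary_double_add_one, List.tail_cons]
    congr 1
    omega

theorem drop_binary (k i : ℕ) : (binary k).drop i = binary (k / 2 ^ i) := by
  induction i with
  | zero => simp
  | succ i ih =>
    rw [← List.tail_drop, ih, tail_binary, Nat.div_div_eq_div_mul, pow_succ]

theorem head_binary (k : ℕ) : (binary k).head? = some (Γ'.bit true) ↔ k % 2 = 1 := by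
  rcases Nat.even_or_odd' k with ⟨l, rfl | rfl⟩
  · rcases eq_or_ne l 0 with rfl | hl
    · simp
    · simp [binary_double hl]
  · rw [binary_double_add_one]
    simp [Nat.add_mod]

theorem lt_two_pow_length_binary (k : ℕ) : k < 2 ^ (binary k).length := by
  have h := drop_binary k (binary k).length
  rw [List.drop_length, eq_comm, binary_eq_nil, Nat.div_eq_zero_iff] at h
  exact h.resolve_left (by positivity)

theorem length_binary_double_add_le (k b : ℕ) (hb : b < 2) :
    (binary (2 * k + b)).length ≤ (binary k).length + 1 := by
  rw [binary_double_add k b hb]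
  split_ifs <;> simp

/-- The binary notation of a number from a list of its digits, with leading zeros. -/
theorem binary_foldr_digits (t w : ℕ) (ht : t < 2 ^ w) :
    ((List.range w).map fun k => Γ'.bit (decide (t / 2 ^ k % 2 = 1))).foldr
      (fun c l => if c = Γ'.bit true then Γ'.bit true :: l else
        if l = [] then [] else Γ'.bit false :: l) [] = binary t := by
  induction w generalizing t with
  | zero =>
    obtain rfl : t = 0 := by simpa using ht
    rfl
  | succ w ih =>
    have h := ih (t / 2) (by rw [pow_succ] at ht; omega)
    simp only [Nat.div_div_eq_div_mul, ← pow_succ'] at h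
    rw [List.range_succ_eq_map, List.map_cons, List.map_map, List.foldr_cons]
    simp only [Function.comp_def, Nat.succ_eq_add_one]
    rw [h]
    conv_rhs => rw [← Nat.div_add_mod t 2, binary_double_add _ _ (Nat.mod_lt _ two_pos)]
    simp

/-- The carry into the digit `i` when `m` and `n` are added. -/
def carry (m n i : ℕ) : ℕ := (m + n) / 2 ^ i - m / 2 ^ i - n / 2 ^ i

theorem div_two_pow_succ (m i : ℕ) : m / 2 ^ (i + 1) = m / 2 ^ i / 2 := by
  rw [pow_succ, Nat.div_div_eq_div_mul]

/-- Both claims are proved together: the bound at one digit guarantees that the truncated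
differences at the next one are exact. -/
theorem carry_spec (m n i : ℕ) :
    (m + n) / 2 ^ i = m / 2 ^ i + n / 2 ^ i + carry m n i ∧ carry m n i ≤ 1 := by
  unfold carry
  induction i with
  | zero => simp
  | succ i ih =>
    simp only [div_two_pow_succ]
    omega

theorem carry_succ (m n i : ℕ) :
    carry m n (i + 1) = (m / 2 ^ i % 2 + n / 2 ^ i % 2 + carry m n i) / 2 := by
  have h := carry_spec m n i
  have h' := carry_spec m n (i + 1)
  simp only [div_two_pow_succ] at h'
  omega

/-- The borrow from the digit `i` when `n` is subtracted from `m`. -/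
def borrow (m n i : ℕ) : ℕ := (((m / 2 ^ i : ℕ) : ℤ) - (n / 2 ^ i : ℕ) - (m - n) / 2 ^ i).toNat

theorem int_div_two_pow_succ (m : ℤ) (i : ℕ) : m / 2 ^ (i + 1) = m / 2 ^ i / 2 := by
  rw [pow_succ, Int.ediv_ediv_of_nonneg (by positivity)]

/-- The difference is taken in the integers with floor division, so the identity also holds when it
is negative. -/
theorem borrow_spec (m n i : ℕ) : ((m / 2 ^ i : ℕ) : ℤ) =
    (n / 2 ^ i : ℕ) + ((m : ℤ) - n) / 2 ^ i + borrow m n i ∧ borrow m n i ≤ 1 := by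
  unfold borrow
  induction i with
  | zero => simp
  | succ i ih =>
    simp only [div_two_pow_succ, int_div_two_pow_succ]
    omega

theorem borrow_succ (m n i : ℕ) :
    borrow m n (i + 1) = (n / 2 ^ i % 2 + borrow m n i - m / 2 ^ i % 2 + 1) / 2 := by
  have h := borrow_spec m n i
  have h' := borrow_spec m n (i + 1)
  simp only [div_two_pow_succ, int_div_two_pow_succ] at h'
  omega

/-- Beyond the last digit both quotients are zero, and the borrow is minus the floor of (m - n) /
2^i, which vanishes iff m - n is not negative. -/
theorem borrow_eq_zero_iff {m n i : ℕ} (hm : m < 2 ^ i) (hn : n < 2 ^ i) :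
    borrow m n i = 0 ↔ n ≤ m := by
  have h := (borrow_spec m n i).1
  rw [Nat.div_eq_of_lt hm, Nat.div_eq_of_lt hn] at h
  have hi : (0 : ℤ) < 2 ^ i := by positivity
  constructor
  · intro h0
    have h1 : ((m : ℤ) - n) / 2 ^ i = 0 := by omega
    have := Int.ediv_nonneg_iff_of_pos hi |>.1 h1.ge
    omega
  · intro h0
    have := Int.ediv_nonneg (a := (m : ℤ) - n) (by omega) hi.le
    omega

/-- Signs do not matter modulo 2, so a digit of a difference is a sum of digits. -/
theorem sub_digit {m n : ℕ} (h : n ≤ m) (i : ℕ) :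
    (m - n) / 2 ^ i % 2 = (m / 2 ^ i % 2 + n / 2 ^ i % 2 + borrow m n i) % 2 := by
  have h₁ := (borrow_spec m n i).1
  have h₂ : ((m : ℤ) - n) / 2 ^ i = ((m - n) / 2 ^ i : ℕ) := by
    rw [← Nat.cast_sub h]
    norm_cast
  omega

namespace PolyComp

variable {α : Type} {sz : α → ℕ} {D : Set α} {Δ Δ' : Set (α → List Γ')} {x y z : α → List Γ'}
  {f g h : α → ℕ}

theorem binary_double_add (hf : PolyComp sz D Δ fun a => binary (f a))
    (hg : PolyComp sz D Δ fun a => ones (g a)) (hg2 : ∀ a ∈ D, g a < 2) :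
    PolyComp sz D Δ fun a => binary (2 * f a + g a) :=
  (hg.ite_eq (number 1) (hf.cons _) (hf.cond (P := fun a => binary (f a) = []) (fun _ _ => Iff.rfl)
    nil (hf.cons _))).congr fun a ha => _root_.binary_double_add _ _ (hg2 a ha)

/-- Repeated doubling. The exponent is unary, so the result is only polynomially longer. -/
theorem binary_mul_two_pow (hf : PolyComp sz D Δ fun a => binary (f a))
    (hg : PolyComp sz D Δ fun a => ones (g a)) :
    PolyComp sz D Δ fun a => binary (f a * 2 ^ g a) := by
  refine of_bounded fun hΔ => ?_
  refine hg.iterate (fun a i => binary (f a * 2 ^ i)) ?_ (hf.congr fun a _ => by simp) ?_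
  · refine (((hf.bounded hΔ).comap Prod.fst fun p hp => hp.1).add
      ((hg.bounded hΔ).comap Prod.fst fun p hp => hp.1)).mono ?_
    rintro ⟨a, i⟩ ⟨ha, hi⟩
    have : (binary (f a * 2 ^ i)).length ≤ (binary (f a)).length + i := by
      clear ha hi
      induction i with
      | zero => simp
      | succ i ih =>
        have := length_binary_double_add_le (f a * 2 ^ i) 0 (by omega)
        rw [add_zero, show 2 * (f a * 2 ^ i) = f a * 2 ^ (i + 1) by ring] at this
        omega
    simp only [length_ones] at hi ⊢
    omega
  · refine (binary_double_add (f := fun p : α × ℕ => f p.1 * 2 ^ p.2) (of_mem (by simp)) (number 0)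
      (by simp)).congr fun p _ => ?_
    rw [pow_succ]
    congr 1
    ring

/-- The digit `g` of a number in binary notation. -/
theorem digit (hf : PolyComp sz D Δ fun a => binary (f a))
    (hg : PolyComp sz D Δ fun a => ones (g a)) :
    PolyComp sz D Δ fun a => ones (f a / 2 ^ g a % 2) := by
  refine ((hf.drop hg).cond_head (P := fun a => f a / 2 ^ g a % 2 = 1) (.bit true) (fun a _ => ?_)
    (number 1) (number 0)).congr fun a _ => ?_
  · rw [drop_binary, head_binary]
  · split_ifs with h
    · rw [h]
    · congr 1
      omega

/-- A number can be computed in binary notation if its digits can be computed. -/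
theorem binary_of_digits (hg : PolyComp sz D Δ fun a => ones (g a)) (hfg : ∀ a ∈ D, f a < 2 ^ g a)
    (hf : PolyComp (fun p : α × ℕ => sz p.1) {p | p.1 ∈ D ∧ p.2 < g p.1}
      (insert (fun p => ones p.2) ((fun y p => y p.1) '' Δ))
      fun p => ones (f p.1 / 2 ^ p.2 % 2)) :
    PolyComp sz D Δ fun a => binary (f a) := by
  have h : PolyComp sz D Δ fun a => (List.range (g a)).flatMap
      fun k => [Γ'.bit (decide (f a / 2 ^ k % 2 = 1))] := by
    refine hg.flatMap_range ((hf.ite_eq (number 1) (const [Γ'.bit true])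
      (const [Γ'.bit false])).congr fun p _ => ?_)
    split_ifs with h <;> simp [h]
  refine (h.foldr_of_length_le (fun l => l.foldr
    (fun c l => if c = Γ'.bit true then Γ'.bit true :: l else
      if l = [] then [] else Γ'.bit false :: l) []) (fun l => ?_) fun c => ?_).congr fun a ha => ?_
  · induction l with
    | nil => simp
    | cons c l ih =>
      rw [List.foldr_cons, List.length_cons]
      split_ifs
      all_goals simp only [List.length_cons, List.length_nil]; omega
  · simp only [List.foldr_cons]
    split_ifs with hc
    · exact cons _ (of_mem (by simp))
    · exact cond (of_mem (Set.mem_insert _ _)) (fun _ _ => Iff.rfl) nil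
        (cons _ (of_mem (Set.mem_insert _ _)))
  · rw [← List.map_eq_flatMap, binary_foldr_digits _ _ (hfg a ha)]

theorem carry (hf : PolyComp sz D Δ fun a => binary (f a))
    (hg : PolyComp sz D Δ fun a => binary (g a)) (hh : PolyComp sz D Δ fun a => ones (h a)) :
    PolyComp sz D Δ fun a => ones (carry (f a) (g a) (h a)) := by
  refine cut₂ hf hg ((hh.weaken ?_).iterate (fun a i => ones (_root_.carry (f a) (g a) i)) ?_
    (nil.congr fun p _ => by simp [_root_.carry]) ?_)
  · exact (Set.subset_insert _ _).trans (Set.subset_insert _ _)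
  · exact (PolyBounded.const 1).mono fun p _ => by
      rw [length_ones]
      exact (carry_spec _ _ _).2
  · simp only [carry_succ]
    have hi : (fun p : α × ℕ => ones p.2) ∈ insert (fun p => ones (_root_.carry (f p.1) (g p.1) p.2))
        (insert (fun p => ones p.2) ((fun y (p : α × ℕ) => y p.1) '' insert (fun a => binary (g a))
          (insert (fun a => binary (f a)) Δ))) := by simp
    exact div_two (add (add (digit (of_mem (Or.inr (Or.inr ⟨_, Or.inr (Or.inl rfl), rfl⟩)))
      (of_mem hi)) (digit (of_mem (Or.inr (Or.inr ⟨_, Or.inl rfl, rfl⟩))) (of_mem hi)))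
      (of_mem (Or.inl rfl)))

theorem borrow (hf : PolyComp sz D Δ fun a => binary (f a))
    (hg : PolyComp sz D Δ fun a => binary (g a)) (hh : PolyComp sz D Δ fun a => ones (h a)) :
    PolyComp sz D Δ fun a => ones (borrow (f a) (g a) (h a)) := by
  refine cut₂ hf hg ((hh.weaken ?_).iterate (fun a i => ones (_root_.borrow (f a) (g a) i)) ?_
    (nil.congr fun p _ => by simp [_root_.borrow]) ?_)
  · exact (Set.subset_insert _ _).trans (Set.subset_insert _ _)
  · exact (PolyBounded.const 1).mono fun p _ => by
      rw [length_ones]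
      exact (borrow_spec _ _ _).2
  · simp only [borrow_succ]
    have hi : (fun p : α × ℕ => ones p.2) ∈
        insert (fun p => ones (_root_.borrow (f p.1) (g p.1) p.2)) (insert (fun p => ones p.2)
          ((fun y (p : α × ℕ) => y p.1) '' insert (fun a => binary (g a))
            (insert (fun a => binary (f a)) Δ))) := by simp
    exact div_two (succ (sub (add (digit (of_mem (Or.inr (Or.inr ⟨_, Or.inl rfl, rfl⟩)))
      (of_mem hi)) (of_mem (Or.inl rfl))) (digit (of_mem (Or.inr (Or.inr ⟨_, Or.inr (Or.inl rfl),
      rfl⟩))) (of_mem hi))))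

theorem binary_add (hf : PolyComp sz D Δ fun a => binary (f a))
    (hg : PolyComp sz D Δ fun a => binary (g a)) :
    PolyComp sz D Δ fun a => binary (f a + g a) := by
  refine cut₂ hf hg (binary_of_digits (g := fun a => (binary (f a)).length + (binary (g a)).length)
    (.add (length (of_mem (by simp))) (length (of_mem (by simp)))) (fun a _ => ?_) ?_)
  -- The sum of the two lengths is a sufficient number of digits: f + g < 2^|f| · 2^|g|.
  · have h₁ := lt_two_pow_length_binary (f a)
    have h₂ := lt_two_pow_length_binary (g a)
    rw [pow_add]
    nlinarith
  · have hf' := of_mem (sz := fun p : α × ℕ => sz p.1)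
      (D := {p | p.1 ∈ D ∧ p.2 < (binary (f p.1)).length + (binary (g p.1)).length})
      (show (fun p : α × ℕ => binary (f p.1)) ∈ insert (fun p : α × ℕ => ones p.2)
        ((fun y p => y p.1) '' insert (fun a => binary (g a)) (insert (fun a => binary (f a)) Δ))
        from Or.inr ⟨_, Or.inr (Or.inl rfl), rfl⟩)
    have hg' := of_mem (sz := fun p : α × ℕ => sz p.1)
      (D := {p | p.1 ∈ D ∧ p.2 < (binary (f p.1)).length + (binary (g p.1)).length})
      (show (fun p : α × ℕ => binary (g p.1)) ∈ insert (fun p : α × ℕ => ones p.2)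
        ((fun y p => y p.1) '' insert (fun a => binary (g a)) (insert (fun a => binary (f a)) Δ))
        from Or.inr ⟨_, Or.inl rfl, rfl⟩)
    refine (mod_two (add (add (digit hf' (of_mem (Or.inl rfl))) (digit hg' (of_mem (Or.inl rfl))))
      (carry hf' hg' (of_mem (Or.inl rfl))))).congr fun p _ => ?_
    have := carry_spec (f p.1) (g p.1) p.2
    congr 1
    omega

/-- The borrow beyond the last digit is computed first. If it is not zero, then f < g, the truncated
difference is zero and so are all its digits. -/
theorem binary_sub (hf : PolyComp sz D Δ fun a => binary (f a))
    (hg : PolyComp sz D Δ fun a => binary (g a)) :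
    PolyComp sz D Δ fun a => binary (f a - g a) := by
  have hw : PolyComp sz D Δ fun a => ones ((binary (f a)).length + (binary (g a)).length) :=
    hf.length.add hg.length
  refine cut₂ hf hg (cut ((borrow hf hg hw).weaken ?_) (binary_of_digits
    (g := fun a => (binary (f a)).length + (binary (g a)).length)
    (.add (length (of_mem (by simp))) (length (of_mem (by simp)))) (fun a _ => ?_) ?_))
  · exact (Set.subset_insert _ _).trans (Set.subset_insert _ _)
  · have h₁ := lt_two_pow_length_binary (f a)
    have h₂ : 2 ^ (binary (f a)).length ≤
        2 ^ ((binary (f a)).length + (binary (g a)).length) :=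
      Nat.pow_le_pow_right two_pos (Nat.le_add_right _ _)
    omega
  · have hf' := of_mem (sz := fun p : α × ℕ => sz p.1)
      (D := {p | p.1 ∈ D ∧ p.2 < (binary (f p.1)).length + (binary (g p.1)).length})
      (show (fun p : α × ℕ => binary (f p.1)) ∈ insert (fun p : α × ℕ => ones p.2)
        ((fun y p => y p.1) '' insert (fun a => ones (_root_.borrow (f a) (g a)
          ((binary (f a)).length + (binary (g a)).length))) (insert (fun a => binary (g a))
            (insert (fun a => binary (f a)) Δ)))
        from Or.inr ⟨_, Or.inr (Or.inr (Or.inl rfl)), rfl⟩)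
    have hg' := of_mem (sz := fun p : α × ℕ => sz p.1)
      (D := {p | p.1 ∈ D ∧ p.2 < (binary (f p.1)).length + (binary (g p.1)).length})
      (show (fun p : α × ℕ => binary (g p.1)) ∈ insert (fun p : α × ℕ => ones p.2)
        ((fun y p => y p.1) '' insert (fun a => ones (_root_.borrow (f a) (g a)
          ((binary (f a)).length + (binary (g a)).length))) (insert (fun a => binary (g a))
            (insert (fun a => binary (f a)) Δ)))
        from Or.inr ⟨_, Or.inr (Or.inl rfl), rfl⟩)
    refine (ite_eq (of_mem (Or.inr ⟨_, Or.inl rfl, rfl⟩)) (number 0) (mod_two (add (add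
      (digit hf' (of_mem (Or.inl rfl))) (digit hg' (of_mem (Or.inl rfl))))
      (borrow hf' hg' (of_mem (Or.inl rfl))))) (number 0)).congr fun p _ => ?_
    have h₁ : f p.1 < 2 ^ ((binary (f p.1)).length + (binary (g p.1)).length) :=
      (lt_two_pow_length_binary _).trans_le
        (Nat.pow_le_pow_right two_pos (Nat.le_add_right _ _))
    have h₂ : g p.1 < 2 ^ ((binary (f p.1)).length + (binary (g p.1)).length) :=
      (lt_two_pow_length_binary _).trans_le
        (Nat.pow_le_pow_right two_pos (Nat.le_add_left _ _))
    simp only [borrow_eq_zero_iff h₁ h₂]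
    split_ifs with h
    · rw [sub_digit h]
    · rw [Nat.sub_eq_zero_of_le (by omega), Nat.zero_div]

end PolyComp

/-! ### Graphs given by lists of pairs of natural numbers -/

/-- A list of pairs of natural numbers less than `N`, as a list of pairs of elements of `Fin N`. -/
def finPairs {N : ℕ} (l : List (ℕ × ℕ)) (h : ∀ p ∈ l, p.1 < N ∧ p.2 < N) :
    List (Fin N × Fin N) :=
  l.pmap (fun p hp => (⟨p.1, hp.1⟩, ⟨p.2, hp.2⟩)) h

theorem map_val_finPairs {N : ℕ} (l : List (ℕ × ℕ)) (h : ∀ p ∈ l, p.1 < N ∧ p.2 < N) :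
    (finPairs l h).map (fun p => (p.1.val, p.2.val)) = l := by
  simp [finPairs, List.map_pmap]

theorem mem_finPairs {N : ℕ} {l : List (ℕ × ℕ)} {h : ∀ p ∈ l, p.1 < N ∧ p.2 < N}
    {p : Fin N × Fin N} : p ∈ finPairs l h ↔ (p.1.val, p.2.val) ∈ l := by
  simp only [finPairs, List.mem_pmap]
  constructor
  · rintro ⟨q, hq, rfl⟩
    exact hq
  · exact fun hp => ⟨_, hp, rfl⟩

/-- The number of pairs of a list, up to order and repetition, that are separated by `a`. -/
def cutSize (l : List (ℕ × ℕ)) (a : ℕ → Bool) : ℕ :=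
  ((l.filter fun p => a p.1 != a p.2).map fun p => s(p.1, p.2)).toFinset.card

theorem cutSize_le (l : List (ℕ × ℕ)) (a : ℕ → Bool) :
    cutSize l a ≤ l.countP fun p => a p.1 != a p.2 := by
  refine (List.toFinset_card_le _).trans ?_
  rw [List.length_map, List.countP_eq_length_filter]

theorem cutSize_eq_card {l : List (ℕ × ℕ)} {a : ℕ → Bool} {E : Finset (Sym2 ℕ)}
    (h : ∀ e, e ∈ E ↔ ∃ p ∈ l, a p.1 ≠ a p.2 ∧ e = s(p.1, p.2)) : cutSize l a = E.card := by
  unfold cutSize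
  congr 1
  ext e
  rw [h]
  simp only [List.mem_toFinset, List.mem_map, List.mem_filter, bne_iff_ne, ne_eq]
  constructor
  · rintro ⟨p, ⟨h1, h2⟩, rfl⟩
    exact ⟨p, h1, h2, rfl⟩
  · rintro ⟨p, h1, h2, rfl⟩
    exact ⟨p, ⟨h1, h2⟩, rfl⟩

/-- As every pair has its first end on the side `true`, an unordered edge determines the ordered
pair, and no two indices are counted as one edge. -/
theorem card_le_cutSize {ι : Type} {l : List (ℕ × ℕ)} {a : ℕ → Bool} (s : Finset ι)
    (f : ι → ℕ × ℕ) (hf : ∀ i ∈ s, f i ∈ l ∨ (f i).swap ∈ l)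
    (ha : ∀ i ∈ s, a (f i).1 = true ∧ a (f i).2 = false) (hinj : Set.InjOn f s) :
    s.card ≤ cutSize l a := by
  refine Finset.card_le_card_of_injOn (fun i => s((f i).1, (f i).2)) ?_ ?_
  · intro i hi
    obtain ⟨h1, h2⟩ := ha i hi
    simp only [Finset.mem_coe, List.mem_toFinset, List.mem_map, List.mem_filter, bne_iff_ne]
    rcases hf i hi with h | h
    · exact ⟨f i, ⟨h, by simp [h1, h2]⟩, rfl⟩
    · exact ⟨(f i).swap, ⟨h, by simp [h1, h2]⟩, Sym2.eq_swap⟩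
  · intro i hi j hj hij
    obtain ⟨h1, h2⟩ := ha i hi
    obtain ⟨h3, h4⟩ := ha j hj
    refine hinj hi hj ?_
    simp only [Sym2.eq_iff] at hij
    rcases hij with h | h
    · exact Prod.ext h.1 h.2
    · rw [h.1, h4] at h1
      exact absurd h1 (by simp)

/-- The indicator function of a set of vertices. -/
def indicator {N : ℕ} (A : Finset (Fin N)) (y : ℕ) : Bool := decide (∃ h : y < N, ⟨y, h⟩ ∈ A)

theorem indicator_val {N : ℕ} (A : Finset (Fin N)) (y : Fin N) :
    indicator A y.val = decide (y ∈ A) := by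
  simp [indicator]

/-- A pair that is separated is not a loop, so the loops discarded by `SimpleGraph.fromEdgeSet` do
not matter. Comparing sets in `Sym2 ℕ` removes the bounds from the vertices. -/
theorem ncard_edgeCut {N : ℕ} {l : List (ℕ × ℕ)} (h : ∀ p ∈ l, p.1 < N ∧ p.2 < N)
    (A : Finset (Fin N)) :
    ((graphOfList (finPairs l h)).edgeCut A).ncard = cutSize l (indicator A) := by
  rw [← Set.ncard_image_of_injective _ (Sym2.map.injective Fin.val_injective), cutSize,
    ← Set.ncard_coe_finset]
  congr 1
  ext e
  simp only [SimpleGraph.edgeCut, graphOfList, SimpleGraph.edgeSet_fromEdgeSet, Set.mem_image,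
    Set.mem_ofPred_eq, Set.mem_sdiff, List.coe_toFinset, List.mem_map, List.mem_filter, bne_iff_ne]
  constructor
  · rintro ⟨e, ⟨⟨⟨p, hp, rfl⟩, -⟩, u, hu, v, hv, he⟩, rfl⟩
    refine ⟨(p.1.val, p.2.val), ⟨mem_finPairs.1 hp, ?_⟩, rfl⟩
    simp only [indicator_val, ne_eq, decide_eq_decide]
    rw [Sym2.eq_iff] at he
    rcases he with ⟨h1, h2⟩ | ⟨h1, h2⟩ <;> rw [h1, h2] <;> tauto
  · rintro ⟨p, ⟨hp, hne⟩, rfl⟩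
    obtain ⟨h1, h2⟩ := h p hp
    have e1 := indicator_val A ⟨p.1, h1⟩
    have e2 := indicator_val A ⟨p.2, h2⟩
    simp only at e1 e2
    rw [e1, e2, ne_eq, decide_eq_decide] at hne
    refine ⟨s(⟨p.1, h1⟩, ⟨p.2, h2⟩), ⟨⟨⟨(⟨p.1, h1⟩, ⟨p.2, h2⟩), mem_finPairs.2 hp, rfl⟩, ?_⟩, ?_⟩,
      rfl⟩
    · rw [Sym2.mem_diagSet, Sym2.mk_isDiag_iff]
      rintro h3
      exact hne (by rw [h3])
    · by_cases h3 : (⟨p.1, h1⟩ : Fin N) ∈ A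
      · exact ⟨_, h3, _, by tauto, rfl⟩
      · exact ⟨_, by tauto, _, h3, Sym2.eq_swap⟩

/-- A graph is connected if all functions that are constant on its edges are constant. -/
theorem connected_of_forall_const {N : ℕ} (hN : 0 < N) {l : List (ℕ × ℕ)}
    (h : ∀ p ∈ l, p.1 < N ∧ p.2 < N)
    (hc : ∀ (β : Type) (f : ℕ → β), (∀ p ∈ l, f p.1 = f p.2) → ∀ y < N, f y = f 0) :
    (graphOfList (finPairs l h)).Connected := by
  have : Nonempty (Fin N) := ⟨⟨0, hN⟩⟩
  rw [SimpleGraph.connected_iff]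
  refine ⟨?_, this⟩
  -- The hypothesis is applied to the map from a vertex to its component; `none` is a dummy value
  -- outside the vertex set.
  let f : ℕ → Option (graphOfList (finPairs l h)).ConnectedComponent := fun y =>
    if hy : y < N then some (SimpleGraph.connectedComponentMk _ ⟨y, hy⟩) else none
  have hf : ∀ u : Fin N, some (SimpleGraph.connectedComponentMk _ u) = f 0 := fun u => by
    rw [← hc _ f (fun p hp => ?_) u u.2]
    · simp [f]
    · obtain ⟨h1, h2⟩ := h p hp
      simp only [f, dif_pos h1, dif_pos h2, Option.some.injEq]
      rcases eq_or_ne p.1 p.2 with h3 | h3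
      · simp [h3]
      · refine SimpleGraph.ConnectedComponent.sound (SimpleGraph.Adj.reachable ?_)
        rw [graphOfList, SimpleGraph.fromEdgeSet_adj]
        exact ⟨⟨(⟨p.1, h1⟩, ⟨p.2, h2⟩), mem_finPairs.2 hp, rfl⟩, fun h => h3 (congrArg Fin.val h)⟩
  intro u v
  have := (hf u).trans (hf v).symm
  simpa using this

/-- A connected graph on N vertices has at least N - 1 edges, and the list leaves room for no more.
-/
theorem isTree_of_length {N : ℕ} {l : List (ℕ × ℕ)} (h : ∀ p ∈ l, p.1 < N ∧ p.2 < N)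
    (hc : (graphOfList (finPairs l h)).Connected) (hl : l.length + 1 ≤ N) :
    (graphOfList (finPairs l h)).IsTree := by
  classical
  rw [SimpleGraph.isTree_iff_connected_and_card]
  refine ⟨hc, le_antisymm ?_ hc.card_vert_le_card_edgeSet_add_one⟩
  have hsub : (graphOfList (finPairs l h)).edgeSet ⊆
      (((finPairs l h).map fun p => s(p.1, p.2)).toFinset : Set (Sym2 (Fin N))) := by
    intro e he
    rw [graphOfList, SimpleGraph.edgeSet_fromEdgeSet] at he
    obtain ⟨⟨p, hp, rfl⟩, -⟩ := he
    simp only [List.coe_toFinset, List.mem_map, Set.mem_ofPred_eq]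
    exact ⟨p, hp, rfl⟩
  have h1 := Set.ncard_le_ncard hsub (Finset.finite_toSet _)
  rw [Set.ncard_coe_finset] at h1
  have h2 := List.toFinset_card_le ((finPairs l h).map fun p => s(p.1, p.2))
  rw [List.length_map, finPairs, List.length_pmap] at h2
  rw [Nat.card_coe_set_eq, Nat.card_fin]
  unfold finPairs at *
  omega

theorem SimpleGraph.Connected.const_of_adj {V : Type} {G : SimpleGraph V} (h : G.Connected)
    {β : Type} {f : V → β} (hf : ∀ u v, G.Adj u v → f u = f v) (u v : V) : f u = f v := by
  obtain ⟨w⟩ := h.preconnected u v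
  induction w with
  | nil => rfl
  | cons hadj _ ih => exact (hf _ _ hadj).trans ih

/-! ### The graph and the tree of the reduction

Every vertex `x < n` of a multigraph with the edges `U j`, `V j`, for `j < m`, is replaced by the
clique of the vertices `i * n + x`, where `i < levels m`. -/

/-- The number of vertices of a clique. -/
def levels (m : ℕ) : ℕ := 11 * (m + 1)

/-- The first vertex of the level that belongs to the edge `j`. -/
def slot (n m j : ℕ) : ℕ := (10 * (m + 1) + 1 + j) * n

/-- The names of the components of the graph with the first `j` edges. -/
def label (U V : ℕ → ℕ) : ℕ → ℕ → ℕ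
  | 0, x => x
  | j + 1, x => if label U V j x = label U V j (V j) then label U V j (U j) else label U V j x

/-- The tree edges at the level that belongs to the edge `j`: an edge between the cliques of its
ends, and edges within the cliques. -/
def treeBlock (n m : ℕ) (U V : ℕ → ℕ) (j : ℕ) : List (ℕ × ℕ) :=
  (U j, slot n m j + V j) :: (List.range n).flatMap fun x =>
    if x = V j then
      if label U V j (U j) = label U V j (V j) then [] else [(x, slot n m j + x)]
    else [(x, slot n m j + x)]

/-- The edges of the tree. -/
def treeList (n m : ℕ) (U V : ℕ → ℕ) : List (ℕ × ℕ) :=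
  ((List.range (10 * (m + 1))).flatMap fun i => (List.range n).flatMap fun x =>
    [(i * n + x, (i + 1) * n + x)]) ++
    (List.range m).flatMap (treeBlock n m U V)

/-- A second edge for each edge of negative weight. -/
def minusList (n m : ℕ) (U V : ℕ → ℕ) (W : ℕ → ℤˣ) : List (ℕ × ℕ) :=
  (List.range m).flatMap fun j => if W j = 1 then [] else [(V j, slot n m j + U j)]

/-- The edges of the cliques. -/
def cliqueList (n m : ℕ) : List (ℕ × ℕ) :=
  (List.range (levels m)).flatMap fun i => (List.range i).flatMap fun d =>
    (List.range n).flatMap fun x => [(d * n + x, i * n + x)]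

/-- The edges of the graph. -/
def graphList (n m : ℕ) (U V : ℕ → ℕ) (W : ℕ → ℤˣ) : List (ℕ × ℕ) :=
  treeList n m U V ++ (minusList n m U V W ++ cliqueList n m)

section

variable {n m : ℕ} {U V : ℕ → ℕ} {W : ℕ → ℤˣ}

theorem mem_treeBlock {j : ℕ} {p : ℕ × ℕ} : p ∈ treeBlock n m U V j ↔
    p = (U j, slot n m j + V j) ∨ ∃ x < n, p = (x, slot n m j + x) ∧
      (x = V j → label U V j (U j) ≠ label U V j (V j)) := by
  simp only [treeBlock, List.mem_cons, List.mem_flatMap, List.mem_range]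
  refine or_congr_right ⟨?_, ?_⟩
  · rintro ⟨x, hx, h⟩
    refine ⟨x, hx, ?_⟩
    split_ifs at h with h1 h2 <;> simp_all
  · rintro ⟨x, hx, h, h'⟩
    refine ⟨x, hx, ?_⟩
    split_ifs with h1 h2
    · exact absurd h2 (h' h1)
    · simp [h]
    · simp [h]

theorem mem_treeList {p : ℕ × ℕ} : p ∈ treeList n m U V ↔
    (∃ i < 10 * (m + 1), ∃ x < n, p = (i * n + x, (i + 1) * n + x)) ∨
      ∃ j < m, p ∈ treeBlock n m U V j := by
  simp [treeList]

theorem mem_minusList {p : ℕ × ℕ} : p ∈ minusList n m U V W ↔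
    ∃ j < m, W j ≠ 1 ∧ p = (V j, slot n m j + U j) := by
  simp only [minusList, List.mem_flatMap, List.mem_range]
  refine exists_congr fun j => and_congr_right fun _ => ?_
  split_ifs with h <;> simp [h]

theorem mem_cliqueList {p : ℕ × ℕ} : p ∈ cliqueList n m ↔
    ∃ i < levels m, ∃ d < i, ∃ x < n, p = (d * n + x, i * n + x) := by
  simp [cliqueList]

theorem mul_add_lt_mul {i x k n : ℕ} (hi : i < k) (hx : x < n) : i * n + x < n * k := by
  have : (i + 1) * n ≤ k * n := Nat.mul_le_mul_right _ hi
  rw [mul_comm n k]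
  linarith

theorem slot_add_lt {j x : ℕ} (hj : j < m) (hx : x < n) : slot n m j + x < n * levels m :=
  mul_add_lt_mul (by unfold levels; omega) hx

theorem lt_mul_levels {x : ℕ} (hx : x < n) : x < n * levels m := by
  have := mul_add_lt_mul (i := 0) (k := levels m) (by unfold levels; omega) hx
  omega

theorem treeList_lt (hU : ∀ j < m, U j < n) (hV : ∀ j < m, V j < n) :
    ∀ p ∈ treeList n m U V, p.1 < n * levels m ∧ p.2 < n * levels m := by
  intro p hp
  rcases mem_treeList.1 hp with ⟨i, hi, x, hx, rfl⟩ | ⟨j, hj, hp⟩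
  · exact ⟨mul_add_lt_mul (by unfold levels; omega) hx, mul_add_lt_mul (by unfold levels; omega) hx⟩
  · rcases mem_treeBlock.1 hp with rfl | ⟨x, hx, rfl, -⟩
    · exact ⟨lt_mul_levels (hU j hj), slot_add_lt hj (hV j hj)⟩
    · exact ⟨lt_mul_levels hx, slot_add_lt hj hx⟩

theorem graphList_lt (hU : ∀ j < m, U j < n) (hV : ∀ j < m, V j < n) :
    ∀ p ∈ graphList n m U V W, p.1 < n * levels m ∧ p.2 < n * levels m := by
  intro p hp
  simp only [graphList, List.mem_append] at hp
  rcases hp with hp | hp | hp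
  · exact treeList_lt hU hV p hp
  · obtain ⟨j, hj, -, rfl⟩ := mem_minusList.1 hp
    exact ⟨lt_mul_levels (hV j hj), slot_add_lt hj (hU j hj)⟩
  · obtain ⟨i, hi, d, hd, x, hx, rfl⟩ := mem_cliqueList.1 hp
    exact ⟨mul_add_lt_mul (hd.trans hi) hx, mul_add_lt_mul hi hx⟩

theorem le_slot {j : ℕ} : n ≤ slot n m j := Nat.le_mul_of_pos_left _ (by omega)

theorem graphList_ne (hU : ∀ j < m, U j < n) (hV : ∀ j < m, V j < n) :
    ∀ p ∈ graphList n m U V W, p.1 ≠ p.2 := by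
  intro p hp
  simp only [graphList, List.mem_append] at hp
  rcases hp with hp | hp | hp
  · rcases mem_treeList.1 hp with ⟨i, hi, x, hx, rfl⟩ | ⟨j, hj, hp⟩
    · simp only [add_mul]
      omega
    · have := le_slot (n := n) (m := m) (j := j)
      rcases mem_treeBlock.1 hp with rfl | ⟨x, hx, rfl, -⟩
      · have := hU j hj
        simp only
        omega
      · simp only
        omega
  · obtain ⟨j, hj, -, rfl⟩ := mem_minusList.1 hp
    have := le_slot (n := n) (m := m) (j := j)
    have := hV j hj
    simp only
    omega
  · obtain ⟨i, hi, d, hd, x, hx, rfl⟩ := mem_cliqueList.1 hp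
    have : d * n < i * n := Nat.mul_lt_mul_of_pos_right hd (by omega)
    simp only
    omega

/-! ### The tree is a spanning tree -/

theorem label_congr {j k : ℕ} (hjk : j ≤ k) {x y : ℕ} (h : label U V j x = label U V j y) :
    label U V k x = label U V k y := by
  induction k, hjk using Nat.le_induction with
  | base => exact h
  | succ k _ ih => simp only [label, ih]

theorem label_succ_eq (j : ℕ) : label U V (j + 1) (U j) = label U V (j + 1) (V j) := by
  simp [label]

/-- The edges that merge two label classes form a spanning forest, as in Kruskal's algorithm. Hence
a function that agrees on the ends of these edges is constant on every class. -/
theorem eq_of_label_eq {β : Type} (g : ℕ → β) (hV : ∀ j < m, V j < n) (hU : ∀ j < m, U j < n)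
    (hg : ∀ j < m, label U V j (U j) ≠ label U V j (V j) → g (U j) = g (V j)) {j : ℕ} (hj : j ≤ m)
    {x y : ℕ} (hx : x < n) (hy : y < n) (h : label U V j x = label U V j y) : g x = g y := by
  induction j generalizing x y with
  | zero =>
    simp only [label] at h
    rw [h]
  | succ j ih =>
    have hU' := hU j hj
    have hV' := hV j hj
    have ih' : ∀ {x y : ℕ}, x < n → y < n → label U V j x = label U V j y → g x = g y :=
      fun hx hy h => ih (by omega) hx hy h
    have huv : g (U j) = g (V j) := by
      by_cases h' : label U V j (U j) = label U V j (V j)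
      · exact ih' hU' hV' h'
      · exact hg j hj h'
    simp only [label] at h
    split_ifs at h with h1 h2 h3
    · exact ih' hx hy (h1.trans h2.symm)
    · rw [ih' hx hV' h1, ← huv, ih' hU' hy h]
    · rw [ih' hx hU' h, huv, ih' hy hV' h3]
    · exact ih' hx hy h

theorem exists_level {y N k : ℕ} (hn : 0 < n) (hN : N = n * k) (hy : y < N) :
    ∃ i < k, ∃ x < n, y = i * n + x := by
  refine ⟨y / n, ?_, y % n, Nat.mod_lt _ hn, by rw [mul_comm]; exact (Nat.div_add_mod y n).symm⟩
  rw [Nat.div_lt_iff_lt_mul hn, mul_comm, ← hN]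
  exact hy

theorem level_cases {i : ℕ} (hi : i < levels m) :
    i ≤ 10 * (m + 1) ∨ ∃ j < m, i = 10 * (m + 1) + 1 + j := by
  by_cases h : i ≤ 10 * (m + 1)
  · exact Or.inl h
  · refine Or.inr ⟨i - (10 * (m + 1) + 1), ?_, ?_⟩ <;> unfold levels at hi <;> omega

/-- The paths reduce the first levels to level 0. If edge j merges two classes, its slot vertex
above `V j` is adjacent to both `U j` and `V j`, so f agrees on them; this settles level 0. Every
other slot vertex is attached to a vertex of level 0. -/
theorem treeList_const {β : Type} (f : ℕ → β) (hn : 0 < n) (hU : ∀ j < m, U j < n)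
    (hV : ∀ j < m, V j < n)
    (hc : ∀ (β : Type) (f : ℕ → β), (∀ j < m, f (U j) = f (V j)) → ∀ x < n, f x = f 0)
    (hf : ∀ p ∈ treeList n m U V, f p.1 = f p.2) {y : ℕ} (hy : y < n * levels m) : f y = f 0 := by
  have hpath : ∀ i ≤ 10 * (m + 1), ∀ x < n, f (i * n + x) = f x := by
    intro i
    induction i with
    | zero => simp
    | succ i ih =>
      intro hi x hx
      rw [← ih (by omega) x hx, hf (i * n + x, (i + 1) * n + x)
        (mem_treeList.2 (Or.inl ⟨i, by omega, x, hx, rfl⟩))]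
  have hslot : ∀ j < m, f (U j) = f (slot n m j + V j) := fun j hj => hf (U j, slot n m j + V j)
    (mem_treeList.2 (Or.inr ⟨j, hj, mem_treeBlock.2 (Or.inl rfl)⟩))
  have hslot' : ∀ j < m, ∀ x < n, (x = V j → label U V j (U j) ≠ label U V j (V j)) →
      f x = f (slot n m j + x) := fun j hj x hx h => hf (x, slot n m j + x)
    (mem_treeList.2 (Or.inr ⟨j, hj, mem_treeBlock.2 (Or.inr ⟨x, hx, rfl, h⟩)⟩))
  have hconst : ∀ x < n, f x = f 0 := fun x hx => by
    -- After all m edges the label is constant along every edge, so connectivity of the multigraph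
    -- leaves a single class.
    refine eq_of_label_eq f hV hU (fun j hj h => ?_) le_rfl hx hn
      (hc _ (label U V m) (fun j hj => label_congr hj (label_succ_eq j)) x hx)
    rw [hslot j hj, hslot' j hj (V j) (hV j hj) fun _ => h]
  obtain ⟨i, hi, x, hx, rfl⟩ := exists_level hn rfl hy
  rcases level_cases hi with h | ⟨j, hj, rfl⟩
  · rw [hpath i h x hx, hconst x hx]
  · change f (slot n m j + x) = _
    by_cases h : x = V j
    · rw [h, ← hslot j hj, hconst _ (hU j hj)]
    · rw [← hslot' j hj x hx fun h' => absurd h' h, hconst x hx]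

theorem length_flatMap_range {β : Type} (k : ℕ) (f : ℕ → List β) :
    ((List.range k).flatMap f).length = ∑ x ∈ Finset.range k, (f x).length := by
  induction k with
  | zero => simp
  | succ k ih => simp [List.range_succ, Finset.sum_range_succ, ih]

/-- The number of label classes is a potential: a block has n edges, or n + 1 if its edge merges two
classes, and then the number of classes drops. -/
theorem length_treeBlock_add_card {j : ℕ} (hU : U j < n) (hV : V j < n) :
    (treeBlock n m U V j).length + ((Finset.range n).image (label U V (j + 1))).card ≤
      n + ((Finset.range n).image (label U V j)).card := by
  rw [treeBlock, List.length_cons, length_flatMap_range]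
  by_cases h : label U V j (U j) = label U V j (V j)
  · have h1 : (Finset.range n).image (label U V (j + 1)) =
        (Finset.range n).image (label U V j) := by
      congr 1
      funext x
      simp only [label]
      split_ifs with hx
      · rw [h, hx]
      · rfl
    have h2 : (∑ x ∈ Finset.range n, (if x = V j then
        if label U V j (U j) = label U V j (V j) then [] else [(x, slot n m j + x)]
        else [(x, slot n m j + x)]).length) < ∑ x ∈ Finset.range n, 1 := by
      refine Finset.sum_lt_sum (fun x _ => ?_) ⟨V j, Finset.mem_range.2 hV, by simp [h]⟩
      split_ifs <;> simp
    rw [Finset.sum_const, Finset.card_range, smul_eq_mul, mul_one] at h2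
    rw [h1]
    omega
  · have h1 : ((Finset.range n).image (label U V (j + 1))).card <
        ((Finset.range n).image (label U V j)).card := by
      refine Finset.card_lt_card (Finset.ssubset_iff_subset_ne.2 ⟨?_, fun he => ?_⟩)
      · intro y hy
        obtain ⟨x, hx, rfl⟩ := Finset.mem_image.1 hy
        simp only [label]
        split_ifs
        · exact Finset.mem_image_of_mem _ (Finset.mem_range.2 hU)
        · exact Finset.mem_image_of_mem _ hx
      · have h2 : label U V j (V j) ∈ (Finset.range n).image (label U V (j + 1)) := by
          rw [he]
          exact Finset.mem_image_of_mem _ (Finset.mem_range.2 hV)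
        obtain ⟨x, -, hx⟩ := Finset.mem_image.1 h2
        simp only [label] at hx
        split_ifs at hx with h3
        · exact h hx
        · exact h3 hx
    have h2 : (∑ x ∈ Finset.range n, (if x = V j then
        if label U V j (U j) = label U V j (V j) then [] else [(x, slot n m j + x)]
        else [(x, slot n m j + x)]).length) = n := by
      simp [h]
    omega

/-- The potential argument telescopes over the blocks: it starts with at most n classes, and at
least one remains. -/
theorem length_treeList (hn : 0 < n) (hU : ∀ j < m, U j < n) (hV : ∀ j < m, V j < n) :
    (treeList n m U V).length + 1 ≤ n * levels m := by
  have h : ∀ j ≤ m, ((List.range j).flatMap (treeBlock n m U V)).length +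
      ((Finset.range n).image (label U V j)).card ≤ n * j + n := by
    intro j
    induction j with
    | zero =>
      intro _
      simpa using Finset.card_image_le (s := Finset.range n) (f := label U V 0)
    | succ j ih =>
      intro hj
      have h1 := ih (by omega)
      have h2 := length_treeBlock_add_card (m := m) (hU j hj) (hV j hj)
      rw [List.range_succ, List.flatMap_append, List.length_append, List.flatMap_singleton,
        mul_add, mul_one]
      omega
  have h1 := h m le_rfl
  have h2 : 0 < ((Finset.range n).image (label U V m)).card :=
    Finset.card_pos.2 ((Finset.nonempty_range_iff.2 hn.ne').image _)
  have h3 : ((List.range (10 * (m + 1))).flatMap fun i => (List.range n).flatMap fun x =>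
      [(i * n + x, (i + 1) * n + x)]).length = n * (10 * (m + 1)) := by
    simp [List.length_flatMap, mul_comm]
  rw [treeList, List.length_append, h3, levels,
    show n * (11 * (m + 1)) = n * (10 * (m + 1)) + (n * m + n) by ring]
  omega

end

section

variable {n m : ℕ} {U V : ℕ → ℕ} {W : ℕ → ℤˣ} {a : ℕ → Bool}

/-! ### Cuts that do not separate the cliques -/

theorem mul_add_inj {i k x y : ℕ} (hx : x < n) (hy : y < n) (h : i * n + x = k * n + y) :
    i = k ∧ x = y := by
  have hn : 0 < n := by omega
  have h1 := congrArg (· / n) h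
  simp only [mul_comm _ n, Nat.mul_add_div hn, Nat.div_eq_of_lt hx, Nat.div_eq_of_lt hy] at h1
  obtain rfl : i = k := by omega
  exact ⟨rfl, by omega⟩

theorem slot_add_inj {j k x y : ℕ} (hx : x < n) (hy : y < n)
    (h : slot n m j + x = slot n m k + y) : j = k ∧ x = y := by
  obtain ⟨h1, h2⟩ := mul_add_inj hx hy h
  exact ⟨by omega, h2⟩

/-- The edges of the multigraph that are separated by `a`. -/
def cutEdges (m : ℕ) (U V : ℕ → ℕ) (a : ℕ → Bool) : Finset ℕ :=
  (Finset.range m).filter fun j => a (U j) ≠ a (V j)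

theorem mem_cutEdges {j : ℕ} : j ∈ cutEdges m U V a ↔ j < m ∧ a (U j) ≠ a (V j) := by
  simp [cutEdges]

/-- One end lies on level 0 and the other on a later level, so the two cannot be interchanged. -/
theorem sym2_slot_inj {j k x y x' y' : ℕ} (hx : x < n) (hy : y < n) (hy' : y' < n)
    (h : s(x, slot n m j + y) = s(x', slot n m k + y')) : j = k ∧ x = x' ∧ y = y' := by
  rw [Sym2.eq_iff] at h
  rcases h with ⟨h1, h2⟩ | ⟨h1, h2⟩
  · obtain ⟨h3, h4⟩ := slot_add_inj hy hy' h2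
    exact ⟨h3, h1, h4⟩
  · have := le_slot (n := n) (m := m) (j := k)
    omega

/-- Tree edges within a clique are not separated, and different slots keep the images of parallel
edges apart. -/
theorem cutSize_treeList (hU : ∀ j < m, U j < n) (hV : ∀ j < m, V j < n)
    (ha : ∀ i < levels m, ∀ x < n, a (i * n + x) = a x) :
    cutSize (treeList n m U V) a = (cutEdges m U V a).card := by
  have hs : ∀ j < m, ∀ x < n, a (slot n m j + x) = a x := fun j hj x hx =>
    ha _ (by unfold levels; omega) x hx
  rw [cutSize_eq_card (E := (cutEdges m U V a).image fun j => s(U j, slot n m j + V j)),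
    Finset.card_image_of_injOn]
  · intro j hj k hk h
    obtain ⟨hj, -⟩ := mem_cutEdges.1 hj
    obtain ⟨hk, -⟩ := mem_cutEdges.1 hk
    exact (sym2_slot_inj (hU j hj) (hV j hj) (hV k hk) h).1
  · intro e
    rw [Finset.mem_image]
    constructor
    · rintro ⟨j, hj, rfl⟩
      obtain ⟨hj, h⟩ := mem_cutEdges.1 hj
      exact ⟨_, mem_treeList.2 (Or.inr ⟨j, hj, mem_treeBlock.2 (Or.inl rfl)⟩),
        by rwa [hs j hj _ (hV j hj)], rfl⟩
    · rintro ⟨p, hp, h, rfl⟩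
      rcases mem_treeList.1 hp with ⟨i, hi, x, hx, rfl⟩ | ⟨j, hj, hp⟩
      · refine absurd ?_ h
        rw [ha i (by unfold levels; omega) x hx, ha (i + 1) (by unfold levels; omega) x hx]
      · rcases mem_treeBlock.1 hp with rfl | ⟨x, hx, rfl, -⟩
        · rw [hs j hj _ (hV j hj)] at h
          exact ⟨j, mem_cutEdges.2 ⟨hj, h⟩, rfl⟩
        · exact absurd (hs j hj x hx).symm h

theorem cutSize_graphList (hU : ∀ j < m, U j < n) (hV : ∀ j < m, V j < n)
    (ha : ∀ i < levels m, ∀ x < n, a (i * n + x) = a x) :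
    cutSize (graphList n m U V W) a =
      (cutEdges m U V a).card + ((cutEdges m U V a).filter fun j => W j ≠ 1).card := by
  have hs : ∀ j < m, ∀ x < n, a (slot n m j + x) = a x := fun j hj x hx =>
    ha _ (by unfold levels; omega) x hx
  rw [cutSize_eq_card (E := ((cutEdges m U V a).image fun j => s(U j, slot n m j + V j)) ∪
    (((cutEdges m U V a).filter fun j => W j ≠ 1).image fun j => s(V j, slot n m j + U j))),
    Finset.card_union_of_disjoint, Finset.card_image_of_injOn, Finset.card_image_of_injOn]
  · intro j hj k hk h
    obtain ⟨hj, -⟩ := mem_cutEdges.1 (Finset.mem_filter.1 hj).1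
    obtain ⟨hk, -⟩ := mem_cutEdges.1 (Finset.mem_filter.1 hk).1
    exact (sym2_slot_inj (hV j hj) (hU j hj) (hU k hk) h).1
  · intro j hj k hk h
    obtain ⟨hj, -⟩ := mem_cutEdges.1 hj
    obtain ⟨hk, -⟩ := mem_cutEdges.1 hk
    exact (sym2_slot_inj (hU j hj) (hV j hj) (hV k hk) h).1
  -- A common edge of the two families would belong to the same slot and force `U j = V j`, but edge
  -- j is separated.
  · rw [Finset.disjoint_left]
    intro e he he'
    obtain ⟨j, hj, rfl⟩ := Finset.mem_image.1 he
    obtain ⟨k, hk, h⟩ := Finset.mem_image.1 he'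
    obtain ⟨hj, h'⟩ := mem_cutEdges.1 hj
    obtain ⟨hk, -⟩ := mem_cutEdges.1 (Finset.mem_filter.1 hk).1
    obtain ⟨rfl, h1, -⟩ := sym2_slot_inj (hV k hk) (hU k hk) (hV j hj) h
    exact h' (by rw [h1])
  · intro e
    rw [Finset.mem_union, Finset.mem_image, Finset.mem_image]
    constructor
    · rintro (⟨j, hj, rfl⟩ | ⟨j, hj, rfl⟩)
      · obtain ⟨hj, h⟩ := mem_cutEdges.1 hj
        exact ⟨_, List.mem_append_left _ (mem_treeList.2 (Or.inr ⟨j, hj,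
          mem_treeBlock.2 (Or.inl rfl)⟩)), by rwa [hs j hj _ (hV j hj)], rfl⟩
      · obtain ⟨hj, hw⟩ := Finset.mem_filter.1 hj
        obtain ⟨hj, h⟩ := mem_cutEdges.1 hj
        exact ⟨_, List.mem_append_right _ (List.mem_append_left _ (mem_minusList.2
          ⟨j, hj, hw, rfl⟩)), by rw [hs j hj _ (hU j hj)]; exact h.symm, rfl⟩
    · rintro ⟨p, hp, h, rfl⟩
      simp only [graphList, List.mem_append] at hp
      rcases hp with hp | hp | hp
      · rcases mem_treeList.1 hp with ⟨i, hi, x, hx, rfl⟩ | ⟨j, hj, hp⟩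
        · refine absurd ?_ h
          rw [ha i (by unfold levels; omega) x hx, ha (i + 1) (by unfold levels; omega) x hx]
        · rcases mem_treeBlock.1 hp with rfl | ⟨x, hx, rfl, -⟩
          · rw [hs j hj _ (hV j hj)] at h
            exact Or.inl ⟨j, mem_cutEdges.2 ⟨hj, h⟩, rfl⟩
          · exact absurd (hs j hj x hx).symm h
      · obtain ⟨j, hj, hw, rfl⟩ := mem_minusList.1 hp
        rw [hs j hj _ (hU j hj)] at h
        exact Or.inr ⟨j, Finset.mem_filter.2 ⟨mem_cutEdges.2 ⟨hj, h.symm⟩, hw⟩, rfl⟩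
      · obtain ⟨i, hi, d, hd, x, hx, rfl⟩ := mem_cliqueList.1 hp
        exact absurd ((ha d (by omega) x hx).trans (ha i hi x hx).symm) h

/-! ### Cuts that separate a clique -/

/-- The number of vertices of the clique `x` on the side `b` of `a`. -/
def sideCount (n m : ℕ) (a : ℕ → Bool) (b : Bool) (x : ℕ) : ℕ :=
  ((Finset.range (levels m)).filter fun i => a (i * n + x) = b).card

/-- The number of vertices of the clique `x` on the smaller side of `a`. -/
def minority (n m : ℕ) (a : ℕ → Bool) (x : ℕ) : ℕ :=
  min (sideCount n m a true x) (sideCount n m a false x)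

theorem sideCount_add (x : ℕ) :
    sideCount n m a true x + sideCount n m a false x = levels m := by
  have h := Finset.card_filter_add_card_filter_not (s := Finset.range (levels m))
    (fun i => a (i * n + x) = true)
  simpa [sideCount] using h

theorem one_le_minority {i k x : ℕ} (hi : i < levels m) (hk : k < levels m)
    (h : a (i * n + x) ≠ a (k * n + x)) : 1 ≤ minority n m a x := by
  have h1 : ∀ b, 1 ≤ sideCount n m a b x := fun b => by
    refine Finset.card_pos.2 ?_
    by_cases hb : a (i * n + x) = b
    · exact ⟨i, Finset.mem_filter.2 ⟨Finset.mem_range.2 hi, hb⟩⟩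
    · refine ⟨k, Finset.mem_filter.2 ⟨Finset.mem_range.2 hk, ?_⟩⟩
      revert h hb
      cases a (i * n + x) <;> cases a (k * n + x) <;> cases b <;> simp
  exact le_min (h1 _) (h1 _)

theorem countP_flatMap_range {β : Type} (p : β → Bool) (k : ℕ) (f : ℕ → List β) :
    ((List.range k).flatMap f).countP p = ∑ x ∈ Finset.range k, (f x).countP p := by
  induction k with
  | zero => simp
  | succ k ih => simp [List.range_succ, Finset.sum_range_succ, ih]

/-- A separated path edge has an end on either side, and every vertex lies on at most two path
edges; so the count is at most twice the size of either side. -/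
theorem countP_path_le (x : ℕ) : ∑ i ∈ Finset.range (10 * (m + 1)),
    (if a (i * n + x) ≠ a ((i + 1) * n + x) then 1 else 0) ≤ 2 * minority n m a x := by
  have key : ∀ b, ∑ i ∈ Finset.range (10 * (m + 1)),
      (if a (i * n + x) ≠ a ((i + 1) * n + x) then 1 else 0) ≤ 2 * sideCount n m a b x := by
    intro b
    have h0 : sideCount n m a b x =
        ∑ i ∈ Finset.range (levels m), if a (i * n + x) = b then 1 else 0 := by
      rw [sideCount, Finset.card_filter]
    have h1 : ∑ i ∈ Finset.range (10 * (m + 1)), (if a (i * n + x) = b then 1 else 0) ≤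
        sideCount n m a b x := by
      rw [h0]
      exact Finset.sum_le_sum_of_subset (Finset.range_subset_range.2 (by unfold levels; omega))
    have h2 : ∑ i ∈ Finset.range (10 * (m + 1)), (if a ((i + 1) * n + x) = b then 1 else 0) ≤
        sideCount n m a b x := by
      rw [h0]
      refine le_trans ?_ (Finset.sum_le_sum_of_subset
        (Finset.range_subset_range.2 (show 10 * (m + 1) + 1 ≤ levels m by unfold levels; omega)))
      rw [Finset.sum_range_succ' _ (10 * (m + 1))]
      exact Nat.le_add_right _ _
    rw [two_mul]
    refine le_trans ?_ (add_le_add h1 h2)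
    rw [← Finset.sum_add_distrib]
    refine Finset.sum_le_sum fun i _ => ?_
    cases a (i * n + x) <;> cases a ((i + 1) * n + x) <;> cases b <;> simp
  rw [minority]
  rcases min_choice (sideCount n m a true x) (sideCount n m a false x) with h | h <;> rw [h]
  exacts [key _, key _]

/-- The edge that stands for edge j contributes at most 1. A separated edge from `x` to its slot
vertex shows that the clique of `x` is split, so it is paid for by the minority of `x`. -/
theorem countP_treeBlock_le {j : ℕ} (hj : j < m) :
    (treeBlock n m U V j).countP (fun p => a p.1 != a p.2) ≤
      1 + ∑ x ∈ Finset.range n, minority n m a x := by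
  rw [treeBlock, List.countP_cons, countP_flatMap_range, add_comm]
  refine add_le_add (by split_ifs <;> simp) (Finset.sum_le_sum fun x _ => ?_)
  have h : ([(x, slot n m j + x)].countP fun p : ℕ × ℕ => a p.1 != a p.2) ≤ minority n m a x := by
    rw [List.countP_singleton]
    split_ifs with h
    · refine one_le_minority (i := 0) (k := 10 * (m + 1) + 1 + j) (by unfold levels; omega)
        (by unfold levels; omega) ?_
      rw [zero_mul, zero_add]
      exact bne_iff_ne.1 h
    · exact Nat.zero_le _
  split_ifs
  · simp
  · exact h
  · exact h

/-- With M the sum of all minorities, the paths contribute at most 2M and each of the m blocks at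
most 1 + M. -/
theorem cutSize_treeList_le : cutSize (treeList n m U V) a ≤
    (m + 2) * (∑ x ∈ Finset.range n, minority n m a x) + m := by
  refine (cutSize_le _ _).trans ?_
  rw [treeList, List.countP_append, countP_flatMap_range, countP_flatMap_range]
  have h1 : ∑ i ∈ Finset.range (10 * (m + 1)), ((List.range n).flatMap fun x =>
      [(i * n + x, (i + 1) * n + x)]).countP (fun p => a p.1 != a p.2) ≤
      2 * ∑ x ∈ Finset.range n, minority n m a x := by
    simp only [countP_flatMap_range]
    rw [Finset.sum_comm, Finset.mul_sum]
    refine Finset.sum_le_sum fun x _ => (le_of_eq ?_).trans (countP_path_le x)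
    refine Finset.sum_congr rfl fun i _ => ?_
    simp [List.countP_singleton]
  have h2 : ∑ j ∈ Finset.range m, (treeBlock n m U V j).countP (fun p => a p.1 != a p.2) ≤
      m * (1 + ∑ x ∈ Finset.range n, minority n m a x) := by
    refine (Finset.sum_le_card_nsmul _ _ _ fun j hj =>
      countP_treeBlock_le (Finset.mem_range.1 hj)).trans ?_
    rw [Finset.card_range, smul_eq_mul]
  linarith

/-- Only clique edges are counted: every pair of vertices of a clique on different sides is a
separated edge. -/
theorem sum_mul_le_cutSize_graphList :
    ∑ x ∈ Finset.range n, sideCount n m a true x * sideCount n m a false x ≤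
      cutSize (graphList n m U V W) a := by
  let s : Finset (Σ _ : ℕ, ℕ × ℕ) := (Finset.range n).sigma fun x =>
    ((Finset.range (levels m)).filter fun i => a (i * n + x) = true) ×ˢ
      ((Finset.range (levels m)).filter fun i => a (i * n + x) = false)
  have hs : s.card = ∑ x ∈ Finset.range n, sideCount n m a true x * sideCount n m a false x := by
    rw [Finset.card_sigma]
    exact Finset.sum_congr rfl fun x _ => Finset.card_product _ _
  have hmem : ∀ t ∈ s, t.1 < n ∧ (t.2.1 < levels m ∧ a (t.2.1 * n + t.1) = true) ∧
      t.2.2 < levels m ∧ a (t.2.2 * n + t.1) = false := fun t ht => by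
    simpa [s] using ht
  rw [← hs]
  refine card_le_cutSize s (fun t => (t.2.1 * n + t.1, t.2.2 * n + t.1)) (fun t ht => ?_)
    (fun t ht => ⟨(hmem t ht).2.1.2, (hmem t ht).2.2.2⟩) fun t ht t' ht' h => ?_
  · obtain ⟨h1, ⟨h2, h3⟩, h4, h5⟩ := hmem t ht
    rcases lt_trichotomy t.2.1 t.2.2 with h | h | h
    · exact Or.inl (List.mem_append_right _ (List.mem_append_right _ (mem_cliqueList.2
        ⟨_, h4, _, h, _, h1, rfl⟩)))
    · rw [h, h5] at h3
      exact absurd h3 (by simp)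
    · exact Or.inr (List.mem_append_right _ (List.mem_append_right _ (mem_cliqueList.2
        ⟨_, h2, _, h, _, h1, rfl⟩)))
  · have h1 := (hmem t ht).1
    have h2 := (hmem t' ht').1
    obtain ⟨x, i, k⟩ := t
    obtain ⟨x', i', k'⟩ := t'
    simp only [Prod.mk.injEq] at h
    obtain ⟨rfl, rfl⟩ := mul_add_inj h1 h2 h.1
    obtain ⟨rfl, -⟩ := mul_add_inj h1 h2 h.2
    rfl

/-- Let M ≥ 1 be the sum of the minorities. The tree has at most (m + 2)M + m ≤ 2(m + 1)M edges in
the cut. In each clique the larger side has at least half of the 11(m + 1) vertices, so the graph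
has at least 11(m + 1)M/2 edges in it. The ratio is at most 4/11 < 2/5. -/
theorem five_mul_cutSize_treeList_le {i k x : ℕ} (hi : i < levels m) (hk : k < levels m)
    (hx : x < n) (h : a (i * n + x) ≠ a (k * n + x)) :
    0 < cutSize (graphList n m U V W) a ∧
      5 * cutSize (treeList n m U V) a ≤ 2 * cutSize (graphList n m U V W) a := by
  have h1 := cutSize_treeList_le (n := n) (m := m) (U := U) (V := V) (a := a)
  have h2 := sum_mul_le_cutSize_graphList (n := n) (m := m) (U := U) (V := V) (W := W) (a := a)
  have h3 : levels m * (∑ x ∈ Finset.range n, minority n m a x) ≤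
      2 * ∑ x ∈ Finset.range n, sideCount n m a true x * sideCount n m a false x := by
    rw [Finset.mul_sum, Finset.mul_sum]
    refine Finset.sum_le_sum fun x _ => ?_
    rw [← sideCount_add (n := n) (m := m) (a := a) x, minority]
    rcases le_total (sideCount n m a true x) (sideCount n m a false x) with h | h
    · rw [min_eq_left h]
      nlinarith
    · rw [min_eq_right h]
      nlinarith
  have h4 : 1 ≤ ∑ x ∈ Finset.range n, minority n m a x :=
    (one_le_minority hi hk h).trans (Finset.single_le_sum (f := fun x => minority n m a x)
      (fun _ _ => Nat.zero_le _) (Finset.mem_range.2 hx))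
  unfold levels at h3
  constructor
  · nlinarith
  · nlinarith

end

/-! ### The reduction -/

theorem sum_map_filter_eq {β M : Type} [AddCommMonoid M] (l : List β) (d : β) (p : β → Bool)
    (g : β → M) :
    ((l.filter p).map g).sum =
      ∑ j ∈ Finset.range l.length, if p (l.getD j d) then g (l.getD j d) else 0 := by
  induction l with
  | nil => simp
  | cons e l ih =>
    rw [List.length_cons, Finset.sum_range_succ']
    simp only [List.getD_cons_succ, List.getD_cons_zero, ← ih]
    cases h : p e <;> simp [h, add_comm]

/-- The comparison of the average weight of a cut with `c` edges, `q` of them negative, with a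
threshold, in terms of the proportion of tree edges. -/
theorem threshold_iff {a : ℤ} {b c q r : ℕ} (hb : 0 < b) (hc : 0 < c) (hcr : c ≤ r) :
    (a / b : ℚ) ≤ ((c : ℚ) - 2 * q) / c ↔
      ¬ (c : ℚ) / ((c + q : ℕ) : ℚ) ≤
        ((2 * b * r : ℕ) : ℚ) / ((2 * b * r + ((b * r + 1 : ℤ) - a * r).toNat : ℕ) : ℚ) := by
  have hr : 0 < r := by omega
  have hbq : (0 : ℚ) < b := by exact_mod_cast hb
  have hcq : (0 : ℚ) < c := by exact_mod_cast hc
  have hD : 0 < 2 * b * r + ((b * r + 1 : ℤ) - a * r).toNat :=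
    Nat.add_pos_left (by positivity) _
  have hDq : (0 : ℚ) < ((2 * b * r + ((b * r + 1 : ℤ) - a * r).toNat : ℕ) : ℚ) := by
    exact_mod_cast hD
  have hcqq : (0 : ℚ) < ((c + q : ℕ) : ℚ) := by positivity
  rw [div_le_div_iff₀ hbq hcq, div_le_div_iff₀ hcqq hDq, not_le]
  -- Both sides are turned into integer inequalities: 2bq ≤ (b - a)c on the left, and 2brq < c((b -
  -- a)r + 1), with a truncated factor, on the right.
  have e1 : ((a : ℚ) * c ≤ ((c : ℚ) - 2 * q) * b) ↔ 2 * (b : ℤ) * q ≤ (b - a) * c := by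
    rw [show ((a : ℚ) * c ≤ ((c : ℚ) - 2 * q) * b) ↔ a * c ≤ ((c : ℤ) - 2 * q) * b by
      exact_mod_cast Iff.rfl]
    constructor <;> intro h <;> linarith
  rw [e1]
  have e2 : (((2 * b * r : ℕ) : ℚ) * ((c + q : ℕ) : ℚ) <
      c * ((2 * b * r + ((b * r + 1 : ℤ) - a * r).toNat : ℕ) : ℚ)) ↔
      2 * (b : ℤ) * r * q < c * (((b * r + 1 : ℤ) - a * r).toNat : ℤ) := by
    rw [← Nat.cast_mul, ← Nat.cast_mul, Nat.cast_lt, ← Int.ofNat_lt]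
    push_cast
    constructor <;> intro h <;> linarith
  rw [e2]
  have hr' : (0 : ℤ) < r := by exact_mod_cast hr
  have hc' : (0 : ℤ) < c := by exact_mod_cast hc
  have hcr' : (c : ℤ) ≤ r := by exact_mod_cast hcr
  have hbq' : (0 : ℤ) ≤ 2 * b * q := by positivity
  -- For a threshold at most 1 the natural subtraction is exact; above 1 it is truncated to zero.
  rcases le_or_gt a b with hab | hab
  · have h0 : (0 : ℤ) ≤ (b - a) * r := mul_nonneg (by omega) hr'.le
    rw [Int.toNat_of_nonneg (by linarith)]
    constructor
    · intro h
      have := mul_le_mul_of_nonneg_right h hr'.le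
      linarith
    · intro h
      by_contra h'
      -- By integrality a failure is off by at least 1; multiplied by r this is at least c, which
      -- uses up the term c on the right.
      have := mul_le_mul_of_nonneg_right (show (b - a) * (c : ℤ) + 1 ≤ 2 * b * q by omega) hr'.le
      linarith
  -- Here a ≥ b + 1: the left inequality would make 2bq negative, and the right one has become 2brq
  -- < 0.
  · have h0 : (b - a) * (r : ℤ) ≤ (-1) * r := mul_le_mul_of_nonneg_right (by omega) hr'.le
    have h1 : (b - a) * (c : ℤ) ≤ (-1) * c := mul_le_mul_of_nonneg_right (by omega) hc'.le
    rw [Int.toNat_of_nonpos (by linarith)]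
    constructor
    · intro h
      linarith
    · intro h
      have := mul_nonneg hbq' hr'.le
      exfalso
      push_cast at h
      linarith

namespace MaxAvgCutInstance

variable (I : MaxAvgCutInstance)

/-- The edges, with natural numbers as vertices. -/
def rawEdges : List (ℕ × ℕ × ℤˣ) := I.edges.map fun e => (e.1.val, e.2.1.val, e.2.2)

/-- The first end of the edge `j`. -/
def fst (j : ℕ) : ℕ := (I.rawEdges.getD j (0, 0, 1)).1

/-- The second end of the edge `j`. -/
def snd (j : ℕ) : ℕ := (I.rawEdges.getD j (0, 0, 1)).2.1

/-- The weight of the edge `j`. -/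
def weight (j : ℕ) : ℤˣ := (I.rawEdges.getD j (0, 0, 1)).2.2

/-- The number of edges. -/
def numEdges : ℕ := I.edges.length

variable {I}

theorem length_rawEdges : I.rawEdges.length = I.numEdges := List.length_map _

theorem exists_edge {j : ℕ} (hj : j < I.numEdges) : ∃ e ∈ I.edges,
    I.fst j = e.1.val ∧ I.snd j = e.2.1.val ∧ I.weight j = e.2.2 := by
  have hj' : j < I.edges.length := hj
  refine ⟨I.edges[j], List.getElem_mem _, ?_⟩
  simp [fst, snd, weight, rawEdges, hj']

theorem fst_lt : ∀ j < I.numEdges, I.fst j < I.n := fun j hj => by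
  obtain ⟨e, -, h, -, -⟩ := exists_edge hj
  rw [h]
  exact e.1.2

theorem snd_lt : ∀ j < I.numEdges, I.snd j < I.n := fun j hj => by
  obtain ⟨e, -, -, h, -⟩ := exists_edge hj
  rw [h]
  exact e.2.1.2

theorem n_pos : 0 < I.n := by
  obtain ⟨x⟩ := I.connected.nonempty
  exact x.pos

theorem const_of_edges (β : Type) (f : ℕ → β) (hf : ∀ j < I.numEdges, f (I.fst j) = f (I.snd j)) :
    ∀ x < I.n, f x = f 0 := by
  intro x hx
  have hedge : ∀ e ∈ I.edges, f e.1 = f e.2.1 := by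
    intro e he
    obtain ⟨j, hj, rfl⟩ := List.mem_iff_getElem.1 he
    have := hf j hj
    simpa [fst, snd, rawEdges, hj] using this
  refine I.connected.const_of_adj (f := fun u : Fin I.n => f u) (fun u v huv => ?_) ⟨x, hx⟩
    ⟨0, n_pos⟩
  rw [SimpleGraph.fromRel_adj] at huv
  rcases huv.2 with ⟨w, hw⟩ | ⟨w, hw⟩
  · exact hedge _ hw
  · exact (hedge _ hw).symm

variable (I)

/-- The numerator of the bound of the reduction. -/
def boundNum : ℕ := 2 * I.kDen * 2 ^ (I.numEdges + 1)

/-- The denominator of the bound of the reduction. -/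
def boundDen : ℕ := 2 * I.kDen * 2 ^ (I.numEdges + 1) +
  ((I.kDen * (2 ^ (I.numEdges + 1) : ℕ) + 1 : ℤ) - I.kNum * (2 ^ (I.numEdges + 1) : ℕ)).toNat

variable {I}

theorem boundNum_pos : 0 < I.boundNum :=
  Nat.mul_pos (Nat.mul_pos two_pos I.kDen_pos) (by positivity)

theorem boundNum_le : I.boundNum ≤ I.boundDen := Nat.le_add_right _ _

theorem neg_kDen_le : -(I.kDen : ℤ) ≤ I.kNum := by
  have h := I.neg_one_le
  have hb : (0 : ℚ) < I.kDen := by exact_mod_cast I.kDen_pos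
  rw [le_div_iff₀ hb] at h
  have : ((-(I.kDen : ℤ) : ℤ) : ℚ) ≤ I.kNum := by
    push_cast
    linarith
  exact_mod_cast this

/-- This says α ≥ 2/5. From k ≥ -1 the denominator is at most twice the numerator plus 1, and the
numerator is at least 2. -/
theorem two_mul_boundDen_le : 2 * I.boundDen ≤ 5 * I.boundNum := by
  have h1 : (I.boundNum : ℤ) = 2 * I.kDen * (2 ^ (I.numEdges + 1) : ℕ) := by
    simp [boundNum]
  have h2 := boundNum_pos (I := I)
  have h3 := mul_le_mul_of_nonneg_right (neg_kDen_le (I := I))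
    (Nat.cast_nonneg (α := ℤ) (2 ^ (I.numEdges + 1)))
  have h4 : ((I.kDen * (2 ^ (I.numEdges + 1) : ℕ) + 1 : ℤ) -
      I.kNum * (2 ^ (I.numEdges + 1) : ℕ)).toNat ≤ I.boundNum + 1 := by
    rw [Int.toNat_le]
    push_cast at h1 h3 ⊢
    linarith
  have h5 : 2 ≤ I.boundNum := by
    have : 0 < I.kDen * 2 ^ (I.numEdges + 1) := Nat.mul_pos I.kDen_pos (by positivity)
    unfold boundNum
    rw [mul_assoc]
    omega
  have h6 : I.boundDen = I.boundNum + ((I.kDen * (2 ^ (I.numEdges + 1) : ℕ) + 1 : ℤ) -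
      I.kNum * (2 ^ (I.numEdges + 1) : ℕ)).toNat := rfl
  omega

theorem treeList_const_of_edges (β : Type) (f : ℕ → β)
    (hf : ∀ p ∈ treeList I.n I.numEdges I.fst I.snd, f p.1 = f p.2) :
    ∀ y < I.n * levels I.numEdges, f y = f 0 :=
  fun _ hy => treeList_const f n_pos fst_lt snd_lt const_of_edges hf hy

theorem size_pos : 0 < I.n * levels I.numEdges := lt_mul_levels n_pos

/-- The instance of the thin tree verification problem that belongs to an instance of the maximum
average cut problem. -/
def reduction (I : MaxAvgCutInstance) : ThinTreeInstance where
  n := I.n * levels I.numEdges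
  edges := finPairs (graphList I.n I.numEdges I.fst I.snd I.weight) (graphList_lt fst_lt snd_lt)
  treeEdges := finPairs (treeList I.n I.numEdges I.fst I.snd) (treeList_lt fst_lt snd_lt)
  αNum := I.boundNum
  αDen := I.boundDen
  αDen_pos := boundNum_pos.trans_le boundNum_le
  loopless p hp h := graphList_ne fst_lt snd_lt _ (mem_finPairs.1 hp) (congrArg Fin.val h)
  connected := connected_of_forall_const size_pos _ fun β f hf => treeList_const_of_edges β f
    fun p hp => hf p (List.mem_append_left _ hp)
  tree_subset _ hp := mem_finPairs.2 (List.mem_append_left _ (mem_finPairs.1 hp))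
  tree_isTree := isTree_of_length _ (connected_of_forall_const size_pos _ treeList_const_of_edges)
    (length_treeList n_pos fst_lt snd_lt)
  α_le_one := div_le_one_of_le₀ (by exact_mod_cast boundNum_le) (Nat.cast_nonneg _)

/-! ### Correctness of the reduction -/

theorem sum_map_cut {M : Type} [AddCommMonoid M] (A : Finset (Fin I.n)) (g : ℤˣ → M) :
    ((I.cut A).map fun e => g e.2.2).sum =
      ∑ j ∈ cutEdges I.numEdges I.fst I.snd (indicator A), g (I.weight j) := by
  rw [cutEdges, Finset.sum_filter, cut,
    sum_map_filter_eq I.edges (⟨0, n_pos⟩, ⟨0, n_pos⟩, 1) _ fun e => g e.2.2]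
  refine Finset.sum_congr rfl fun j hj => ?_
  have hj' : j < I.edges.length := Finset.mem_range.1 hj
  simp only [fst, snd, weight, rawEdges, List.getD_eq_getElem?_getD, List.getElem?_map,
    List.getElem?_eq_getElem hj', Option.getD_some, Option.map_some, indicator_val, decide_eq_true_eq,
    ne_eq, decide_eq_decide]

theorem length_cut (A : Finset (Fin I.n)) :
    (I.cut A).length = (cutEdges I.numEdges I.fst I.snd (indicator A)).card := by
  simpa using sum_map_cut (M := ℕ) A fun _ => 1

/-- A weight is 1 minus twice the indicator of being negative. -/
theorem sum_cut (A : Finset (Fin I.n)) :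
    ((I.cut A).map fun e => ((e.2.2 : ℤ) : ℚ)).sum =
      (cutEdges I.numEdges I.fst I.snd (indicator A)).card - 2 *
        ((cutEdges I.numEdges I.fst I.snd (indicator A)).filter fun j => I.weight j ≠ 1).card := by
  have hw : ∀ w : ℤˣ, ((w : ℤ) : ℚ) = 1 - 2 * if w ≠ 1 then 1 else 0 := by
    intro w
    rcases Int.units_eq_one_or w with rfl | rfl <;> norm_num
  rw [sum_map_cut A fun w => ((w : ℤ) : ℚ)]
  simp only [hw]
  rw [Finset.sum_sub_distrib, ← Finset.mul_sum, Finset.sum_boole]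
  simp

/-- By connectivity no nontrivial cut is empty, so the average weight is a genuine quotient. -/
theorem cutEdges_nonempty {a : ℕ → Bool} {x y : ℕ} (hx : x < I.n) (hy : y < I.n) (h : a x ≠ a y) :
    0 < (cutEdges I.numEdges I.fst I.snd a).card := by
  rw [Finset.card_pos, Finset.nonempty_iff_ne_empty]
  intro h0
  have hc := const_of_edges (I := I) Bool a fun j hj => by
    by_contra h1
    have := mem_cutEdges.2 ⟨hj, h1⟩
    rw [h0] at this
    simp at this
  exact h ((hc x hx).trans (hc y hy).symm)

/-- The number r of `threshold_iff` only has to be at least the size of every cut. The power of two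
is chosen because multiplication by it is a shift in binary notation. -/
theorem card_cutEdges_le {a : ℕ → Bool} :
    (cutEdges I.numEdges I.fst I.snd a).card ≤ 2 ^ (I.numEdges + 1) := by
  have h1 := Finset.card_filter_le (Finset.range I.numEdges) fun j => a (I.fst j) ≠ a (I.snd j)
  rw [Finset.card_range] at h1
  have h2 : I.numEdges + 1 < 2 ^ (I.numEdges + 1) := Nat.lt_two_pow_self
  unfold cutEdges
  omega

theorem le_avgWeight_iff {A : Finset (Fin I.n)} {a : ℕ → Bool} (haA : ∀ x < I.n, a x = indicator A x)
    (ha : ∀ i < levels I.numEdges, ∀ x < I.n, a (i * I.n + x) = a x)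
    (hA : A.Nonempty) (hA' : A ≠ Finset.univ) :
    I.k ≤ I.avgWeight A ↔
      ¬ ((cutSize (treeList I.n I.numEdges I.fst I.snd) a : ℕ) : ℚ) /
        ((cutSize (graphList I.n I.numEdges I.fst I.snd I.weight) a : ℕ) : ℚ) ≤
        (I.boundNum : ℚ) / I.boundDen := by
  have he : cutEdges I.numEdges I.fst I.snd a = cutEdges I.numEdges I.fst I.snd (indicator A) := by
    ext j
    simp only [mem_cutEdges]
    refine and_congr_right fun hj => ?_
    rw [haA _ (fst_lt j hj), haA _ (snd_lt j hj)]
  rw [cutSize_treeList fst_lt snd_lt ha, cutSize_graphList fst_lt snd_lt ha, k, avgWeight, sum_cut,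
    length_cut, he]
  obtain ⟨u, hu⟩ := hA
  obtain ⟨v, hv⟩ : ∃ v, v ∉ A := by
    by_contra h
    push Not at h
    exact hA' (Finset.eq_univ_iff_forall.2 h)
  exact threshold_iff I.kDen_pos (cutEdges_nonempty u.2 v.2 (by simp [indicator_val, hu, hv]))
    card_cutEdges_le

theorem yes_iff (I : MaxAvgCutInstance) :
    MaxAvgCut.Yes I ↔ ¬ I.reduction.graph.IsThin I.reduction.tree I.reduction.α := by
  have hthin : I.reduction.graph.IsThin I.reduction.tree I.reduction.α ↔
      ∀ A : Finset (Fin (I.n * levels I.numEdges)), A.Nonempty → A ≠ Finset.univ →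
        ((cutSize (treeList I.n I.numEdges I.fst I.snd) (indicator A) : ℕ) : ℚ) /
        ((cutSize (graphList I.n I.numEdges I.fst I.snd I.weight) (indicator A) : ℕ) : ℚ) ≤
        (I.boundNum : ℚ) / I.boundDen := by
    have h1 := ncard_edgeCut (treeList_lt (n := I.n) fst_lt snd_lt)
    have h2 := ncard_edgeCut (graphList_lt (n := I.n) (W := I.weight) fst_lt snd_lt)
    simp only [← h1, ← h2]
    rfl
  have hn := n_pos (I := I)
  rw [hthin]
  push Not
  constructor
  · rintro ⟨A, hA, hA', hk⟩
    -- The union of the cliques that belong to the vertices of `A`.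
    let B : Finset (Fin (I.n * levels I.numEdges)) :=
      Finset.univ.filter fun y => indicator A (y.val % I.n) = true
    have hB : ∀ i < levels I.numEdges, ∀ x < I.n, indicator B (i * I.n + x) = indicator A x := by
      intro i hi x hx
      have := indicator_val B ⟨i * I.n + x, mul_add_lt_mul hi hx⟩
      simp only [B, Finset.mem_filter, Finset.mem_univ, true_and, Nat.mul_add_mod',
        Nat.mod_eq_of_lt hx] at this
      simpa using this
    have hB0 : ∀ x < I.n, indicator B x = indicator A x := fun x hx => by
      simpa using hB 0 (by unfold levels; omega) x hx
    refine ⟨B, ?_, ?_, not_le.1 ((le_avgWeight_iff hB0 (fun i hi x hx => ?_) hA hA').1 hk)⟩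
    · obtain ⟨u, hu⟩ := hA
      refine ⟨⟨u, lt_mul_levels u.2⟩, ?_⟩
      simp [B, Nat.mod_eq_of_lt u.2, indicator_val, hu]
    · intro h
      refine hA' (Finset.eq_univ_iff_forall.2 fun u => ?_)
      have := h ▸ Finset.mem_univ (⟨u, lt_mul_levels u.2⟩ : Fin (I.n * levels I.numEdges))
      simpa [B, Nat.mod_eq_of_lt u.2, indicator_val] using this
    · rw [hB i hi x hx, hB0 x hx]
  · rintro ⟨B, hB, hB', hlt⟩
    -- Either `B` is a union of cliques and comes from a cut of the multigraph, or it splits a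
    -- clique.
    by_cases hper : ∀ i < levels I.numEdges, ∀ x < I.n, indicator B (i * I.n + x) = indicator B x
    · let A : Finset (Fin I.n) := Finset.univ.filter fun x => indicator B x.val = true
      have hA0 : ∀ x < I.n, indicator B x = indicator A x := fun x hx => by
        have := indicator_val A ⟨x, hx⟩
        simp only [A, Finset.mem_filter, Finset.mem_univ, true_and] at this
        simpa using this.symm
      have hBA : ∀ y : Fin (I.n * levels I.numEdges), ∃ x : Fin I.n, (y ∈ B ↔ x ∈ A) := by
        intro y
        obtain ⟨i, hi, x, hx, h⟩ := exists_level hn rfl y.2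
        refine ⟨⟨x, hx⟩, ?_⟩
        have h1 := indicator_val B y
        rw [h, hper i hi x hx] at h1
        simp [A, h1]
      have hA : A.Nonempty := by
        obtain ⟨y, hy⟩ := hB
        obtain ⟨x, hx⟩ := hBA y
        exact ⟨x, hx.1 hy⟩
      have hA' : A ≠ Finset.univ := fun h => hB' (Finset.eq_univ_iff_forall.2 fun y => by
        obtain ⟨x, hx⟩ := hBA y
        exact hx.2 (h ▸ Finset.mem_univ x))
      exact ⟨A, hA, hA', (le_avgWeight_iff hA0 hper hA hA').2 (not_le.2 hlt)⟩
    · push Not at hper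
      obtain ⟨i, hi, x, hx, h⟩ := hper
      obtain ⟨h1, h2⟩ := five_mul_cutSize_treeList_le (U := I.fst) (V := I.snd) (W := I.weight)
        (k := 0) hi (by unfold levels; omega) hx (by simpa using h)
      have h3 := two_mul_boundDen_le (I := I)
      have h4 : 0 < I.boundDen := boundNum_pos.trans_le boundNum_le
      rw [div_lt_div_iff₀ (by exact_mod_cast h4) (by exact_mod_cast h1)] at hlt
      have h5 : I.boundNum * cutSize (graphList I.n I.numEdges I.fst I.snd I.weight) (indicator B) <
        cutSize (treeList I.n I.numEdges I.fst I.snd) (indicator B) * I.boundDen := by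
        exact_mod_cast hlt
      -- With T tree edges among the g > 0 edges of the cut and α = N/D: 5T ≤ 2g and 2D ≤ 5N give TD
      -- ≤ Ng, against `h5`.
      nlinarith

end MaxAvgCutInstance

/-! ### Access to the parts of a string -/

/-- The part of a string before the first `c`. -/
def before (c : Γ') (l : List Γ') : List Γ' := l.takeWhile (· ≠ c)

/-- The part of a string after the first `c`. -/
def after (c : Γ') (l : List Γ') : List Γ' := (l.dropWhile (· ≠ c)).tail

theorem before_append {c : Γ'} {l r : List Γ'} (h : c ∉ l) : before c (l ++ c :: r) = l := by
  rw [before, List.takeWhile_append_of_pos, List.takeWhile_cons_of_neg (by simp), List.append_nil]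
  intro d hd
  simp only [ne_eq, decide_not, Bool.not_eq_eq_eq_not, Bool.not_true, decide_eq_false_iff_not]
  rintro rfl
  exact h hd

theorem after_append {c : Γ'} {l r : List Γ'} (h : c ∉ l) : after c (l ++ c :: r) = r := by
  rw [after, List.dropWhile_append_of_pos, List.dropWhile_cons_of_neg (by simp), List.tail_cons]
  intro d hd
  simp only [ne_eq, decide_not, Bool.not_eq_eq_eq_not, Bool.not_true, decide_eq_false_iff_not]
  rintro rfl
  exact h hd

/-- The list of the first `n` values of a function. -/
def table (F : ℕ → ℕ) (n : ℕ) : List Γ' :=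
  (List.range n).flatMap fun x => ones (F x) ++ [Γ'.comma]

@[simp] theorem not_mem_ones {c : Γ'} (hc : c ≠ Γ'.bit true) (k : ℕ) : c ∉ ones k :=
  fun h => hc (List.eq_of_mem_replicate h)

@[simp] theorem not_mem_binary {c : Γ'} (hc : ∀ b, c ≠ Γ'.bit b) (k : ℕ) : c ∉ binary k := by
  intro h
  obtain ⟨b, -, rfl⟩ := List.mem_map.1 h
  exact hc b rfl

/-- A pair of numbers, as an item of a list. -/
def pairText (p : ℕ × ℕ) : List Γ' :=
  Γ'.bra :: (ones p.1 ++ Γ'.comma :: (ones p.2 ++ [Γ'.comma]))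

namespace PolyComp

variable {α : Type} {sz : α → ℕ} {D : Set α} {Δ : Set (α → List Γ')} {x y : α → List Γ'}
  {f g : α → ℕ}

theorem before (c : Γ') (hx : PolyComp sz D Δ x) : PolyComp sz D Δ fun a => before c (x a) :=
  hx.takeWhile _

theorem after (c : Γ') (hx : PolyComp sz D Δ x) : PolyComp sz D Δ fun a => after c (x a) :=
  (hx.dropWhile _).tail

/-- A form of `PolyComp.iterate` in which the step may use all strings that are computable from
`Δ`. -/
theorem iterate_lift (hf : PolyComp sz D Δ fun a => ones (f a)) (acc : α → ℕ → List Γ')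
    (hacc : PolyBounded (fun p : α × ℕ => sz p.1) {p | p.1 ∈ D ∧ p.2 ≤ f p.1}
      fun p => (acc p.1 p.2).length)
    (h₀ : PolyComp sz D Δ fun a => acc a 0)
    (hstep : ∀ Δ' : Set (α × ℕ → List Γ'),
      (∀ x, PolyComp sz D Δ x →
        PolyComp (fun p : α × ℕ => sz p.1) {p | p.1 ∈ D ∧ p.2 < f p.1} Δ' fun p => x p.1) →
      PolyComp (fun p : α × ℕ => sz p.1) {p | p.1 ∈ D ∧ p.2 < f p.1} Δ' (fun p => ones p.2) →
      PolyComp (fun p : α × ℕ => sz p.1) {p | p.1 ∈ D ∧ p.2 < f p.1} Δ'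
        (fun p => acc p.1 p.2) →
      PolyComp (fun p : α × ℕ => sz p.1) {p | p.1 ∈ D ∧ p.2 < f p.1} Δ'
        fun p => acc p.1 (p.2 + 1)) :
    PolyComp sz D Δ fun a => acc a (f a) :=
  of_bounded fun hΔ => hf.iterate acc hacc h₀ (hstep _
    (fun _ hx => (hx.comap Prod.fst (fun _ hp => hp.1) hΔ).weaken
      ((Set.subset_insert _ _).trans (Set.subset_insert _ _)))
    (of_mem (Or.inr (Or.inl rfl))) (of_mem (Or.inl rfl)))

/-- A form of `PolyComp.flatMap_range` in which the body may use all strings that are computable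
from `Δ`. -/
theorem flatMap_range_lift (hf : PolyComp sz D Δ fun a => ones (f a)) {body : α → ℕ → List Γ'}
    (hbody : ∀ Δ' : Set (α × ℕ → List Γ'),
      (∀ x, PolyComp sz D Δ x →
        PolyComp (fun p : α × ℕ => sz p.1) {p | p.1 ∈ D ∧ p.2 < f p.1} Δ' fun p => x p.1) →
      PolyComp (fun p : α × ℕ => sz p.1) {p | p.1 ∈ D ∧ p.2 < f p.1} Δ' (fun p => ones p.2) →
      PolyComp (fun p : α × ℕ => sz p.1) {p | p.1 ∈ D ∧ p.2 < f p.1} Δ'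
        fun p => body p.1 p.2) :
    PolyComp sz D Δ fun a => (List.range (f a)).flatMap (body a) :=
  of_bounded fun hΔ => hf.flatMap_range (hbody _
    (fun _ hx => (hx.comap Prod.fst (fun _ hp => hp.1) hΔ).weaken (Set.subset_insert _ _))
    (of_mem (Or.inl rfl)))

/-- The value at `g` of a function given by its table. -/
theorem table_get {F : α → ℕ → ℕ} (hF : PolyComp sz D Δ fun a => table (F a) (f a))
    (hg : PolyComp sz D Δ fun a => ones (g a)) (hgf : ∀ a ∈ D, g a < f a) :
    PolyComp sz D Δ fun a => ones (F a (g a)) := by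
  have hcons : ∀ a, ∀ i < f a, ((List.range (f a)).drop i).flatMap
      (fun x => ones (F a x) ++ [Γ'.comma]) = ones (F a i) ++ Γ'.comma ::
        ((List.range (f a)).drop (i + 1)).flatMap fun x => ones (F a x) ++ [Γ'.comma] := by
    intro a i hi
    rw [List.drop_eq_getElem_cons (by simpa using hi)]
    simp
  have h : PolyComp sz D Δ fun a => ((List.range (f a)).drop (g a)).flatMap
      fun x => ones (F a x) ++ [Γ'.comma] := by
    refine of_bounded fun hΔ => hg.iterate_lift (fun a i => ((List.range (f a)).drop i).flatMap
      fun x => ones (F a x) ++ [Γ'.comma]) ?_ (hF.congr fun a _ => by simp [table])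
        fun Δ' _ _ hacc => (hacc.after .comma).congr fun p hp => ?_
    · refine ((hF.bounded hΔ).comap Prod.fst fun p hp => hp.1).mono fun p _ => ?_
      exact (List.Sublist.flatMap (List.drop_sublist _ _) _).length_le
    · rw [hcons _ _ (hp.2.trans (hgf _ hp.1)), after_append (by simp)]
  refine (h.before .comma).congr fun a ha => ?_
  rw [hcons _ _ (hgf a ha), before_append (by simp)]

theorem pairText (hf : PolyComp sz D Δ fun a => ones (f a))
    (hg : PolyComp sz D Δ fun a => ones (g a)) :
    PolyComp sz D Δ fun a => pairText (f a, g a) :=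
  (hf.append ((hg.append (const _)).cons _)).cons _

end PolyComp

theorem encodeUnary_eq (k : ℕ) : encodeUnary k = ones k ++ [Γ'.comma] := by
  simp [encodeUnary, ones]

theorem encodeBinary_eq (k : ℕ) : encodeBinary k = binary k ++ [Γ'.comma] := rfl

/-! ### The input of the reduction -/

namespace MaxAvgCutInstance

/-- The description of the edges from the edge `j` on and of the threshold. -/
def edgesFrom (I : MaxAvgCutInstance) (j : ℕ) : List Γ' :=
  (I.rawEdges.drop j).flatMap (fun e => Γ'.bra :: (ones e.1 ++ Γ'.comma :: (ones e.2.1 ++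
    Γ'.comma :: [Γ'.bit (decide (e.2.2 = 1))]))) ++ Γ'.ket ::
      (Γ'.bit (decide (0 ≤ I.kNum)) :: (binary I.kNum.natAbs ++ Γ'.comma ::
        (binary I.kDen ++ [Γ'.comma])))

variable {I : MaxAvgCutInstance}

theorem encode_eq : I.encode = ones I.n ++ Γ'.comma :: I.edgesFrom 0 := by
  simp [encode, encodePair, encodeList, encodeSign, encodeInt, encodeUnary_eq, encodeBinary_eq,
    edgesFrom, rawEdges]

theorem edgesFrom_eq {j : ℕ} (hj : j < I.numEdges) : I.edgesFrom j =
    Γ'.bra :: (ones (I.fst j) ++ Γ'.comma :: (ones (I.snd j) ++ Γ'.comma ::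
      Γ'.bit (decide (I.weight j = 1)) :: I.edgesFrom (j + 1))) := by
  rw [edgesFrom, List.drop_eq_getElem_cons (by rwa [length_rawEdges])]
  simp [edgesFrom, fst, snd, weight, rawEdges, show j < I.edges.length from hj]

theorem edgesFrom_numEdges : I.edgesFrom I.numEdges =
    Γ'.ket :: (Γ'.bit (decide (0 ≤ I.kNum)) :: (binary I.kNum.natAbs ++ Γ'.comma ::
        (binary I.kDen ++ [Γ'.comma]))) := by
  rw [edgesFrom, List.drop_of_length_le length_rawEdges.le]
  rfl

theorem dropWhile_edgesFrom (j : ℕ) :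
    (I.edgesFrom j).dropWhile (fun c => c ≠ Γ'.bra ∧ c ≠ Γ'.ket) = I.edgesFrom j := by
  rcases lt_or_ge j I.numEdges with h | h
  · rw [edgesFrom_eq h]
    rfl
  · rw [edgesFrom, List.drop_of_length_le (by rwa [length_rawEdges])]
    rfl

/-- Apart from its leading `bra`, an item consists of bits and commas, so the next `bra` or `ket`
marks the start of the remainder. -/
theorem edgesFrom_succ {j : ℕ} (hj : j < I.numEdges) : I.edgesFrom (j + 1) =
    (I.edgesFrom j).tail.dropWhile fun c => c ≠ Γ'.bra ∧ c ≠ Γ'.ket := by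
  have h : ∀ k l, (ones k ++ Γ'.comma :: l).dropWhile (fun c => c ≠ Γ'.bra ∧ c ≠ Γ'.ket) =
      l.dropWhile fun c => c ≠ Γ'.bra ∧ c ≠ Γ'.ket := fun k l => by
    rw [List.dropWhile_append_of_pos]
    · simp
    · intro c hc
      simp [List.eq_of_mem_replicate hc]
  rw [edgesFrom_eq hj, List.tail_cons, h, h, List.dropWhile_cons_of_pos (by simp),
    dropWhile_edgesFrom]

theorem length_edgesFrom_le (j : ℕ) : (I.edgesFrom j).length ≤ I.encode.length := by
  have h := (List.Sublist.flatMap (List.drop_sublist j I.rawEdges) fun e =>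
    Γ'.bra :: (ones e.1 ++ Γ'.comma :: (ones e.2.1 ++
      Γ'.comma :: [Γ'.bit (decide (e.2.2 = 1))]))).length_le
  rw [encode_eq]
  simp only [edgesFrom, List.length_append, List.length_cons, List.drop_zero] at h ⊢
  omega

/-- Each edge is announced by one `bra`, and this symbol occurs nowhere else; so the machine can
count the edges. -/
theorem count_edgesFrom {j k : ℕ} (h : j + k = I.numEdges) : (I.edgesFrom j).count Γ'.bra = k := by
  have h1 : ∀ k, (ones k).count Γ'.bra = 0 := fun k => List.count_eq_zero.2 (by simp)
  have h2 : ∀ k, (binary k).count Γ'.bra = 0 := fun k => List.count_eq_zero.2 (by simp)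
  induction k generalizing j with
  | zero =>
    obtain rfl : j = I.numEdges := h
    rw [edgesFrom_numEdges]
    simp [h2]
  | succ k ih =>
    rw [edgesFrom_eq (by omega)]
    simp [h1, ih (j := j + 1) (by omega)]

/-- Needed to bound the length of the table of labels. -/
theorem label_lt {x j : ℕ} (hx : x < I.n) (hj : j ≤ I.numEdges) : label I.fst I.snd j x < I.n := by
  induction j generalizing x with
  | zero => exact hx
  | succ j ih =>
    rw [label]
    split_ifs
    · exact ih (fst_lt j hj) (by omega)
    · exact ih hx (by omega)

/-! ### Reading the data of an instance from its encoding -/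

section

variable {α : Type} {sz : α → ℕ} {D : Set α} {Δ : Set (α → List Γ')} {I : α → MaxAvgCutInstance}
  {f g : α → ℕ}

theorem polyComp_n (hI : PolyComp sz D Δ fun a => (I a).encode) :
    PolyComp sz D Δ fun a => ones (I a).n :=
  (hI.before .comma).congr fun a _ => by rw [encode_eq, before_append (by simp)]

theorem polyComp_edgesFrom_zero (hI : PolyComp sz D Δ fun a => (I a).encode) :
    PolyComp sz D Δ fun a => (I a).edgesFrom 0 :=
  (hI.after .comma).congr fun a _ => by rw [encode_eq, after_append (by simp)]

theorem polyComp_numEdges (hI : PolyComp sz D Δ fun a => (I a).encode) :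
    PolyComp sz D Δ fun a => ones (I a).numEdges :=
  ((polyComp_edgesFrom_zero hI).count .bra).congr fun a _ => by rw [count_edgesFrom (zero_add _)]

theorem polyComp_edgesFrom (hI : PolyComp sz D Δ fun a => (I a).encode)
    (hf : PolyComp sz D Δ fun a => ones (f a)) (hfm : ∀ a ∈ D, f a ≤ (I a).numEdges) :
    PolyComp sz D Δ fun a => (I a).edgesFrom (f a) := by
  refine .of_bounded fun hΔ => hf.iterate_lift (fun a j => (I a).edgesFrom j) ?_
    (polyComp_edgesFrom_zero hI) fun Δ' _ _ hacc => (hacc.tail.dropWhile _).congr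
      fun p hp => edgesFrom_succ (hp.2.trans_le (hfm _ hp.1))
  exact ((hI.bounded hΔ).comap Prod.fst fun p hp => hp.1).mono fun p _ => length_edgesFrom_le _

theorem polyComp_fst (hI : PolyComp sz D Δ fun a => (I a).encode)
    (hf : PolyComp sz D Δ fun a => ones (f a)) (hfm : ∀ a ∈ D, f a < (I a).numEdges) :
    PolyComp sz D Δ fun a => ones ((I a).fst (f a)) :=
  ((polyComp_edgesFrom hI hf fun a ha => (hfm a ha).le).tail.before .comma).congr fun a ha => by
    rw [edgesFrom_eq (hfm a ha), List.tail_cons, before_append (by simp)]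

theorem polyComp_snd (hI : PolyComp sz D Δ fun a => (I a).encode)
    (hf : PolyComp sz D Δ fun a => ones (f a)) (hfm : ∀ a ∈ D, f a < (I a).numEdges) :
    PolyComp sz D Δ fun a => ones ((I a).snd (f a)) :=
  (((polyComp_edgesFrom hI hf fun a ha => (hfm a ha).le).tail.after .comma).before .comma).congr
    fun a ha => by
      rw [edgesFrom_eq (hfm a ha), List.tail_cons, after_append (by simp), before_append (by simp)]

theorem polyComp_ite_weight (hI : PolyComp sz D Δ fun a => (I a).encode)
    (hf : PolyComp sz D Δ fun a => ones (f a)) (hfm : ∀ a ∈ D, f a < (I a).numEdges)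
    {x y : α → List Γ'} (hx : PolyComp sz D Δ x) (hy : PolyComp sz D Δ y) :
    PolyComp sz D Δ fun a => if (I a).weight (f a) = 1 then x a else y a := by
  refine (((polyComp_edgesFrom hI hf fun a ha => (hfm a ha).le).tail.after .comma).after
    .comma).cond_head (.bit true) (fun a ha => ?_) hx hy
  rw [edgesFrom_eq (hfm a ha), List.tail_cons, after_append (by simp), after_append (by simp)]
  simp

theorem polyComp_threshold (hI : PolyComp sz D Δ fun a => (I a).encode) :
    PolyComp sz D Δ fun a => Γ'.bit (decide (0 ≤ (I a).kNum)) :: (binary (I a).kNum.natAbs ++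
      Γ'.comma :: (binary (I a).kDen ++ [Γ'.comma])) :=
  (polyComp_edgesFrom hI (polyComp_numEdges hI) fun _ _ => le_rfl).tail.congr fun a _ => by
    rw [edgesFrom_numEdges, List.tail_cons]

theorem polyComp_natAbs_kNum (hI : PolyComp sz D Δ fun a => (I a).encode) :
    PolyComp sz D Δ fun a => binary (I a).kNum.natAbs :=
  ((polyComp_threshold hI).tail.before .comma).congr fun a _ => by
    rw [List.tail_cons, before_append (by simp)]

theorem polyComp_kDen (hI : PolyComp sz D Δ fun a => (I a).encode) :
    PolyComp sz D Δ fun a => binary (I a).kDen :=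
  (((polyComp_threshold hI).tail.after .comma).before .comma).congr fun a _ => by
    rw [List.tail_cons, after_append (by simp), before_append (by simp)]

/-! ### The output of the reduction -/

/-- The factor 2 is absorbed into the power of two, whence the exponent m + 2. -/
theorem polyComp_boundNum (hI : PolyComp sz D Δ fun a => (I a).encode) :
    PolyComp sz D Δ fun a => binary (I a).boundNum :=
  ((polyComp_kDen hI).binary_mul_two_pow (polyComp_numEdges hI).succ.succ).congr fun a _ => by
    rw [boundNum]
    congr 1
    ring

/-- The integer expression is rewritten with natural numbers, where `toNat` becomes truncated
subtraction, which `PolyComp.binary_sub` computes. -/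
theorem boundDen_of_nonneg {I : MaxAvgCutInstance} (h : 0 ≤ I.kNum) : I.boundDen = I.boundNum +
    (I.kDen * 2 ^ (I.numEdges + 1) + 1 - I.kNum.natAbs * 2 ^ (I.numEdges + 1)) := by
  rw [boundDen, boundNum]
  congr 1
  conv_lhs => rw [← Int.natAbs_of_nonneg h]
  generalize 2 ^ (I.numEdges + 1) = r
  rw [← Nat.cast_mul, ← Nat.cast_mul, ← Nat.cast_succ, Int.toNat_sub]

theorem boundDen_of_neg {I : MaxAvgCutInstance} (h : ¬ 0 ≤ I.kNum) : I.boundDen = I.boundNum +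
    (I.kDen * 2 ^ (I.numEdges + 1) + 1 + I.kNum.natAbs * 2 ^ (I.numEdges + 1)) := by
  rw [boundDen, boundNum]
  congr 1
  have : I.kNum = -(I.kNum.natAbs : ℤ) := by omega
  conv_lhs => rw [this]
  rw [neg_mul, sub_neg_eq_add]
  norm_cast

theorem polyComp_boundDen (hI : PolyComp sz D Δ fun a => (I a).encode) :
    PolyComp sz D Δ fun a => binary (I a).boundDen := by
  have hm := (polyComp_numEdges hI).succ
  have hb := ((polyComp_kDen hI).binary_mul_two_pow hm).binary_add
    (g := fun _ => 1) (.const (binary 1))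
  have ha := (polyComp_natAbs_kNum hI).binary_mul_two_pow hm
  refine ((polyComp_threshold hI).cond_head (P := fun a => 0 ≤ (I a).kNum) (.bit true)
    (fun a _ => by simp) ((polyComp_boundNum hI).binary_add (hb.binary_sub ha))
    ((polyComp_boundNum hI).binary_add (hb.binary_add ha))).congr fun a _ => ?_
  split_ifs with h
  · rw [boundDen_of_nonneg h]
  · rw [boundDen_of_neg h]

/-- A label after edge j depends on the earlier labels of three vertices. The loop therefore carries
the table of all labels; its n entries are less than n, so it stays short. -/
theorem polyComp_label_table (hI : PolyComp sz D Δ fun a => (I a).encode)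
    (hf : PolyComp sz D Δ fun a => ones (f a)) (hfm : ∀ a ∈ D, f a ≤ (I a).numEdges) :
    PolyComp sz D Δ fun a => table (label (I a).fst (I a).snd (f a)) (I a).n := by
  refine .of_bounded fun hΔ => hf.iterate_lift
    (fun a j => table (label (I a).fst (I a).snd j) (I a).n) ?_ ?_ fun Δ' lift hj hacc => ?_
  · have hn := ((polyComp_n hI).bounded hΔ).comap (Prod.fst : α × ℕ → α)
      (D' := {p | p.1 ∈ D ∧ p.2 ≤ f p.1}) fun p hp => hp.1
    refine (hn.mul (hn.add (.const 1))).mono fun p hp => ?_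
    simp only [table, List.length_flatMap, List.length_append, length_ones, List.length_singleton]
    refine (List.sum_le_card_nsmul _ ((I p.1).n + 1) ?_).trans (by simp)
    simp only [List.mem_map, List.mem_range]
    rintro _ ⟨x, hx, rfl⟩
    exact Nat.succ_le_succ (label_lt hx (hp.2.trans (hfm _ hp.1))).le
  · exact (polyComp_n hI).flatMap_range_lift fun Δ' _ hx => hx.append (.const _)
  · have hI' := lift _ hI
    have hu := polyComp_fst hI' hj fun p hp => hp.2.trans_le (hfm _ hp.1)
    have hv := polyComp_snd hI' hj fun p hp => hp.2.trans_le (hfm _ hp.1)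
    have hlu := hacc.table_get hu fun p hp => fst_lt _ (hp.2.trans_le (hfm _ hp.1))
    have hlv := hacc.table_get hv fun p hp => snd_lt _ (hp.2.trans_le (hfm _ hp.1))
    refine (polyComp_n hI').flatMap_range_lift fun Δ'' lift' hx => ?_
    have hlx := (lift' _ hacc).table_get hx fun q hq => hq.2
    exact ((hlx.ite_eq (lift' _ hlv) (lift' _ hlu) hlx).append (.const [Γ'.comma])).congr
      fun q _ => by
        rw [label]
        split_ifs <;> rfl

theorem polyComp_slot (hI : PolyComp sz D Δ fun a => (I a).encode)
    (hf : PolyComp sz D Δ fun a => ones (f a)) :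
    PolyComp sz D Δ fun a => ones (slot (I a).n (I a).numEdges (f a)) :=
  ((((PolyComp.number 10).mul (polyComp_numEdges hI).succ).succ.add hf).mul (polyComp_n hI))

theorem polyComp_treeBlock (hI : PolyComp sz D Δ fun a => (I a).encode)
    (hf : PolyComp sz D Δ fun a => ones (f a)) (hfm : ∀ a ∈ D, f a < (I a).numEdges) :
    PolyComp sz D Δ fun a =>
      (treeBlock (I a).n (I a).numEdges (I a).fst (I a).snd (f a)).flatMap pairText := by
  have hu := polyComp_fst hI hf hfm
  have hv := polyComp_snd hI hf hfm
  have hs := polyComp_slot hI hf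
  have ht := polyComp_label_table hI hf fun a ha => (hfm a ha).le
  have hlu := ht.table_get hu fun a ha => fst_lt _ (hfm a ha)
  have hlv := ht.table_get hv fun a ha => snd_lt _ (hfm a ha)
  refine ((hu.pairText (hs.add hv)).append ((polyComp_n hI).flatMap_range_lift
    (body := fun a x => if x = (I a).snd (f a) then
      if label (I a).fst (I a).snd (f a) ((I a).fst (f a)) =
        label (I a).fst (I a).snd (f a) ((I a).snd (f a)) then []
      else pairText (x, slot (I a).n (I a).numEdges (f a) + x)
      else pairText (x, slot (I a).n (I a).numEdges (f a) + x)) fun Δ' lift hx => ?_)).congr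
    fun a _ => ?_
  · have hp := hx.pairText ((lift _ hs).add hx)
    exact hx.ite_eq (lift _ hv) ((lift _ hlu).ite_eq (lift _ hlv) .nil hp) hp
  · rw [treeBlock, List.flatMap_cons, List.flatMap_assoc]
    congr 2
    funext x
    split_ifs <;> simp

theorem polyComp_treeList (hI : PolyComp sz D Δ fun a => (I a).encode) :
    PolyComp sz D Δ fun a =>
      (treeList (I a).n (I a).numEdges (I a).fst (I a).snd).flatMap pairText := by
  have hn := polyComp_n hI
  have hm := polyComp_numEdges hI
  refine ((((PolyComp.number 10).mul hm.succ).flatMap_range_lift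
    (body := fun a i => (List.range (I a).n).flatMap fun x =>
      pairText (i * (I a).n + x, (i + 1) * (I a).n + x)) fun Δ' lift hi => ?_).append
    (hm.flatMap_range_lift (body := fun a j =>
      (treeBlock (I a).n (I a).numEdges (I a).fst (I a).snd j).flatMap pairText)
      fun Δ' lift hj => ?_)).congr fun a _ => ?_
  · refine (lift _ hn).flatMap_range_lift fun Δ'' lift' hx => ?_
    have hn' := lift' _ (lift _ hn)
    have hi' := lift' _ hi
    exact ((hi'.mul hn').add hx).pairText ((hi'.succ.mul hn').add hx)
  · exact polyComp_treeBlock (lift _ hI) hj fun p hp => hp.2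
  · simp [treeList, List.flatMap_assoc]

theorem polyComp_minusList (hI : PolyComp sz D Δ fun a => (I a).encode) :
    PolyComp sz D Δ fun a =>
      (minusList (I a).n (I a).numEdges (I a).fst (I a).snd (I a).weight).flatMap pairText := by
  refine ((polyComp_numEdges hI).flatMap_range_lift (body := fun a j =>
    if (I a).weight j = 1 then [] else
      pairText ((I a).snd j, slot (I a).n (I a).numEdges j + (I a).fst j))
      fun Δ' lift hj => ?_).congr fun a _ => ?_
  · have hI' := lift _ hI
    have hlt : ∀ p ∈ {p : α × ℕ | p.1 ∈ D ∧ p.2 < (I p.1).numEdges}, p.2 < (I p.1).numEdges :=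
      fun p hp => hp.2
    exact polyComp_ite_weight hI' hj hlt .nil ((polyComp_snd hI' hj hlt).pairText
      ((polyComp_slot hI' hj).add (polyComp_fst hI' hj hlt)))
  · rw [minusList, List.flatMap_assoc]
    congr 1
    funext j
    split_ifs <;> simp

theorem polyComp_levels (hI : PolyComp sz D Δ fun a => (I a).encode) :
    PolyComp sz D Δ fun a => ones (levels (I a).numEdges) :=
  (PolyComp.number 11).mul (polyComp_numEdges hI).succ

theorem polyComp_cliqueList (hI : PolyComp sz D Δ fun a => (I a).encode) :
    PolyComp sz D Δ fun a => (cliqueList (I a).n (I a).numEdges).flatMap pairText := by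
  have hn := polyComp_n hI
  refine ((polyComp_levels hI).flatMap_range_lift
    (body := fun a i => (List.range i).flatMap fun d => (List.range (I a).n).flatMap fun x =>
      pairText (d * (I a).n + x, i * (I a).n + x)) fun Δ' lift hi => ?_).congr fun a _ => ?_
  · refine hi.flatMap_range_lift fun Δ'' lift' hd => ?_
    refine (lift' _ (lift _ hn)).flatMap_range_lift fun Δ''' lift'' hx => ?_
    have hn' := lift'' _ (lift' _ (lift _ hn))
    exact (((lift'' _ hd).mul hn').add hx).pairText (((lift'' _ (lift' _ hi)).mul hn').add hx)
  · simp [cliqueList, List.flatMap_assoc]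

theorem encode_reduction (I : MaxAvgCutInstance) : I.reduction.encode =
    ones (I.n * levels I.numEdges) ++ Γ'.comma ::
      (((treeList I.n I.numEdges I.fst I.snd).flatMap pairText ++
        ((minusList I.n I.numEdges I.fst I.snd I.weight).flatMap pairText ++
          ((cliqueList I.n I.numEdges).flatMap pairText ++ Γ'.ket ::
            ((treeList I.n I.numEdges I.fst I.snd).flatMap pairText ++ Γ'.ket ::
              (binary I.boundNum ++ Γ'.comma :: (binary I.boundDen ++ [Γ'.comma]))))))) := by
  have h : (fun p : ℕ × ℕ => Γ'.bra :: encodePair encodeUnary encodeUnary p) = pairText := by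
    funext p
    simp [encodePair, encodeUnary_eq, pairText]
  simp only [ThinTreeInstance.encode, reduction, map_val_finPairs]
  simp [encodePair, encodeUnary_eq, encodeBinary_eq, encodeList, ← h, graphList]

theorem polyComp_encode_reduction (hI : PolyComp sz D Δ fun a => (I a).encode) :
    PolyComp sz D Δ fun a => (I a).reduction.encode :=
  (((polyComp_n hI).mul (polyComp_levels hI)).append (((polyComp_treeList hI).append
    ((polyComp_minusList hI).append ((polyComp_cliqueList hI).append (((polyComp_treeList hI).append
      (((polyComp_boundNum hI).append (((polyComp_boundDen hI).append
        (.const [Γ'.comma])).cons .comma)).cons .ket)).cons .ket)))).cons .comma)).congr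
    fun a _ => encode_reduction (I a)

end

end MaxAvgCutInstance

/-! ### The polynomial-time reduction -/

theorem theorem4 : DecisionProblem.KarpReducible MaxAvgCut ThinTreeValid.compl :=
  ⟨MaxAvgCutInstance.reduction, PolyComp.nonempty_computableInPolyTime
    (MaxAvgCutInstance.polyComp_encode_reduction (.of_mem rfl)), MaxAvgCutInstance.yes_iff⟩
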